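/- Let $k$ be a field. A dg algebra (dga) is a unital associative $\mathbf Z$-graded $k$-algebra $F=\bigoplus_i F^i$ with a differential $d$ of degree $+1$, $d^2=0$, $d(ab)=da\,b+(-1)^{|a|}a\,db$. For a dga $F$ and a dg $F$-bimodule $M$, let $C^\bullet(F,M)=\prod_{n\ge 0}\underline{\mathrm{Hom}}(F[1]^{\otimes n},M)$ (product and inner Hom of $\mathbf Z$-graded spaces, $F[1]^i=F^{i+1}$) be the cohomological Hochschild complex: a cochain of degree $m$ is a family $c=(c_n)_{n\ge0}$ of multilinear maps $c_n:F^n\to M$ with $|c_n(a_1,\dots,a_n)|=\sum_i(|a_i|-1)+m$ for homogeneous $a_i$, and $$(\delta c)_n(a_1,\dots,a_n)=(-1)^{m|a_1|}a_1c_{n-1}(a_2,\dots,a_n)+\sum_{i=1}^{n-1}(-1)^{i+|a_1|+\dots+|a_i|}c_{n-1}(\dots,a_ia_{i+1},\dots)+(-1)^{n+|a_1|+\dots+|a_{n-1}|}c_{n-1}(a_1,\dots,a_{n-1})a_n$$ $$\qquad+(-1)^m d\,c_n(a_1,\dots,a_n)+\sum_{i=1}^n(-1)^{i-1+|a_1|+\dots+|a_{i-1}|}c_n(\dots,da_i,\dots)$$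 (the first line being absent for $n=0$). **Lemma.** Let $\phi:\tilde F\to F$ be a homomorphism of dg algebras that is a quasi-isomorphism (it induces an isomorphism of cohomology groups), and regard $F$ as a dg bimodule over $\tilde F$ via $\phi$. (1) The natural chain maps, given by composition with $\phi$ in the values and in the arguments respectively, $$C^\bullet(\tilde F,\tilde F)\longrightarrow C^\bullet(\tilde F,F)\longleftarrow C^\bullet(F,F)$$ are both quasi-isomorphisms; in particular $C^\bullet(\tilde F,\tilde F)$ and $C^\bullet(F,F)$ are quasi-isomorphic. (2) Suppose that $k$ has characteristic $0$ and that $\tilde F$ and $F$ are supercommutative, $ab=(-1)^{|a||b|}ba$. Let $e_n(j)$ be the Eulerian idempotents, $\sum_j x^je_n(j)=\frac1{n!}\sum_{\sigma\in S_n}(x-d_\sigma)(x-d_\sigma+1)\cdots(x-d_\sigma+n-1)\,\mathrm{sgn}(\sigma)\,\sigma$, where $d_\sigma$ is the number of descents of $\sigma$ and $\mathrm{sgn}(\sigma)\sigma$ acts on $F[1]^{\otimes n}$ by moving the $i$-th factor to the place $\sigma(i)$ with the Koszul sign of $F[1]^{\otimes n}$ (this is $\mathrm{sgn}(\sigma)$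 if $F$ is concentrated in degree $0$). For each of the three complexes $C^\bullet$ in (1) and each $j\ge0$, let $C^\bullet_{(j)}\subset C^\bullet$ consist of the cochains $c$ with $c_n\circ e_n(j)=c_n$ for all $n$. Then these are subcomplexes and $C^\bullet=\prod_jC^\bullet_{(j)}$ (the Hodge decomposition; $C^\bullet_{(1)}$ is the Harrison complex): every cochain $c$ of degree $m$ is, for a unique sequence $c_{(j)}\in C^m_{(j)}$, given by $c_n=\sum_{j\le n}(c_{(j)})_n$ for all $n$. The two chain maps in (1) preserve this decomposition, and for every $j$ they restrict to quasi-isomorphisms $$C^\bullet_{(j)}(\tilde F,\tilde F)\longrightarrow C^\bullet_{(j)}(\tilde F,F)\longleftarrow C^\bullet_{(j)}(F,F).$$ -/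

import Mathlib

open CategoryTheory

universe u v

noncomputable section

namespace DGHochschild

/-- The sign `(-1) ^ m` for an integer `m`, as an integer. -/
def sg (m : ℤ) : ℤ := (m.negOnePow : ℤ)

@[simp] lemma sg_zero : sg 0 = 1 := by simp [sg]
@[simp] lemma sg_one : sg 1 = -1 := by simp [sg]
lemma sg_add (a b : ℤ) : sg (a + b) = sg a * sg b := by simp [sg, Int.negOnePow_add]
lemma sg_succ (a : ℤ) : sg (a + 1) = -sg a := by simp [sg_add]
lemma sg_mul_self (a : ℤ) : sg a * sg a = 1 := by
  rw [← sg_add, ← two_mul]; simp [sg, Int.negOnePow_two_mul]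
lemma sg_sub (a b : ℤ) : sg (a - b) = sg a * sg b := by simp [sg, Int.negOnePow_sub]

section SignMap

variable {K : Type u} [Field K] {V : Type v} [AddCommGroup V] [Module K V]
  (𝒱 : ℤ → Submodule K V) [DirectSum.Decomposition 𝒱]

/-- The linear map of a graded vector space that multiplies an element of degree `i` by
`(-1) ^ (m * i)`. -/
def signMap (m : ℤ) : V →ₗ[K] V :=
  (DirectSum.toModule K ℤ V fun i => sg (m * i) • (𝒱 i).subtype) ∘ₗ
    (DirectSum.decomposeLinearEquiv 𝒱).toLinearMap

lemma signMap_apply (m : ℤ) {i : ℤ} {a : V} (ha : a ∈ 𝒱 i) :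
    signMap 𝒱 m a = sg (m * i) • a := by
  have := DirectSum.decomposeLinearEquiv_apply_coe 𝒱 i ⟨a, ha⟩
  simp only at this
  simp [signMap, this, DirectSum.toModule_lof]

lemma signMap_mem (m : ℤ) {i : ℤ} {a : V} (ha : a ∈ 𝒱 i) : signMap 𝒱 m a ∈ 𝒱 i := by
  rw [signMap_apply 𝒱 m ha]
  exact zsmul_mem ha _

/-- Two linear maps that agree on homogeneous elements are equal. -/
lemma ext_of_homogeneous {W : Type*} [AddCommGroup W] [Module K W] {f g : V →ₗ[K] W}
    (h : ∀ i, ∀ a ∈ 𝒱 i, f a = g a) (a : V) : f a = g a := by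
  induction a using DirectSum.Decomposition.inductionOn 𝒱 with
  | zero => simp
  | homogeneous a => exact h _ _ a.2
  | add a b ha hb => simp [ha, hb]

lemma signMap_add (m n : ℤ) (a : V) : signMap 𝒱 (m + n) a = signMap 𝒱 m (signMap 𝒱 n a) := by
  refine ext_of_homogeneous 𝒱 (f := signMap 𝒱 (m + n))
    (g := signMap 𝒱 m ∘ₗ signMap 𝒱 n) (fun i a ha => ?_) a
  simp [signMap_apply 𝒱 _ ha, add_mul, sg_add, mul_smul, smul_comm (sg (m * i))]

lemma signMap_one_one (a : V) : signMap 𝒱 1 (signMap 𝒱 1 a) = a := by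
  refine ext_of_homogeneous 𝒱 (f := signMap 𝒱 1 ∘ₗ signMap 𝒱 1)
    (g := LinearMap.id) (fun i a ha => ?_) a
  simp [signMap_apply 𝒱 _ ha, ← mul_smul, sg_mul_self]

lemma signMap_comp_of_degree_one {d : V →ₗ[K] V} (hd : ∀ {i a}, a ∈ 𝒱 i → d a ∈ 𝒱 (i + 1))
    (m : ℤ) (a : V) : signMap 𝒱 m (d a) = sg m • d (signMap 𝒱 m a) := by
  refine ext_of_homogeneous 𝒱 (f := signMap 𝒱 m ∘ₗ d)
    (g := sg m • d ∘ₗ signMap 𝒱 m) (fun i a ha => ?_) a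
  simp [signMap_apply 𝒱 _ ha, signMap_apply 𝒱 _ (hd ha), mul_add, sg_add, mul_smul,
    smul_comm (sg (m * i))]

end SignMap

/-- A (unital, associative) differential `ℤ`-graded algebra over the field `K`, with differential
of degree `+1`. -/
structure DGAlgebra (K : Type u) [Field K] where
  carrier : Type v
  [ring : Ring carrier]
  [algebra : Algebra K carrier]
  /-- the homogeneous components -/
  gr : ℤ → Submodule K carrier
  [graded : GradedAlgebra gr]
  /-- the differential -/
  d : carrier →ₗ[K] carrier
  d_mem : ∀ {i a}, a ∈ gr i → d a ∈ gr (i + 1)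
  d_d : ∀ a, d (d a) = 0
  leibniz : ∀ {i a} (b : carrier), a ∈ gr i → d (a * b) = d a * b + sg i • (a * d b)

namespace DGAlgebra

variable {K : Type u} [Field K]

instance : CoeSort (DGAlgebra.{u, v} K) (Type v) := ⟨DGAlgebra.carrier⟩

attribute [instance] DGAlgebra.ring DGAlgebra.algebra DGAlgebra.graded

/-- The underlying cochain complex of `K`-vector spaces. -/
def toComplex (F : DGAlgebra.{u, v} K) : CochainComplex (ModuleCat.{v} K) ℤ :=
  CochainComplex.of (fun i => ModuleCat.of K (F.gr i))
    (fun i => ModuleCat.ofHom (F.d.restrict (p := F.gr i) (q := F.gr (i + 1)) fun _ h => F.d_mem h))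
    (fun i => by ext x; exact F.d_d x)

/-- Graded commutativity: `a b = (-1)^{|a| |b|} b a` for homogeneous `a`, `b`. -/
def IsSupercommutative (F : DGAlgebra.{u, v} K) : Prop :=
  ∀ ⦃i j : ℤ⦄ ⦃a b : F⦄, a ∈ F.gr i → b ∈ F.gr j → a * b = sg (i * j) • (b * a)

/-- A homomorphism of differential graded algebras. -/
structure Hom (F G : DGAlgebra.{u, v} K) where
  toAlgHom : F →ₐ[K] G
  map_mem : ∀ {i a}, a ∈ F.gr i → toAlgHom a ∈ G.gr i
  map_d : ∀ a, toAlgHom (F.d a) = G.d (toAlgHom a)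

/-- The morphism of cochain complexes underlying a homomorphism of differential graded algebras. -/
def Hom.toComplexHom {F G : DGAlgebra.{u, v} K} (φ : Hom F G) : F.toComplex ⟶ G.toComplex :=
  CochainComplex.ofHom
    (fun i => ModuleCat.ofHom
      (φ.toAlgHom.toLinearMap.restrict (p := F.gr i) (q := G.gr i) fun _ h => φ.map_mem h))
    (fun i => by
      simp only [toComplex, CochainComplex.of_d]
      refine ModuleCat.hom_ext (LinearMap.ext fun x => Subtype.ext ?_)
      exact (φ.map_d x).symm)

/-- A homomorphism of differential graded algebras is a quasi-isomorphism if it induces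
isomorphisms of all cohomology groups. -/
def Hom.IsQuasiIso {F G : DGAlgebra.{u, v} K} (φ : Hom F G) : Prop :=
  QuasiIso φ.toComplexHom

variable (F : DGAlgebra.{u, v} K)

/-- Multiplication of elements of degree `i` by `(-1) ^ (m * i)`. -/
def sgn (m : ℤ) : F →ₗ[K] F := signMap F.gr m

/-- The parity automorphism: multiplication of elements of degree `i` by `(-1) ^ i`. -/
def eps : F →ₗ[K] F := F.sgn 1

lemma sgn_mul (m : ℤ) (a b : F) : F.sgn m (a * b) = F.sgn m a * F.sgn m b := by
  refine ext_of_homogeneous F.gr (f := F.sgn m ∘ₗ LinearMap.mulRight K b)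
    (g := LinearMap.mulRight K (F.sgn m b) ∘ₗ F.sgn m) (fun i a ha => ?_) a
  refine ext_of_homogeneous F.gr (f := F.sgn m ∘ₗ LinearMap.mulLeft K a)
    (g := LinearMap.mulLeft K (F.sgn m a) ∘ₗ F.sgn m) (fun j b hb => ?_) b
  simp [sgn, signMap_apply F.gr _ ha, signMap_apply F.gr _ hb, -zsmul_eq_mul,
    signMap_apply F.gr _ (SetLike.mul_mem_graded ha hb), mul_add, sg_add, mul_smul]
  exact smul_comm _ _ _

lemma eps_mul (a b : F) : F.eps (a * b) = F.eps a * F.eps b := F.sgn_mul 1 a b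
@[simp] lemma eps_eps (a : F) : F.eps (F.eps a) = a := signMap_one_one F.gr a
lemma sgn_succ (m : ℤ) (a : F) : F.sgn (m + 1) a = F.sgn m (F.eps a) := signMap_add F.gr m 1 a
lemma sgn_d (m : ℤ) (a : F) : F.sgn m (F.d a) = sg m • F.d (F.sgn m a) :=
  signMap_comp_of_degree_one F.gr F.d_mem m a
lemma eps_d (a : F) : F.eps (F.d a) = -F.d (F.eps a) := by
  simpa [eps] using F.sgn_d 1 a
lemma eps_sgn (m : ℤ) (a : F) : F.eps (F.sgn m a) = F.sgn m (F.eps a) := by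
  rw [← sgn_succ, add_comm]; exact (signMap_add F.gr 1 m a).symm
lemma eps_mem {i : ℤ} {a : F} (ha : a ∈ F.gr i) : F.eps a ∈ F.gr i := signMap_mem F.gr 1 ha
lemma sgn_mem (m : ℤ) {i : ℤ} {a : F} (ha : a ∈ F.gr i) : F.sgn m a ∈ F.gr i :=
  signMap_mem F.gr m ha
lemma eps_apply {i : ℤ} {a : F} (ha : a ∈ F.gr i) : F.eps a = sg i • a := by
  simpa [eps, sgn, -zsmul_eq_mul] using signMap_apply F.gr 1 ha
lemma d_mul (a b : F) : F.d (a * b) = F.d a * b + F.eps a * F.d b := by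
  refine ext_of_homogeneous F.gr (f := F.d ∘ₗ LinearMap.mulRight K b)
    (g := LinearMap.mulRight K b ∘ₗ F.d + LinearMap.mulRight K (F.d b) ∘ₗ F.eps)
    (fun i a ha => ?_) a
  simp [F.leibniz b ha, F.eps_apply ha, -zsmul_eq_mul]

variable {F} in
lemma Hom.map_sgn {G : DGAlgebra.{u, v} K} (φ : Hom F G) (m : ℤ) (a : F) :
    φ.toAlgHom (F.sgn m a) = G.sgn m (φ.toAlgHom a) := by
  refine ext_of_homogeneous F.gr (f := φ.toAlgHom.toLinearMap ∘ₗ F.sgn m)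
    (g := G.sgn m ∘ₗ φ.toAlgHom.toLinearMap) (fun i a ha => ?_) a
  simp [sgn, signMap_apply F.gr _ ha, signMap_apply G.gr _ (φ.map_mem ha)]

end DGAlgebra

variable {K : Type u} [Field K]

/-- A differential graded bimodule over the differential graded algebra `F`; `lact a x` is `a x`
and `ract x a` is `x a`. -/
structure DGBimodule (F : DGAlgebra.{u, v} K) where
  carrier : Type v
  [addCommGroup : AddCommGroup carrier]
  [module : Module K carrier]
  /-- the homogeneous components -/
  gr : ℤ → Submodule K carrier
  [decomposition : DirectSum.Decomposition gr]
  /-- the differential -/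
  d : carrier →ₗ[K] carrier
  d_mem : ∀ {i x}, x ∈ gr i → d x ∈ gr (i + 1)
  d_d : ∀ x, d (d x) = 0
  /-- the left action of `F` -/
  lact : F →ₗ[K] carrier →ₗ[K] carrier
  /-- the right action of `F` -/
  ract : carrier →ₗ[K] F →ₗ[K] carrier
  one_lact : ∀ x, lact 1 x = x
  mul_lact : ∀ a b x, lact (a * b) x = lact a (lact b x)
  ract_one : ∀ x, ract x 1 = x
  ract_mul : ∀ x a b, ract x (a * b) = ract (ract x a) b
  lact_ract : ∀ a x b, ract (lact a x) b = lact a (ract x b)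
  lact_mem : ∀ {i j a x}, a ∈ F.gr i → x ∈ gr j → lact a x ∈ gr (i + j)
  ract_mem : ∀ {i j x a}, x ∈ gr i → a ∈ F.gr j → ract x a ∈ gr (i + j)
  leibniz_left : ∀ {i a} (x : carrier), a ∈ F.gr i →
    d (lact a x) = lact (F.d a) x + sg i • lact a (d x)
  leibniz_right : ∀ {i x} (a : F), x ∈ gr i →
    d (ract x a) = ract (d x) a + sg i • ract x (F.d a)

namespace DGBimodule

attribute [instance] DGBimodule.addCommGroup DGBimodule.module DGBimodule.decomposition

instance {F : DGAlgebra.{u, v} K} : CoeSort (DGBimodule F) (Type v) := ⟨DGBimodule.carrier⟩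

/-- A differential graded algebra as a bimodule over itself. -/
@[reducible]
def regular (F : DGAlgebra.{u, v} K) : DGBimodule F where
  carrier := F
  gr := F.gr
  d := F.d
  d_mem := F.d_mem
  d_d := F.d_d
  lact := LinearMap.mul K F
  ract := LinearMap.mul K F
  one_lact := by simp
  mul_lact := by simp [mul_assoc]
  ract_one := by simp
  ract_mul := by simp [mul_assoc]
  lact_ract := by simp [mul_assoc]
  lact_mem := fun ha hx => SetLike.mul_mem_graded ha hx
  ract_mem := fun ha hx => SetLike.mul_mem_graded ha hx
  leibniz_left := by intro i a x ha; simpa [-zsmul_eq_mul] using F.leibniz x ha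
  leibniz_right := by intro i x a hx; simpa [-zsmul_eq_mul] using F.leibniz a hx

/-- Restriction of a bimodule along a homomorphism of differential graded algebras. -/
@[reducible]
def restrict {F G : DGAlgebra.{u, v} K} (φ : F.Hom G) (M : DGBimodule G) : DGBimodule F where
  carrier := M
  gr := M.gr
  d := M.d
  d_mem := M.d_mem
  d_d := M.d_d
  lact := M.lact ∘ₗ φ.toAlgHom.toLinearMap
  ract := M.ract.compl₂ φ.toAlgHom.toLinearMap
  one_lact := by simp [M.one_lact]
  mul_lact := by simp [M.mul_lact]
  ract_one := by simp [M.ract_one]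
  ract_mul := by simp [M.ract_mul]
  lact_ract := by simp [M.lact_ract]
  lact_mem := fun ha hx => M.lact_mem (φ.map_mem ha) hx
  ract_mem := fun hx ha => M.ract_mem hx (φ.map_mem ha)
  leibniz_left := by intro i a x ha; simpa [φ.map_d] using M.leibniz_left x (φ.map_mem ha)
  leibniz_right := by intro i x a hx; simpa [φ.map_d] using M.leibniz_right (φ.toAlgHom a) hx

/-- A homomorphism (of degree `0`, compatible with all structure) of differential graded
bimodules. -/
structure Hom {F : DGAlgebra.{u, v} K} (M N : DGBimodule F) where
  toLinearMap : M →ₗ[K] N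
  map_mem : ∀ {i x}, x ∈ M.gr i → toLinearMap x ∈ N.gr i
  map_d : ∀ x, toLinearMap (M.d x) = N.d (toLinearMap x)
  map_lact : ∀ a x, toLinearMap (M.lact a x) = N.lact a (toLinearMap x)
  map_ract : ∀ x a, toLinearMap (M.ract x a) = N.ract (toLinearMap x) a

/-- A homomorphism `φ : F → G` of differential graded algebras, as a homomorphism of
`F`-bimodules. -/
def homOfAlgHom {F G : DGAlgebra.{u, v} K} (φ : F.Hom G) :
    Hom (regular F) (restrict φ (regular G)) where
  toLinearMap := φ.toAlgHom.toLinearMap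
  map_mem := φ.map_mem
  map_d := φ.map_d
  map_lact := fun a x => map_mul φ.toAlgHom a x
  map_ract := fun x a => map_mul φ.toAlgHom x a

variable {F : DGAlgebra.{u, v} K} (M : DGBimodule F)

/-- The parity automorphism of a bimodule. -/
def eps : M →ₗ[K] M := signMap M.gr 1

lemma eps_apply {i : ℤ} {x : M} (hx : x ∈ M.gr i) : M.eps x = sg i • x := by
  simpa [eps] using signMap_apply M.gr 1 hx

lemma d_lact (a : F) (x : M) : M.d (M.lact a x) = M.lact (F.d a) x + M.lact (F.eps a) (M.d x) := by
  refine ext_of_homogeneous F.gr (f := M.d ∘ₗ M.lact.flip x)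
    (g := M.lact.flip x ∘ₗ F.d + M.lact.flip (M.d x) ∘ₗ F.eps) (fun i a ha => ?_) a
  simp [M.leibniz_left x ha, F.eps_apply ha, -zsmul_eq_mul]

lemma d_ract (x : M) (a : F) : M.d (M.ract x a) = M.ract (M.d x) a + M.ract (M.eps x) (F.d a) := by
  refine ext_of_homogeneous M.gr (f := M.d ∘ₗ M.ract.flip a)
    (g := M.ract.flip a ∘ₗ M.d + M.ract.flip (F.d a) ∘ₗ M.eps) (fun i x hx => ?_) x
  simp [M.leibniz_right a hx, M.eps_apply hx]

end DGBimodule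

section Cochains

variable {F : DGAlgebra.{u, v} K} (M : DGBimodule F)

/-- Families `(c_n)_{n ≥ 0}` of multilinear maps `F^n → M`, without any condition on degrees. -/
abbrev Fam : Type v := ∀ n : ℕ, MultilinearMap K (fun _ : Fin n => (F : Type v)) M

/-- Insertion of the differential at the `i`-th place of a multilinear map:
`(a_0, …, a_{n-1}) ↦ c (ε a_0, …, ε a_{i-1}, d a_i, a_{i+1}, …, a_{n-1})`, where `ε` is the parity
automorphism. On homogeneous arguments this is
`(-1)^{|a_0| + ⋯ + |a_{i-1}|} c (a_0, …, d a_i, …, a_{n-1})`. -/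
def dAt {n : ℕ} (i : Fin n) (c : MultilinearMap K (fun _ : Fin n => (F : Type v)) M) :
    MultilinearMap K (fun _ : Fin n => (F : Type v)) M :=
  c.compLinearMap fun j => if j < i then F.eps else if j = i then F.d else LinearMap.id

/-- The tuple `(ε a_0, …, ε a_{i-1}, ε a_i * a_{i+1}, a_{i+2}, …, a_n)`. -/
def contract {n : ℕ} (i : Fin n) (a : Fin (n + 1) → F) : Fin n → F := fun j =>
  if j < i then F.eps (a j.castSucc)
  else if j = i then F.eps (a i.castSucc) * a i.succ
  else a j.succ

lemma contract_update {n : ℕ} (i : Fin n) (l : Fin (n + 1)) :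
    ∃ (k : Fin n), ∀ a : Fin (n + 1) → F, ∃ (g : F →ₗ[K] F), ∀ x : F,
      contract i (Function.update a l x) = Function.update (contract i a) k (g x) := by
  rcases lt_trichotomy l i.castSucc with h | h | h
  · obtain ⟨k, rfl⟩ : ∃ k : Fin n, l = k.castSucc :=
      ⟨l.castLT (lt_trans h i.castSucc_lt_last), rfl⟩
    have hk : k < i := by simpa using h
    refine ⟨k, fun a => ⟨F.eps, fun x => ?_⟩⟩
    ext j
    rcases eq_or_ne j k with rfl | hj
    · simp [contract, hk]
    · have h1 : j.castSucc ≠ k.castSucc := by simpa using hj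
      have h2 : j.succ ≠ k.castSucc ∨ j < i := by
        by_contra! hc
        have : (j : ℕ) + 1 = k := by simpa using congrArg Fin.val hc.1
        have := hc.2; simp only [Fin.lt_def, Fin.le_def] at *; omega
      have h3 : i.castSucc ≠ k.castSucc := by simpa using hk.ne'
      have h4 : i.succ ≠ k.castSucc := by
        intro hc
        have : (i : ℕ) + 1 = k := by simpa using congrArg Fin.val hc
        simp only [Fin.lt_def] at *; omega
      simp only [contract, Function.update_of_ne hj, Function.update_of_ne h1,
        Function.update_of_ne h3, Function.update_of_ne h4]
      rcases h2 with h2 | h2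
      · rw [Function.update_of_ne h2]
      · simp [h2]
  · subst h
    refine ⟨i, fun a => ⟨LinearMap.mulRight K (a i.succ) ∘ₗ F.eps, fun x => ?_⟩⟩
    ext j
    have h4 : i.succ ≠ i.castSucc := by simp [Fin.ext_iff]
    rcases eq_or_ne j i with rfl | hj
    · simp [contract, Function.update_of_ne h4]
    · have h1 : j.castSucc ≠ i.castSucc := by simpa using hj
      have h2 : j.succ ≠ i.castSucc ∨ j < i := by
        by_contra! hc
        have : (j : ℕ) + 1 = i := by simpa using congrArg Fin.val hc.1
        have := hc.2; simp only [Fin.le_def] at *; omega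
      simp only [contract, Function.update_of_ne hj, Function.update_of_ne h1, hj, if_false]
      rcases h2 with h2 | h2
      · rw [Function.update_of_ne h2]
      · simp [h2]
  · obtain ⟨k, rfl⟩ : ∃ k : Fin n, l = k.succ :=
      ⟨l.pred (Fin.ne_zero_of_lt h), by simp⟩
    have hk : i ≤ k := by simp only [Fin.lt_def, Fin.le_def, Fin.val_castSucc, Fin.val_succ] at *; omega
    rcases hk.eq_or_lt with rfl | hk
    · refine ⟨i, fun a => ⟨LinearMap.mulLeft K (F.eps (a i.castSucc)), fun x => ?_⟩⟩
      ext j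
      have h4 : i.castSucc ≠ i.succ := by simp [Fin.ext_iff]
      rcases eq_or_ne j i with rfl | hj
      · simp [contract, Function.update_of_ne h4]
      · have h1 : j.succ ≠ i.succ := by simpa using hj
        have h2 : j < i → j.castSucc ≠ i.succ := by
          intro hji hc
          have : (j : ℕ) = i + 1 := by simpa using congrArg Fin.val hc
          simp only [Fin.lt_def] at *; omega
        simp only [contract, Function.update_of_ne hj, Function.update_of_ne h1, hj, if_false]
        split_ifs with h3
        · rw [Function.update_of_ne (h2 h3)]
        · rfl
    · refine ⟨k, fun a => ⟨LinearMap.id, fun x => ?_⟩⟩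
      ext j
      rcases eq_or_ne j k with rfl | hj
      · simp [contract, hk.not_gt, hk.ne']
      · have h1 : j.succ ≠ k.succ := by simpa using hj
        have h2 : j < i → j.castSucc ≠ k.succ := by
          intro hji hc
          have : (j : ℕ) = k + 1 := by simpa using congrArg Fin.val hc
          simp only [Fin.lt_def] at *; omega
        have h3 : i.castSucc ≠ k.succ := by
          intro hc
          have : (i : ℕ) = k + 1 := by simpa using congrArg Fin.val hc
          simp only [Fin.lt_def] at *; omega
        have h4 : i.succ ≠ k.succ := by simpa using hk.ne
        simp only [contract, Function.update_of_ne hj, Function.update_of_ne h1,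
          Function.update_of_ne h3, Function.update_of_ne h4]
        split_ifs with h3
        · rw [Function.update_of_ne (h2 h3)]
        · rfl
        · rfl

/-- Insertion of the product at the `i`-th place of a multilinear map:
`(a_0, …, a_n) ↦ c (ε a_0, …, ε a_{i-1}, ε a_i * a_{i+1}, a_{i+2}, …, a_n)`. On homogeneous
arguments this is `(-1)^{|a_0| + ⋯ + |a_i|} c (a_0, …, a_i a_{i+1}, …, a_n)`. -/
def mulAt {n : ℕ} (i : Fin n) (c : MultilinearMap K (fun _ : Fin n => (F : Type v)) M) :
    MultilinearMap K (fun _ : Fin (n + 1) => (F : Type v)) M :=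
  MultilinearMap.mk' (fun a => c (contract i a))
    (fun a l x y => by
      obtain ⟨k, hk⟩ := contract_update (F := F) i l
      obtain ⟨g, hg⟩ := hk a
      simp [hg])
    (fun a l r x => by
      obtain ⟨k, hk⟩ := contract_update (F := F) i l
      obtain ⟨g, hg⟩ := hk a
      simp [hg])

/-- `(a_0, …, a_n) ↦ (-1)^{m |a_0|} a_0 c (a_1, …, a_n)`. -/
def leftTerm (m : ℤ) {n : ℕ} (c : MultilinearMap K (fun _ : Fin n => (F : Type v)) M) :
    MultilinearMap K (fun _ : Fin (n + 1) => (F : Type v)) M :=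
  LinearMap.uncurryLeft
    { toFun := fun x => (M.lact (F.sgn m x)).compMultilinearMap c
      map_add' := by intros; ext; simp
      map_smul' := by intros; ext; simp }

/-- `(a_0, …, a_n) ↦ (-1)^{|a_0| + ⋯ + |a_{n-1}|} c (a_0, …, a_{n-1}) a_n`. -/
def rightTerm {n : ℕ} (c : MultilinearMap K (fun _ : Fin n => (F : Type v)) M) :
    MultilinearMap K (fun _ : Fin (n + 1) => (F : Type v)) M :=
  (M.ract.compMultilinearMap (c.compLinearMap fun _ => F.eps)).uncurryRight

/-- The part of the Hochschild differential that comes from the products, on families of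
degree `m`: its component with `n + 1` arguments is
`(-1)^{m |a_0|} a_0 c_n (a_1, …, a_n)
  + ∑_{i < n} (-1)^{i + 1 + |a_0| + ⋯ + |a_i|} c_n (a_0, …, a_i a_{i+1}, …, a_n)
  + (-1)^{n + 1 + |a_0| + ⋯ + |a_{n-1}|} c_n (a_0, …, a_{n-1}) a_n`. -/
def mulPart (m : ℤ) (c : Fam M) : Fam M
  | 0 => 0
  | n + 1 => leftTerm M m (c n) + ∑ i : Fin n, sg (i + 1) • mulAt M i (c n)
      + sg (n + 1) • rightTerm M (c n)

/-- The part of the Hochschild differential that comes from the differentials of `F` and `M`, on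
families of degree `m`: its component with `n` arguments is
`(-1)^m d (c_n (a_0, …, a_{n-1}))
  + ∑_{i < n} (-1)^{i + |a_0| + ⋯ + |a_{i-1}|} c_n (a_0, …, d a_i, …, a_{n-1})`. -/
def internalPart (m : ℤ) (c : Fam M) : Fam M := fun n =>
  sg m • M.d.compMultilinearMap (c n) + ∑ i : Fin n, sg i • dAt M i (c n)

/-! ### The square of the differential -/

def opI (m : ℤ) : Fam M →ₗ[K] Fam M where
  toFun c n := sg m • M.d.compMultilinearMap (c n)
  map_add' c c' := by funext n; ext a; simp
  map_smul' r c := by funext n; ext a; simp [smul_comm r]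

def opD : Fam M →ₗ[K] Fam M where
  toFun c n := ∑ i : Fin n, sg i • dAt M i (c n)
  map_add' c c' := by
    funext n; ext a; simp [dAt, Finset.sum_add_distrib]
  map_smul' r c := by
    funext n; ext a; simp [dAt, Finset.smul_sum, smul_comm r]

def opL (m : ℤ) : Fam M →ₗ[K] Fam M where
  toFun c n := match n with
    | 0 => 0
    | n + 1 => leftTerm M m (c n)
  map_add' c c' := by funext n; cases n <;> ext a <;> simp [leftTerm]
  map_smul' r c := by funext n; cases n <;> ext a <;> simp [leftTerm]

def opR : Fam M →ₗ[K] Fam M where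
  toFun c n := match n with
    | 0 => 0
    | n + 1 => sg (n + 1) • rightTerm M (c n)
  map_add' c c' := by funext n; cases n <;> ext a <;> simp [rightTerm]
  map_smul' r c := by funext n; cases n <;> ext a <;> simp [rightTerm, smul_comm r]

def opB : Fam M →ₗ[K] Fam M where
  toFun c n := match n with
    | 0 => 0
    | n + 1 => ∑ i : Fin n, sg (i + 1) • mulAt M i (c n)
  map_add' c c' := by
    funext n; cases n <;> ext a <;>
      simp [mulAt, Finset.sum_add_distrib]
  map_smul' r c := by
    funext n; cases n <;> ext a <;>
      simp [mulAt, Finset.smul_sum, smul_comm r]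

lemma parts_eq (m : ℤ) (c : Fam M) : mulPart M m c + internalPart M m c
    = (opI M m + opD M + opL M m + opB M + opR M) c := by
  funext n
  cases n <;> simp [mulPart, internalPart, opI, opD, opL, opB, opR]; abel

/-- The Hochschild differential on families of degree `m`: the sum of the part that comes from the
products and the part that comes from the differentials. -/
def delta (m : ℤ) : Fam M →ₗ[K] Fam M where
  toFun c := mulPart M m c + internalPart M m c
  map_add' c c' := by simp only [parts_eq, map_add]
  map_smul' r c := by simp only [parts_eq, map_smul, RingHom.id_apply]

lemma delta_eq (m : ℤ) : delta M m = opI M m + opD M + opL M m + opB M + opR M :=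
  LinearMap.ext fun c => parts_eq M m c

def lc (x : F) : Fam M →ₗ[K] Fam M where
  toFun c n := (c (n + 1)).curryLeft x
  map_add' c c' := by funext n; ext a; simp
  map_smul' r c := by funext n; ext a; simp

lemma lc_apply (x : F) (c : Fam M) (n : ℕ) (a : Fin n → F) :
    lc M x c n a = c (n + 1) (Fin.cons x a) := rfl

lemma fam_add_apply (c c' : Fam M) (n : ℕ) (a : Fin n → F) : (c + c') n a = c n a + c' n a := rfl
lemma fam_sub_apply (c c' : Fam M) (n : ℕ) (a : Fin n → F) : (c - c') n a = c n a - c' n a := rfl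
lemma fam_neg_apply (c : Fam M) (n : ℕ) (a : Fin n → F) : (-c) n a = -c n a := rfl

lemma lc_add (x y : F) (c : Fam M) : lc M (x + y) c = lc M x c + lc M y c := by
  funext n; ext a; simp [lc]

lemma lc_neg (x : F) (c : Fam M) : lc M (-x) c = -lc M x c := by
  funext n; ext a; simp [lc]

lemma lc_zero (c : Fam M) : lc M 0 c = 0 := by
  funext n; ext a; simp [lc]

lemma fam_ext {c c' : Fam M} (h0 : c 0 = c' 0) (h : ∀ x, lc M x c = lc M x c') : c = c' := by
  funext n
  cases n with
  | zero => exact h0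
  | succ n =>
    ext a
    have := congrArg (fun e : Fam M => e n (Fin.tail a)) (h (a 0))
    simpa [lc_apply] using this

/-- multiplication of the first argument by `z` -/
def mm (z : F) (c : Fam M) : Fam M := fun n => match n with
  | 0 => 0
  | n + 1 => ((c (n + 1)).curryLeft ∘ₗ LinearMap.mulLeft K z).uncurryLeft

lemma lc_mm (y z : F) (c : Fam M) : lc M y (mm M z c) = lc M (z * y) c := by
  funext n; ext a; simp [lc, mm]

lemma mm_zero (z : F) (c : Fam M) : mm M z c 0 = 0 := rfl

lemma opD_apply (c : Fam M) (n : ℕ) (a : Fin n → F) : opD M c n a = ∑ i : Fin n, sg i •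
    c n (fun j => if j < i then F.eps (a j) else if j = i then F.d (a j) else a j) := by
  simp only [opD, dAt, LinearMap.coe_mk, AddHom.coe_mk, sum_apply, smul_apply,
    MultilinearMap.compLinearMap_apply]
  refine Finset.sum_congr rfl fun i _ => ?_
  congr 2
  funext j
  split_ifs <;> rfl

lemma opB_apply (c : Fam M) (n : ℕ) (a : Fin (n + 1) → F) : opB M c (n + 1) a =
    ∑ i : Fin n, sg (i + 1) • c n (contract i a) := by
  simp [opB, mulAt]

lemma lc_opD (x : F) (c : Fam M) :
    lc M x (opD M c) = lc M (F.d x) c - opD M (lc M (F.eps x) c) := by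
  funext n; ext a
  rw [fam_sub_apply]
  simp only [lc_apply, opD_apply, Fin.sum_univ_succ, sub_eq_add_neg, ← Finset.sum_neg_distrib]
  congr 1
  · simp only [Fin.val_zero, Nat.cast_zero, sg_zero, one_smul]
    congr 1
    funext j
    refine Fin.cases ?_ (fun j => ?_) j <;> simp
  · refine Finset.sum_congr rfl fun i _ => ?_
    simp only [Fin.val_succ, Nat.cast_succ, sg_succ, neg_smul]
    congr 3
    funext j
    refine Fin.cases ?_ (fun j => ?_) j <;> simp

lemma lc_opB (x : F) (c : Fam M) :
    lc M x (opB M c) = -opB M (lc M (F.eps x) c) - mm M (F.eps x) c := by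
  funext n; ext a
  cases n with
  | zero => simp [lc_apply, opB_apply, mm_zero]; simp [opB]
  | succ n =>
    rw [fam_sub_apply, fam_neg_apply]
    simp only [lc_apply, opB_apply, Fin.sum_univ_succ, sub_eq_add_neg,
      ← Finset.sum_neg_distrib]
    rw [add_comm]
    congr 1
    · refine Finset.sum_congr rfl fun i _ => ?_
      simp only [Fin.val_succ, Nat.cast_succ, sg_succ _, neg_smul, neg_neg]
      congr 3
      funext j
      refine Fin.cases ?_ (fun j => ?_) j
      · simp [contract]
      · simp [contract]
    · simp only [Fin.val_zero, Nat.cast_zero, zero_add, sg_one, neg_smul, one_smul]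
      congr 1
      simp only [mm, LinearMap.uncurryLeft_apply, LinearMap.comp_apply,
        MultilinearMap.curryLeft_apply, LinearMap.mulLeft_apply]
      congr 1
      funext j
      refine Fin.cases ?_ (fun j => ?_) j
      · simp [contract]
      · simp [contract, Fin.tail]

lemma opD_zero (c : Fam M) : opD M c 0 = 0 := by ext a; simp [opD_apply]
lemma opB_zero (c : Fam M) : opB M c 0 = 0 := rfl

def opP : Fam M →ₗ[K] Fam M := opD M + opB M

lemma opP_zero (c : Fam M) : opP M c 0 = 0 := by simp [opP, opD_zero, opB_zero]

lemma lc_opP (x : F) (c : Fam M) :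
    lc M x (opP M c) = lc M (F.d x) c - opP M (lc M (F.eps x) c) - mm M (F.eps x) c := by
  simp only [opP, LinearMap.add_apply, map_add, lc_opD, lc_opB]; abel

lemma opP_mm (x : F) (c : Fam M) :
    opP M (mm M x c) = mm M (F.eps x) (opP M c) + mm M (F.eps (F.d x)) c := by
  refine fam_ext M ?_ fun y => ?_
  · simp [opP_zero, mm_zero]
  · have h : mm M (F.eps y) (mm M x c) = mm M (F.eps (F.eps x * y)) c := by
      refine fam_ext M (by simp [mm_zero]) fun z => ?_
      simp [lc_mm, F.eps_mul, mul_assoc]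
    simp only [map_add, lc_opP, lc_mm, h, F.d_mul, F.eps_d, F.eps_mul, F.eps_eps, lc_add, neg_mul,
      lc_neg]
    abel

lemma opP_opP (c : Fam M) : opP M (opP M c) = 0 := by
  have key : ∀ n : ℕ, ∀ c : Fam M, opP M (opP M c) n = 0 := by
    intro n
    induction n with
    | zero => intro c; simp [opP_zero]
    | succ n ih =>
      intro c
      ext a
      have h : lc M (a 0) (opP M (opP M c)) = opP M (opP M (lc M (a 0) c)) := by
        simp only [lc_opP, map_sub, F.d_d, lc_zero, F.eps_eps, opP_mm, F.eps_d, lc_neg, map_neg]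
        abel
      have h' := congrArg (fun e : Fam M => e n (Fin.tail a)) h
      simp only [ih] at h'
      simpa [lc_apply] using h'
  funext n
  exact key n c

def post (f : M →ₗ[K] M) : Fam M →ₗ[K] Fam M where
  toFun c n := f.compMultilinearMap (c n)
  map_add' c c' := by funext n; ext a; simp
  map_smul' r c := by funext n; ext a; simp

lemma post_apply (f : M →ₗ[K] M) (c : Fam M) (n : ℕ) (a : Fin n → F) :
    post M f c n a = f (c n a) := rfl

lemma opP_post (f : M →ₗ[K] M) (c : Fam M) : opP M (post M f c) = post M f (opP M c) := by
  funext n; ext a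
  cases n with
  | zero => simp [post_apply, opP_zero]
  | succ n =>
    simp only [opP, LinearMap.add_apply, fam_add_apply, opD_apply, opB_apply, post_apply, map_add,
      map_sum, map_zsmul]

lemma opI_eq (m : ℤ) (c : Fam M) : opI M m c = sg m • post M M.d c := rfl

lemma opI_opI (m : ℤ) (c : Fam M) : opI M (m + 1) (opI M m c) = 0 := by
  funext n; ext a
  simp [opI, M.d_d]

lemma opI_opP (m : ℤ) (c : Fam M) : opI M (m + 1) (opP M c) + opP M (opI M m c) = 0 := by
  simp only [opI_eq, map_zsmul, opP_post, sg_succ, neg_smul, neg_add_cancel]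

lemma opL_zero (m : ℤ) (c : Fam M) : opL M m c 0 = 0 := rfl
lemma opR_zero (c : Fam M) : opR M c 0 = 0 := rfl

lemma opL_apply (m : ℤ) (c : Fam M) (n : ℕ) (a : Fin (n + 1) → F) :
    opL M m c (n + 1) a = M.lact (F.sgn m (a 0)) (c n (Fin.tail a)) := rfl

lemma lc_opL (m : ℤ) (x : F) (c : Fam M) :
    lc M x (opL M m c) = post M (M.lact (F.sgn m x)) c := rfl

lemma mm_opL (m : ℤ) (z : F) (c : Fam M) :
    mm M z (opL M m c) = post M (M.lact (F.sgn m z)) (opL M m c) := by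
  refine fam_ext M ?_ fun y => ?_
  · ext a; simp [mm_zero, post_apply, opL_zero]
  · rw [lc_mm, lc_opL]
    funext n; ext a
    simp [lc_apply, post_apply, opL_apply, F.sgn_mul, M.mul_lact]

lemma left_identity (m : ℤ) (c : Fam M) :
    opI M (m + 1) (opL M m c) + opL M (m + 1) (opI M m c) + opP M (opL M m c)
      + opL M (m + 1) (opP M c) + opL M (m + 1) (opL M m c) = 0 := by
  refine fam_ext M ?_ fun x => ?_
  · ext a; simp [opI, opL_zero, opP_zero]
  · simp only [map_add, lc_opP, lc_opL, mm_opL, map_zero, opP_post, F.sgn_succ, opI_eq, map_zsmul]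
    have h : lc M x (post M M.d (opL M m c)) =
        post M (M.lact (F.d (F.sgn m x))) c + post M (M.lact (F.sgn m (F.eps x))) (post M M.d c) := by
      funext n; ext a
      simp [lc_apply, post_apply, opL_apply, M.d_lact, F.eps_sgn]
    have h2 : post M (M.lact (F.sgn m (F.d x))) c =
        sg m • post M (M.lact (F.d (F.sgn m x))) c := by
      funext n; ext a
      simp only [post_apply, F.sgn_d, map_zsmul, LinearMap.smul_apply]
      rfl
    rw [h, h2, sg_succ, neg_smul, smul_add]
    abel

lemma opR_apply (c : Fam M) (n : ℕ) (a : Fin (n + 1) → F) :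
    opR M c (n + 1) a =
      sg (n + 1) • M.ract (c n (fun j => F.eps (a j.castSucc))) (a (Fin.last n)) := rfl

lemma opL_opR (m : ℤ) (c : Fam M) :
    opL M (m + 1) (opR M c) + opR M (opL M m c) = 0 := by
  funext n; ext a
  rcases n with _ | _ | n
  · simp [opL_zero, opR_zero]
  · simp [opL_apply, opR_apply, opL_zero, opR_zero]
  · rw [fam_add_apply, opL_apply, opR_apply, opR_apply, opL_apply, M.lact_ract, map_zsmul,
      F.sgn_succ]
    simp only [Nat.cast_add, Nat.cast_one, sg_succ, neg_smul, neg_neg]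
    exact neg_add_cancel _

def opT : Fam M →ₗ[K] Fam M where
  toFun c n := (c n).compLinearMap fun _ => F.eps
  map_add' c c' := by funext n; ext a; simp
  map_smul' r c := by funext n; ext a; simp

lemma opT_apply (c : Fam M) (n : ℕ) (a : Fin n → F) : opT M c n a = c n (fun j => F.eps (a j)) :=
  rfl

lemma lc_opT (x : F) (c : Fam M) : lc M x (opT M c) = opT M (lc M (F.eps x) c) := by
  funext n; ext a
  simp only [lc_apply, opT_apply]
  congr 1
  funext j
  refine Fin.cases ?_ (fun j => ?_) j <;> simp

lemma opD_opT (c : Fam M) : opD M (opT M c) = -opT M (opD M c) := by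
  have key : ∀ n : ℕ, ∀ c : Fam M, opD M (opT M c) n = -opT M (opD M c) n := by
    intro n
    induction n with
    | zero => intro c; ext a; simp [opD_zero, opT_apply]
    | succ n ih =>
      intro c
      ext a
      have h : lc M (a 0) (opD M (opT M c)) + lc M (a 0) (opT M (opD M c)) =
          -(opD M (opT M (lc M (a 0) c)) + opT M (opD M (lc M (a 0) c))) := by
        simp only [lc_opD, lc_opT, map_sub, F.eps_d, F.eps_eps, lc_neg, map_neg]
        abel
      have h' := congrArg (fun e : Fam M => e n (Fin.tail a)) h
      simp only [fam_add_apply, fam_neg_apply, ih] at h'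
      simp only [lc_apply, Fin.cons_self_tail] at h'
      have h3 : (-(opT M (opD M ((lc M (a 0)) c)) n)) (Fin.tail a)
        = -(opT M (opD M ((lc M (a 0)) c)) n (Fin.tail a)) := rfl
      rw [h3, neg_add_cancel, neg_zero] at h'
      exact eq_neg_of_add_eq_zero_left h'
  funext n
  exact key n c

lemma mm_opT (x : F) (c : Fam M) : mm M (F.eps x) (opT M c) = opT M (mm M x c) := by
  refine fam_ext M ?_ fun y => ?_
  · ext a; simp [mm_zero, opT_apply]
  · simp [lc_mm, lc_opT, F.eps_mul]

lemma opB_opT (c : Fam M) : opB M (opT M c) = opT M (opB M c) := by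
  have key : ∀ n : ℕ, ∀ c : Fam M, opB M (opT M c) n = opT M (opB M c) n := by
    intro n
    induction n with
    | zero => intro c; ext a; simp [opB_zero, opT_apply]
    | succ n ih =>
      intro c
      ext a
      have h : lc M (a 0) (opB M (opT M c)) - lc M (a 0) (opT M (opB M c)) =
          opT M (opB M (lc M (a 0) c)) - opB M (opT M (lc M (a 0) c)) := by
        simp only [lc_opB, lc_opT, map_sub, F.eps_eps, map_neg, mm_opT]
        abel
      have h' := congrArg (fun e : Fam M => e n (Fin.tail a)) h
      simp only [fam_sub_apply, ih, sub_self] at h'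
      simp only [lc_apply, Fin.cons_self_tail] at h'
      exact sub_eq_zero.mp h'
  funext n
  exact key n c

/-- The space of Hochschild cochains of degree `m` of `F` with coefficients in `M`, that is the
degree `m` part of `∏_{n ≥ 0} Hom(F[1]^{⊗ n}, M)`: families of multilinear maps `c_n : F^n → M` such
that `c_n` maps elements of degrees `p_0, …, p_{n-1}` in `F` (hence `p_i - 1` in `F[1]`) to an
element of degree `∑ (p_i - 1) + m`. -/
def cochains (m : ℤ) : Submodule K (Fam M) where
  carrier := {c | ∀ (n : ℕ) (p : Fin n → ℤ) (a : Fin n → F), (∀ i, a i ∈ F.gr (p i)) →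
    c n a ∈ M.gr (∑ i, (p i - 1) + m)}
  add_mem' := fun h h' n p a ha => add_mem (h n p a ha) (h' n p a ha)
  zero_mem' := fun _ _ _ _ => zero_mem _
  smul_mem' := fun r _ h n p a ha => Submodule.smul_mem _ r (h n p a ha)

/-- Two multilinear maps that agree on homogeneous elements are equal. -/
lemma multilinear_ext {W : Type*} [AddCommGroup W] [Module K W] {n : ℕ}
    {f g : MultilinearMap K (fun _ : Fin n => (F : Type v)) W}
    (h : ∀ (p : Fin n → ℤ) (a : Fin n → F), (∀ i, a i ∈ F.gr (p i)) → f a = g a) : f = g := by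
  induction n with
  | zero => ext a; exact h 0 a (fun i => i.elim0)
  | succ n ih =>
    have key : ∀ x, f.curryLeft x = g.curryLeft x := by
      refine ext_of_homogeneous F.gr fun i x hx => ih fun p a ha => ?_
      refine h (Fin.cons i p) (Fin.cons x a) fun j => ?_
      refine Fin.cases ?_ (fun j => ?_) j
      · simpa using hx
      · simpa using ha j
    ext a
    have := congrArg (fun e => e (Fin.tail a)) (key (a 0))
    simpa using this

variable {M}

lemma lc_mem {m i : ℤ} {x : F} {c : Fam M} (hx : x ∈ F.gr i) (hc : c ∈ cochains M m) :
    lc M x c ∈ cochains M (m + i - 1) := by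
  intro n p a ha
  have := hc (n + 1) (Fin.cons i p) (Fin.cons x a) (fun j => by
    refine Fin.cases ?_ (fun j => ?_) j
    · simpa using hx
    · simpa using ha j)
  rw [Fin.sum_univ_succ] at this
  simp only [Fin.cons_zero, Fin.cons_succ] at this
  rw [lc_apply]
  convert this using 2
  ring

lemma eps_cochain {m : ℤ} {c : Fam M} (hc : c ∈ cochains M m) (n : ℕ) (a : Fin n → F) :
    M.eps (c n a) = sg (m + n) • c n (fun j => F.eps (a j)) := by
  have : M.eps.compMultilinearMap (c n) = sg (m + n) • opT M c n := by
    refine multilinear_ext fun p a ha => ?_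
    have h1 : (fun j => F.eps (a j)) = fun j => (sg (p j) : K) • a j := by
      funext j; rw [F.eps_apply (ha j), Int.cast_smul_eq_zsmul]
    have h2 : ∀ s : Finset (Fin n), sg (∑ i ∈ s, (p i - 1)) = sg s.card * ∏ i ∈ s, sg (p i) := by
      intro s
      induction s using Finset.induction_on with
      | empty => simp
      | insert i s hi ih =>
        simp only [Finset.sum_insert hi, Finset.prod_insert hi, Finset.card_insert_of_notMem hi,
          sg_add, sg_sub, ih, Nat.cast_add, Nat.cast_one]
        ring
    have h3 := h2 Finset.univ
    simp only [Finset.card_univ, Fintype.card_fin] at h3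
    change M.eps (c n a) = sg (m + n) • opT M c n a
    rw [M.eps_apply (hc n p a ha), opT_apply, h1, MultilinearMap.map_smul_univ, sg_add, h3,
      ← Int.cast_prod, Int.cast_smul_eq_zsmul, smul_smul, sg_add]
    congr 1
    ring
  exact congrArg (fun e => e a) this

lemma opI_mem {m : ℤ} {c : Fam M} (hc : c ∈ cochains M m) : opI M m c ∈ cochains M (m + 1) := by
  intro n p a ha
  have := zsmul_mem (M.d_mem (hc n p a ha)) (sg m)
  rwa [add_assoc] at this

lemma opL_mem {m : ℤ} {c : Fam M} (hc : c ∈ cochains M m) : opL M m c ∈ cochains M (m + 1) := by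
  intro n p a ha
  cases n with
  | zero => simp [opL_zero]
  | succ n =>
    rw [opL_apply]
    have := M.lact_mem (F.sgn_mem m (ha 0)) (hc n (fun j => p j.succ) (Fin.tail a)
      (fun j => ha j.succ))
    convert this using 2
    rw [Fin.sum_univ_succ]; ring

lemma opR_mem {m : ℤ} {c : Fam M} (hc : c ∈ cochains M m) : opR M c ∈ cochains M (m + 1) := by
  intro n p a ha
  cases n with
  | zero => simp [opR_zero]
  | succ n =>
    rw [opR_apply]
    have := M.ract_mem (hc n (fun j => p j.castSucc) (fun j => F.eps (a j.castSucc))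
      (fun j => F.eps_mem (ha j.castSucc))) (ha (Fin.last n))
    refine zsmul_mem ?_ _
    convert this using 2
    rw [Fin.sum_univ_castSucc]; ring

lemma opP_mem {m : ℤ} {c : Fam M} (hc : c ∈ cochains M m) : opP M c ∈ cochains M (m + 1) := by
  intro n
  induction n generalizing m c with
  | zero => intro p a ha; simp [opP_zero]
  | succ n ih =>
    intro p a ha
    have h : opP M c (n + 1) a = lc M (a 0) (opP M c) n (Fin.tail a) := by simp [lc_apply]
    rw [h, lc_opP, fam_sub_apply, fam_sub_apply, Fin.sum_univ_succ]
    have ht : ∀ i, Fin.tail a i ∈ F.gr (p i.succ) := fun i => ha i.succ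
    refine sub_mem (sub_mem ?_ ?_) ?_
    · convert lc_mem (F.d_mem (ha 0)) hc n (fun i => p i.succ) (Fin.tail a) ht using 2
      ring
    · convert ih (lc_mem (F.eps_mem (ha 0)) hc) (fun i => p i.succ) (Fin.tail a) ht using 2
      ring
    · cases n with
      | zero => simp [mm_zero]
      | succ n =>
        have h' : mm M (F.eps (a 0)) c (n + 1) (Fin.tail a)
            = lc M (F.eps (a 0) * a 1) c n (Fin.tail (Fin.tail a)) := rfl
        rw [h']
        convert lc_mem (SetLike.mul_mem_graded (F.eps_mem (ha 0)) (ha 1)) hc n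
          (fun i => p i.succ.succ) (Fin.tail (Fin.tail a)) (fun i => ha i.succ.succ) using 2
        rw [Fin.sum_univ_succ, Fin.succ_zero_eq_one]
        ring

lemma delta_eq' (m : ℤ) (c : Fam M) : delta M m c = opI M m c + opP M c + opL M m c + opR M c := by
  rw [delta_eq]; simp only [opP, LinearMap.add_apply]; abel

lemma delta_mem {m : ℤ} {c : Fam M} (hc : c ∈ cochains M m) :
    delta M m c ∈ cochains M (m + 1) := by
  rw [delta_eq']
  exact add_mem (add_mem (add_mem (opI_mem hc) (opP_mem hc)) (opL_mem hc)) (opR_mem hc)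

lemma opD_opR (c : Fam M) (n : ℕ) (a : Fin (n + 1) → F) :
    opD M (opR M c) (n + 1) a =
      sg (n + 1) • M.ract (opD M (opT M c) n (Fin.init a)) (a (Fin.last n))
        - M.ract (c n (Fin.init a)) (F.d (a (Fin.last n))) := by
  rw [opD_apply, Fin.sum_univ_castSucc, opD_apply, map_sum, LinearMap.sum_apply, Finset.smul_sum,
    sub_eq_add_neg]
  congr 1
  · refine Finset.sum_congr rfl fun i _ => ?_
    rw [opR_apply, map_zsmul, LinearMap.smul_apply, smul_comm]
    simp only [opT_apply, Fin.val_castSucc, Fin.castSucc_lt_castSucc_iff, Fin.castSucc_inj]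
    simp [Fin.init, (Fin.castSucc_lt_last i).not_gt, (Fin.castSucc_lt_last i).ne']
  · rw [opR_apply]
    simp [Fin.castSucc_lt_last, smul_smul, sg_succ, sg_mul_self]
    rfl

lemma opB_opR (c : Fam M) (n : ℕ) (a : Fin (n + 2) → F) :
    opB M (opR M c) (n + 2) a =
      sg (n + 1) • M.ract (opB M (opT M c) (n + 1) (Fin.init a)) (a (Fin.last (n + 1)))
        + M.ract (c n (Fin.init (Fin.init a)))
            (F.eps (a (Fin.last n).castSucc) * a (Fin.last (n + 1))) := by
  rw [opB_apply, Fin.sum_univ_castSucc, opB_apply, map_sum, LinearMap.sum_apply, Finset.smul_sum]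
  congr 1
  · refine Finset.sum_congr rfl fun i _ => ?_
    rw [opR_apply, map_zsmul, LinearMap.smul_apply, smul_comm]
    simp only [opT_apply, Fin.val_castSucc]
    congr 3
    · congr 2
      funext j
      simp [contract, Fin.init]
    · simp [contract, (Fin.castSucc_lt_last i).not_gt, (Fin.castSucc_lt_last i).ne']
  · rw [opR_apply]
    simp only [Fin.val_last, smul_smul, sg_mul_self, one_smul]
    simp [contract, Fin.castSucc_lt_last]
    rfl

lemma right_identity {m : ℤ} {c : Fam M} (hc : c ∈ cochains M m) :
    opI M (m + 1) (opR M c) + opR M (opI M m c) + opP M (opR M c)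
      + opR M (opP M c) + opR M (opR M c) = 0 := by
  funext n; ext a
  cases n with
  | zero => simp [opI, opR_zero, opP_zero]
  | succ n =>
    have hI : opI M (m + 1) (opR M c) (n + 1) a + opR M (opI M m c) (n + 1) a
        = M.ract (c n (Fin.init a)) (F.d (a (Fin.last n))) := by
      have h1 : opI M (m + 1) (opR M c) (n + 1) a = sg (m + 1) • M.d (opR M c (n + 1) a) := rfl
      have h2 : opI M m c n (fun j => F.eps (a j.castSucc))
        = sg m • M.d (c n (fun j => F.eps (a j.castSucc))) := rfl
      rw [h1, opR_apply, opR_apply, h2, map_zsmul, M.d_ract, eps_cochain hc]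
      simp only [F.eps_eps, map_zsmul, LinearMap.smul_apply, smul_add, smul_smul]
      have h3 : sg (m + 1) * (sg (n + 1) * sg (m + n)) = 1 := by
        have := sg_mul_self m
        have := sg_mul_self n
        simp only [sg_add, sg_one]
        linear_combination (sg m * sg m) * sg_mul_self n + sg_mul_self m
      have h4 : sg (n + 1) * sg m = - (sg (m + 1) * sg (n + 1)) := by
        simp only [sg_add, sg_one]; ring
      rw [h3, h4, neg_smul, one_smul]
      have hi : Fin.init a = fun j => a j.castSucc := rfl
      rw [hi]
      abel
    have hD : opD M (opR M c) (n + 1) a + opR M (opD M c) (n + 1) a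
        = - M.ract (c n (Fin.init a)) (F.d (a (Fin.last n))) := by
      rw [opD_opR, opD_opT, opR_apply]
      simp only [fam_neg_apply, opT_apply, map_neg, LinearMap.neg_apply, smul_neg, Fin.init]
      abel
    have hB : opB M (opR M c) (n + 1) a + opR M (opB M c) (n + 1) a
        + opR M (opR M c) (n + 1) a = 0 := by
      cases n with
      | zero => rw [opB_apply, opR_apply, opR_apply]; simp [opB_zero, opR_zero]
      | succ n =>
        rw [opB_opR, opB_opT, opR_apply, opR_apply, opR_apply]
        simp only [F.eps_eps, map_zsmul, LinearMap.smul_apply, smul_smul, Nat.cast_add,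
          Nat.cast_one, sg_succ (n + 1), neg_smul, neg_mul, sg_mul_self, one_smul, opT_apply,
          M.ract_mul]
        have hi : Fin.init (Fin.init a) = fun j => a j.castSucc.castSucc := rfl
        have hi' : Fin.init a = fun j => a j.castSucc := rfl
        rw [hi, hi']
        abel
    have e : opP M = opD M + opB M := rfl
    rw [e]
    simp only [LinearMap.add_apply, fam_add_apply, map_add]
    rw [Pi.zero_apply, zero_apply]
    have hs := congrArg₂ (· + ·) (congrArg₂ (· + ·) hI hD) hB
    simp only [add_neg_cancel, add_zero] at hs
    rw [← hs]
    abel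

lemma delta_delta {m : ℤ} {c : Fam M} (hc : c ∈ cochains M m) :
    delta M (m + 1) (delta M m c) = 0 := by
  have h1 := opI_opI M m c
  have h2 := opI_opP M m c
  have h3 := opP_opP M c
  have h4 := left_identity M m c
  have h5 := opL_opR M m c
  have h6 := right_identity hc
  have h7 : opI M (m + 1) (opI M m c) + (opI M (m + 1) (opP M c) + opP M (opI M m c))
    + opP M (opP M c) + (opI M (m + 1) (opL M m c) + opL M (m + 1) (opI M m c) + opP M (opL M m c)
      + opL M (m + 1) (opP M c) + opL M (m + 1) (opL M m c))
    + (opL M (m + 1) (opR M c) + opR M (opL M m c))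
    + (opI M (m + 1) (opR M c) + opR M (opI M m c) + opP M (opR M c)
      + opR M (opP M c) + opR M (opR M c)) = 0 := by
    rw [h1, h2, h3, h4, h5, h6]; simp
  rw [← h7]
  simp only [delta_eq', map_add]
  abel

/-! ### The Hochschild cochain complex and its functoriality -/

variable (M)

/-- The Hochschild differential on cochains of degree `m`. -/
def cochainsD (m : ℤ) : cochains M m →ₗ[K] cochains M (m + 1) :=
  (delta M m).restrict fun _ h => delta_mem h

/-- The Hochschild cochain complex `C^•(F, M)`. -/
def hochschildComplex : CochainComplex (ModuleCat.{v} K) ℤ :=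
  CochainComplex.of (fun m => ModuleCat.of K (cochains M m))
    (fun m => ModuleCat.ofHom (cochainsD M m))
    (fun _ => ModuleCat.hom_ext (LinearMap.ext fun c => Subtype.ext (delta_delta c.2)))

variable {M}

/-- Composition of families of multilinear maps with a bimodule homomorphism `M → N`. -/
def coeffFam {N : DGBimodule F} (f : M.Hom N) : Fam M →ₗ[K] Fam N where
  toFun c n := f.toLinearMap.compMultilinearMap (c n)
  map_add' c c' := by funext n; ext a; simp
  map_smul' r c := by funext n; ext a; simp

lemma coeffFam_apply {N : DGBimodule F} (f : M.Hom N) (c : Fam M) (n : ℕ) (a : Fin n → F) :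
    coeffFam f c n a = f.toLinearMap (c n a) := rfl

lemma coeffFam_mem {N : DGBimodule F} (f : M.Hom N) {m : ℤ} {c : Fam M}
    (hc : c ∈ cochains M m) : coeffFam f c ∈ cochains N m := fun n p a ha => f.map_mem (hc n p a ha)

lemma coeffFam_delta {N : DGBimodule F} (f : M.Hom N) (m : ℤ) (c : Fam M) :
    delta N m (coeffFam f c) = coeffFam f (delta M m c) := by
  funext n; ext a
  rw [coeffFam_apply, delta_eq', delta_eq']
  have hI : ∀ n (a : Fin n → F), opI N m (coeffFam f c) n a = f.toLinearMap (opI M m c n a) := by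
    intro n a
    simp only [opI_eq]
    change sg m • N.d (f.toLinearMap (c n a)) = f.toLinearMap (sg m • M.d (c n a))
    rw [map_zsmul, f.map_d]
  cases n with
  | zero => simp only [fam_add_apply, hI, opP_zero, opL_zero, opR_zero, map_add]; simp
  | succ n =>
    simp only [fam_add_apply, hI, map_add, opP, LinearMap.add_apply, opD_apply, opB_apply,
      opL_apply, opR_apply, coeffFam_apply, map_sum, map_zsmul, f.map_lact, f.map_ract]

/-- The chain map `C^•(F, M) → C^•(F, N)` induced by a homomorphism `M → N` of bimodules. -/
def coeffMap {N : DGBimodule F} (f : M.Hom N) : hochschildComplex M ⟶ hochschildComplex N :=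
  CochainComplex.ofHom
    (fun m => ModuleCat.ofHom ((coeffFam f).restrict (p := cochains M m) (q := cochains N m)
      fun _ h => coeffFam_mem f h))
    (fun m => by
      simp only [hochschildComplex, CochainComplex.of_d]
      exact ModuleCat.hom_ext (LinearMap.ext fun c => Subtype.ext (coeffFam_delta f m c)))

/-- Composition of families of multilinear maps on `G` with a homomorphism `F → G` in each
argument. -/
def restrictFam {G : DGAlgebra.{u, v} K} (φ : F.Hom G) (N : DGBimodule G) :
    Fam N →ₗ[K] Fam (DGBimodule.restrict φ N) where
  toFun c n := (c n).compLinearMap fun _ => φ.toAlgHom.toLinearMap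
  map_add' c c' := by funext n; ext a; simp
  map_smul' r c := by funext n; ext a; simp

lemma restrictFam_apply {G : DGAlgebra.{u, v} K} (φ : F.Hom G) (N : DGBimodule G) (c : Fam N)
    (n : ℕ) (a : Fin n → F) :
    restrictFam φ N c n a = c n (fun i => φ.toAlgHom (a i)) := rfl

lemma restrictFam_mem {G : DGAlgebra.{u, v} K} (φ : F.Hom G) (N : DGBimodule G) {m : ℤ}
    {c : Fam N} (hc : c ∈ cochains N m) :
    restrictFam φ N c ∈ cochains (DGBimodule.restrict φ N) m :=
  fun n p _ ha => hc n p _ fun i => φ.map_mem (ha i)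

lemma restrictFam_delta {G : DGAlgebra.{u, v} K} (φ : F.Hom G) (N : DGBimodule G) (m : ℤ)
    (c : Fam N) : delta (DGBimodule.restrict φ N) m (restrictFam φ N c)
      = restrictFam φ N (delta N m c) := by
  have he : ∀ a : F, φ.toAlgHom (F.eps a) = G.eps (φ.toAlgHom a) := φ.map_sgn 1
  funext n; ext a
  rw [restrictFam_apply, delta_eq', delta_eq']
  have hI : ∀ n (a : Fin n → F), opI (DGBimodule.restrict φ N) m (restrictFam φ N c) n a
      = opI N m c n (fun i => φ.toAlgHom (a i)) := fun n a => rfl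
  have hD : ∀ n (a : Fin n → F), opD (DGBimodule.restrict φ N) (restrictFam φ N c) n a
      = opD N c n (fun i => φ.toAlgHom (a i)) := by
    intro n a
    simp only [opD_apply]
    refine Finset.sum_congr rfl fun i _ => congrArg (fun y : N => sg i • y) ?_
    refine congrArg (c n) (funext fun j => ?_)
    dsimp only
    split_ifs <;> simp [he, φ.map_d]
  cases n with
  | zero =>
    simp only [fam_add_apply, hI, hD, opP, LinearMap.add_apply, opB_zero, opL_zero, opR_zero]
    rfl
  | succ n =>
    have hB : opB (DGBimodule.restrict φ N) (restrictFam φ N c) (n + 1) a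
        = opB N c (n + 1) (fun i => φ.toAlgHom (a i)) := by
      simp only [opB_apply]
      refine Finset.sum_congr rfl fun i _ => congrArg (fun y : N => sg (i + 1) • y) ?_
      refine congrArg (c n) (funext fun j => ?_)
      simp only [contract]
      split_ifs <;> simp [he]
    have hL : opL (DGBimodule.restrict φ N) m (restrictFam φ N c) (n + 1) a
        = opL N m c (n + 1) (fun i => φ.toAlgHom (a i)) := by
      rw [opL_apply, opL_apply, ← φ.map_sgn]
      rfl
    have hR : opR (DGBimodule.restrict φ N) (restrictFam φ N c) (n + 1) a
        = opR N c (n + 1) (fun i => φ.toAlgHom (a i)) := by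
      rw [opR_apply, opR_apply]
      simp only [← he]
      rfl
    simp only [fam_add_apply, hI, hD, opP, LinearMap.add_apply, hB, hL, hR]

/-- The chain map `C^•(G, N) → C^•(F, N)` induced by a homomorphism `F → G`. -/
def restrictMap {G : DGAlgebra.{u, v} K} (φ : F.Hom G) (N : DGBimodule G) :
    hochschildComplex N ⟶ hochschildComplex (DGBimodule.restrict φ N) :=
  CochainComplex.ofHom
    (fun m => ModuleCat.ofHom ((restrictFam φ N).restrict (p := cochains N m)
      (q := cochains (DGBimodule.restrict φ N) m) fun _ h => restrictFam_mem φ N h))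
    (fun m => by
      simp only [hochschildComplex, CochainComplex.of_d]
      exact ModuleCat.hom_ext (LinearMap.ext fun c => Subtype.ext (restrictFam_delta φ N m c)))

/-! ### The Hodge decomposition -/

/-- The number of descents `σ(i) > σ(i + 1)` of a permutation. -/
def descents {n : ℕ} (σ : Equiv.Perm (Fin n)) : ℕ :=
  (Finset.univ.filter fun i : Fin n => ∃ h : (i : ℕ) + 1 < n, σ ⟨i + 1, h⟩ < σ i).card

variable (K) in
/-- The coefficient of `x ^ k` in `(1 / n!) (x - d) (x - d + 1) ⋯ (x - d + n - 1)`. The Eulerian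
idempotent `e_n(k)` is the sum over all permutations `σ` of `sgn(σ) σ` with this coefficient, where
`d` is the number of descents of `σ`. -/
def eulerianCoeff (n k d : ℕ) : K :=
  (Polynomial.C (n.factorial : K)⁻¹ * ∏ j ∈ Finset.range n,
    (Polynomial.X - Polynomial.C (d : K) + Polynomial.C (j : K))).coeff k

/-- The Koszul sign of the permutation `σ` of `n` elements of `F` of degrees `p_i`, regarded as
elements of `F[1]` of degrees `p_i - 1`: the product of `(-1)^{(p_i - 1) (p_j - 1)}` over all
inversions `i < j`, `σ(i) > σ(j)`. It is `sgn(σ)` if all `p_i` are `0`. -/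
def koszulSign {n : ℕ} (σ : Equiv.Perm (Fin n)) (p : Fin n → ℤ) : ℤ :=
  ∏ ij : Fin n × Fin n with ij.1 < ij.2 ∧ σ ij.2 < σ ij.1, sg ((p ij.1 - 1) * (p ij.2 - 1))

variable (M)

/-- The `k`-th Hodge component of the space of Hochschild cochains of degree `m`: the cochains `c`
with `c_n ∘ e_n(k) = c_n` for all `n`. The Eulerian idempotent `e_n(k)` acts on `F[1]^{⊗ n}` through
the graded action of the symmetric group, where `σ` moves the `i`-th factor to the place `σ(i)`,
with the Koszul sign. -/
def hodge (k : ℕ) (m : ℤ) : Submodule K (Fam M) where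
  carrier := {c | c ∈ cochains M m ∧
    ∀ (n : ℕ) (p : Fin n → ℤ) (a : Fin n → F), (∀ i, a i ∈ F.gr (p i)) →
      ∑ σ : Equiv.Perm (Fin n), eulerianCoeff K n k (descents σ) •
        koszulSign σ p • c n (fun j => a (σ.symm j)) = c n a}
  add_mem' := by
    rintro c c' ⟨h1, h2⟩ ⟨h1', h2'⟩
    refine ⟨add_mem h1 h1', fun n p a ha => ?_⟩
    simp only [fam_add_apply, smul_add, Finset.sum_add_distrib, h2 n p a ha, h2' n p a ha]
  zero_mem' := ⟨zero_mem _, fun n p a _ => by simp⟩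
  smul_mem' := by
    rintro r c ⟨h1, h2⟩
    refine ⟨Submodule.smul_mem _ r h1, fun n p a ha => ?_⟩
    have e : ∀ b, (r • c) n b = r • c n b := fun _ => rfl
    simp only [e, smul_comm _ r, ← Finset.smul_sum, h2 n p a ha]

/-- The Hodge components form a decomposition of the Hochschild complex: each of them is a
subcomplex, and every cochain `c` is in a unique way a sum of components (`C^• = ∏_k C^•_{(k)}`;
only the components with `k ≤ n` contribute to `c_n`). -/
def HasHodgeDecomposition : Prop :=
  (∀ (k : ℕ) (m : ℤ) (c : Fam M), c ∈ hodge M k m → delta M m c ∈ hodge M k (m + 1)) ∧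
  ∀ (m : ℤ) (c : Fam M), c ∈ cochains M m →
    ∃! f : ℕ → Fam M, (∀ k, f k ∈ hodge M k m) ∧
      ∀ n, ∑ k ∈ Finset.range (n + 1), f k n = c n

variable {M}

/-- The `k`-th Hodge component of the Hochschild complex, as a complex (for `k = 1`, the Harrison
complex). -/
def hodgeComplex (h : HasHodgeDecomposition M) (k : ℕ) : CochainComplex (ModuleCat.{v} K) ℤ :=
  CochainComplex.of (fun m => ModuleCat.of K (hodge M k m))
    (fun m => ModuleCat.ofHom ((delta M m).restrict (p := hodge M k m) (q := hodge M k (m + 1))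
      fun c hc => h.1 k m c hc))
    (fun _ => ModuleCat.hom_ext (LinearMap.ext fun c => Subtype.ext (delta_delta c.2.1)))

lemma coeffFam_hodge {N : DGBimodule F} (f : M.Hom N) {k : ℕ} {m : ℤ} {c : Fam M}
    (hc : c ∈ hodge M k m) : coeffFam f c ∈ hodge N k m := by
  refine ⟨coeffFam_mem f hc.1, fun n p a ha => ?_⟩
  simp only [coeffFam_apply, ← hc.2 n p a ha, map_sum, map_smul, map_zsmul]

lemma restrictFam_hodge {G : DGAlgebra.{u, v} K} (φ : F.Hom G) (N : DGBimodule G) {k : ℕ}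
    {m : ℤ} {c : Fam N} (hc : c ∈ hodge N k m) :
    restrictFam φ N c ∈ hodge (DGBimodule.restrict φ N) k m :=
  ⟨restrictFam_mem φ N hc.1, fun n p a ha =>
    hc.2 n p (fun i => φ.toAlgHom (a i)) fun i => φ.map_mem (ha i)⟩

/-- The restriction of `coeffMap f` to the `k`-th Hodge components. -/
def hodgeCoeffMap {N : DGBimodule F} (f : M.Hom N) (hM : HasHodgeDecomposition M)
    (hN : HasHodgeDecomposition N) (k : ℕ) : hodgeComplex hM k ⟶ hodgeComplex hN k :=
  CochainComplex.ofHom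
    (fun m => ModuleCat.ofHom ((coeffFam f).restrict (p := hodge M k m) (q := hodge N k m)
      fun _ h => coeffFam_hodge f h))
    (fun m => by
      simp only [hodgeComplex, CochainComplex.of_d]
      exact ModuleCat.hom_ext (LinearMap.ext fun c => Subtype.ext (coeffFam_delta f m c)))

/-- The restriction of `restrictMap φ N` to the `k`-th Hodge components. -/
def hodgeRestrictMap {G : DGAlgebra.{u, v} K} (φ : F.Hom G) (N : DGBimodule G)
    (hN : HasHodgeDecomposition N) (hN' : HasHodgeDecomposition (DGBimodule.restrict φ N))
    (k : ℕ) : hodgeComplex hN k ⟶ hodgeComplex hN' k :=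
  CochainComplex.ofHom
    (fun m => ModuleCat.ofHom ((restrictFam φ N).restrict (p := hodge N k m)
      (q := hodge (DGBimodule.restrict φ N) k m) fun _ h => restrictFam_hodge φ N h))
    (fun m => by
      simp only [hodgeComplex, CochainComplex.of_d]
      exact ModuleCat.hom_ext (LinearMap.ext fun c => Subtype.ext (restrictFam_delta φ N m c)))

end Cochains

end DGHochschild

end

/-!
Over a field, the mapping cone of a quasi-isomorphism of complexes is contractible, so that the
quasi-isomorphism has a homotopy inverse `ψ`. Neither `ψ` nor the homotopies respect the products,
but they induce homotopies for the part of the Hochschild differential that preserves the number of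
arguments. The mapping cones of the two maps of Hochschild complexes are complete for the
filtration by the number of arguments, and the remaining terms of the differential raise this
number, so the cones are exact by successive approximation.

If the algebra is supercommutative and the bimodule symmetric, the Hochschild differential commutes
with the second Adams operation `∑_g sort(g)`, the sum over all labellings of the arguments by two
labels: it is the convolution square of the identity for the shuffle product and deconcatenation,
and the Hochschild differential is compatible with both. The Adams operations are
`∑_k N ^ k e_n(k)`, since the number of labellings by `N` labels that are sorted by `σ` is
`(N + n - 1 - d_σ).choose n`. Hence in characteristic `0` the `k`-th Hodge component consists of the
eigenvectors with eigenvalue `2 ^ k`, and the Eulerian idempotents are projections of complexes that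
are natural in the algebra and in the bimodule. They exhibit the mapping cones of the restricted
maps as direct summands of exact complexes.
-/

noncomputable section

namespace DGHochschild

section MappingCone

open CochainComplex

lemma quasiIso_iff_acyclic_mappingCone {C : Type*} [Category* C] [Abelian C]
    {A B : CochainComplex C ℤ} (f : A ⟶ B) : QuasiIso f ↔ (mappingCone f).Acyclic := by
  rw [← HomotopyCategory.quotient_obj_mem_subcategoryAcyclic_iff_acyclic]
  refine Iff.trans ?_ ((HomotopyCategory.subcategoryAcyclic C).trW_iff_of_distinguished _
    (HomotopyCategory.mappingCone_triangleh_distinguished f))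
  rw [← HomotopyCategory.quasiIso_eq_trW_subcategoryAcyclic]
  exact (HomotopyCategory.quotient_map_mem_quasiIso_iff f).symm

variable {R : Type u} [Ring R] {A B : CochainComplex (ModuleCat.{v} R) ℤ} (f : A ⟶ B)

/-- The degree-`i` part `A^{i+1} × B^i` of the mapping cone of `f`. -/
def mappingConeXEquiv (i : ℤ) : (mappingCone f).X i ≃+ A.X (i + 1) × B.X i where
  toFun z := ((mappingCone.fst f).1.v i (i + 1) rfl z, (mappingCone.snd f).v i i (add_zero i) z)
  invFun x := (mappingCone.inl f).v (i + 1) i (by lia) x.1 + (mappingCone.inr f).f i x.2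
  left_inv z := congr($(mappingCone.id_X f i (i + 1) rfl) z)
  right_inv x := by ext <;> simp [← ModuleCat.comp_apply]
  map_add' z w := by simp

lemma mappingConeXEquiv_d (i : ℤ) (z : (mappingCone f).X i) :
    mappingConeXEquiv f (i + 1) ((mappingCone f).d i (i + 1) z) =
      (-A.d (i + 1) (i + 1 + 1) (mappingConeXEquiv f i z).1,
        f.f (i + 1) (mappingConeXEquiv f i z).1 + B.d i (i + 1) (mappingConeXEquiv f i z).2) := by
  ext
  · exact congr($(mappingCone.d_fst_v f i (i + 1) (i + 1 + 1) rfl rfl) z)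
  · exact congr($(mappingCone.d_snd_v f i (i + 1) rfl) z)

lemma quasiIso_iff_exact_elements : QuasiIso f ↔
    ∀ (i : ℤ) (a : A.X (i + 1 + 1)) (b : B.X (i + 1)),
      A.d (i + 1 + 1) (i + 1 + 1 + 1) a = 0 →
      f.f (i + 1 + 1) a + B.d (i + 1) (i + 1 + 1) b = 0 →
      ∃ (a' : A.X (i + 1)) (b' : B.X i), -A.d (i + 1) (i + 1 + 1) a' = a ∧
        f.f (i + 1) a' + B.d i (i + 1) b' = b := by
  have exactAt_iff (i : ℤ) : (mappingCone f).ExactAt (i + 1) ↔ ∀ z : (mappingCone f).X (i + 1),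
      (mappingCone f).d (i + 1) (i + 1 + 1) z = 0 → ∃ w, (mappingCone f).d i (i + 1) w = z :=
    ((mappingCone f).exactAt_iff' i (i + 1) (i + 1 + 1) (by simp) (by simp)).trans
      (ShortComplex.moduleCat_exact_iff _)
  rw [quasiIso_iff_acyclic_mappingCone]
  refine ((Equiv.addRight 1).forall_congr_right (q := (mappingCone f).ExactAt)).symm.trans
    (forall_congr' fun i => (exactAt_iff i).trans ?_)
  simp only [(mappingConeXEquiv f i).symm.surjective.exists,
    (mappingConeXEquiv f (i + 1)).symm.surjective.forall,
    ← (mappingConeXEquiv f (i + 1)).injective.eq_iff,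
    ← (mappingConeXEquiv f (i + 1 + 1)).injective.eq_iff, mappingConeXEquiv_d, map_zero,
    AddEquiv.apply_symm_apply, Prod.forall,
    Prod.exists, Prod.ext_iff, neg_eq_zero, and_imp, Prod.fst_zero, Prod.snd_zero]

end MappingCone

section Graded

variable {R : Type u} [Ring R] {V W : Type v} [AddCommGroup V] [Module R V] [AddCommGroup W]
  [Module R W]

/-- Exactness of the sequence of maps `D m : C m → C (m + 1)` between submodules of a fixed
module. That `D m` maps `C m` to `C (m + 1)` and that consecutive maps compose to zero is not part
of the notion. -/
def IsExactSeq (C : ℤ → Submodule R V) (D : ℤ → V →ₗ[R] V) : Prop :=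
  ∀ m, ∀ y ∈ C (m + 1), D (m + 1) y = 0 → ∃ x ∈ C m, D m x = y

lemma IsExactSeq.of_projection {C C' : ℤ → Submodule R V} {D : ℤ → V →ₗ[R] V}
    (hC : IsExactSeq C D) (P : V →ₗ[R] V) (C'_le : ∀ m, C' m ≤ C m)
    (P_mem : ∀ m, ∀ x ∈ C m, P x ∈ C' m) (P_eq_self : ∀ m, ∀ x ∈ C' m, P x = x)
    (D_P : ∀ m, ∀ x ∈ C m, D m (P x) = P (D m x)) : IsExactSeq C' D := by
  intro m y hy hDy
  obtain ⟨x, hx, rfl⟩ := hC m y (C'_le _ hy) hDy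
  exact ⟨P x, P_mem m x hx, (D_P m x hx).trans (P_eq_self _ _ hy)⟩

/-- The terms of the mapping cone of a chain map from a complex with terms `S m` to one with terms
`T m`. -/
def cone (S : ℤ → Submodule R V) (T : ℤ → Submodule R W) (m : ℤ) : Submodule R (V × W) :=
  (S (m + 1)).prod (T m)

/-- The differential `(x, y) ↦ (-d x, g x + d y)` of the mapping cone of `g`. -/
def coneD (dS : ℤ → V →ₗ[R] V) (dT : ℤ → W →ₗ[R] W) (g : V →ₗ[R] W) (m : ℤ) :
    V × W →ₗ[R] V × W :=
  (-(dS (m + 1) ∘ₗ LinearMap.fst R V W)).prod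
    (g ∘ₗ LinearMap.fst R V W + dT m ∘ₗ LinearMap.snd R V W)

lemma coneD_apply (dS : ℤ → V →ₗ[R] V) (dT : ℤ → W →ₗ[R] W) (g : V →ₗ[R] W) (m : ℤ) (x : V)
    (y : W) : coneD dS dT g m (x, y) = (-dS (m + 1) x, g x + dT m y) := rfl

lemma quasiIso_iff_isExactSeq_cone {S : ℤ → Submodule R V} {T : ℤ → Submodule R W}
    {dS : ℤ → V →ₗ[R] V} {dT : ℤ → W →ₗ[R] W} (g : V →ₗ[R] W)
    (hS : ∀ i, ∀ x ∈ S i, dS i x ∈ S (i + 1)) (hT : ∀ i, ∀ x ∈ T i, dT i x ∈ T (i + 1))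
    (hg : ∀ i, ∀ x ∈ S i, g x ∈ T i) (hSS hTT)
    (f : CochainComplex.of (fun i => ModuleCat.of R (S i))
        (fun i => ModuleCat.ofHom ((dS i).restrict (hS i))) hSS ⟶
      CochainComplex.of (fun i => ModuleCat.of R (T i))
        (fun i => ModuleCat.ofHom ((dT i).restrict (hT i))) hTT)
    (hf : ∀ i, f.f i = ModuleCat.ofHom (g.restrict (hg i))) :
    QuasiIso f ↔ IsExactSeq (cone S T) (coneD dS dT g) := by
  rw [quasiIso_iff_exact_elements]
  refine forall_congr' fun i => ?_
  simp only [hf, CochainComplex.of_d]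
  change (∀ (a : S (i + 1 + 1)) (b : T (i + 1)), (dS (i + 1 + 1)).restrict (hS _) a = 0 →
    g.restrict (hg _) a + (dT (i + 1)).restrict (hT _) b = 0 →
    ∃ (a' : S (i + 1)) (b' : T i), -(dS (i + 1)).restrict (hS _) a' = a ∧
      g.restrict (hg _) a' + (dT i).restrict (hT _) b' = b) ↔ _
  simp only [Subtype.forall, Subtype.exists, LinearMap.restrict_apply, Subtype.ext_iff,
    Submodule.coe_add, Submodule.coe_neg, Submodule.coe_zero, cone, Submodule.mem_prod,
    Prod.forall, Prod.exists, coneD_apply, Prod.mk_eq_zero, neg_eq_zero, Prod.mk.injEq]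
  constructor
  · intro h a b ⟨ha, hb⟩ ⟨hda, hab⟩
    obtain ⟨a', ha', b', hb', h'⟩ := h a ha b hb hda hab
    exact ⟨a', b', ⟨ha', hb'⟩, h'⟩
  · intro h a ha b hb hda hab
    obtain ⟨a', b', ⟨ha', hb'⟩, h'⟩ := h a b ⟨ha, hb⟩ ⟨hda, hab⟩
    exact ⟨a', ha', b', hb', h'⟩

end Graded

section Contraction

variable {K : Type u} [Field K] {V : Type v} [AddCommGroup V] [Module K V]

lemma IsExactSeq.exists_section {C : ℤ → Submodule K V} {D : ℤ → V →ₗ[K] V}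
    (hC : IsExactSeq C D) (i : ℤ) :
    ∃ s : V →ₗ[K] V, ∀ x ∈ C (i + 1), D (i + 1) x = 0 → s x ∈ C i ∧ D i (s x) = x := by
  let Z : Submodule K V := C (i + 1) ⊓ LinearMap.ker (D (i + 1))
  let B : Submodule K V := C i ⊓ Z.comap (D i)
  let g : B →ₗ[K] Z := (D i).restrict fun x hx => hx.2
  have hg : Function.Surjective g := by
    rintro ⟨x, hx, hx'⟩
    obtain ⟨y, hy, rfl⟩ := hC i x hx hx'
    exact ⟨⟨y, hy, hx, hx'⟩, rfl⟩
  obtain ⟨r, hr⟩ := g.exists_rightInverse_of_surjective (LinearMap.range_eq_top.2 hg)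
  obtain ⟨s, hs⟩ := LinearMap.exists_extend (B.subtype ∘ₗ r)
  refine ⟨s, fun x hx hx' => ?_⟩
  have hsx : s x = r ⟨x, hx, hx'⟩ := congr($hs ⟨x, hx, hx'⟩)
  rw [hsx]
  exact ⟨(r _).2.1, congrArg Subtype.val (congr($hr ⟨x, hx, hx'⟩))⟩

lemma IsExactSeq.exists_contraction {C : ℤ → Submodule K V} {D : ℤ → V →ₗ[K] V}
    (hC : IsExactSeq C D) (hD : ∀ i, ∀ x ∈ C i, D i x ∈ C (i + 1))
    (hDD : ∀ i, ∀ x ∈ C i, D (i + 1) (D i x) = 0) :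
    ∃ h : ℤ → V →ₗ[K] V, (∀ i, ∀ x ∈ C (i + 1), h i x ∈ C i) ∧
      ∀ i, ∀ x ∈ C (i + 1), D i (h i x) + h (i + 1) (D (i + 1) x) = x := by
  choose s hs using hC.exists_section
  have cycle (i : ℤ) (x : V) (hx : x ∈ C (i + 1)) : x - s (i + 1) (D (i + 1) x) ∈ C (i + 1) ∧
      D (i + 1) (x - s (i + 1) (D (i + 1) x)) = 0 := by
    obtain ⟨h1, h2⟩ := hs (i + 1) _ (hD _ x hx) (hDD _ x hx)
    exact ⟨sub_mem hx h1, by rw [map_sub, h2, sub_self]⟩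
  refine ⟨fun i => s i ∘ₗ (LinearMap.id - s (i + 1) ∘ₗ D (i + 1)), fun i x hx => ?_,
    fun i x hx => ?_⟩
  · exact (hs i _ (cycle i x hx).1 (cycle i x hx).2).1
  · have h1 := (hs i _ (cycle i x hx).1 (cycle i x hx).2).2
    simp only [LinearMap.comp_apply, LinearMap.sub_apply, LinearMap.id_apply, h1, hDD _ x hx,
      map_zero, sub_zero, sub_add_cancel]

variable {W : Type*} [AddCommGroup W] [Module K W]

/-- The linear map that is given by `f i` on the homogeneous elements of degree `i`. -/
def piecewiseLinear (𝒱 : ℤ → Submodule K V) [DirectSum.Decomposition 𝒱] (f : ℤ → V →ₗ[K] W) :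
    V →ₗ[K] W :=
  (DirectSum.toModule K ℤ W fun i => f i ∘ₗ (𝒱 i).subtype) ∘ₗ
    (DirectSum.decomposeLinearEquiv 𝒱).toLinearMap

lemma piecewiseLinear_apply (𝒱 : ℤ → Submodule K V) [DirectSum.Decomposition 𝒱]
    (f : ℤ → V →ₗ[K] W) {i : ℤ} {a : V} (ha : a ∈ 𝒱 i) : piecewiseLinear 𝒱 f a = f i a := by
  lift a to 𝒱 i using ha
  simp [piecewiseLinear, DirectSum.toModule_lof]

end Contraction

section HomotopyInverse

variable {K : Type u} [Field K] {V W : Type v} [AddCommGroup V] [Module K V] [AddCommGroup W]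
  [Module K W] {𝒱 : ℤ → Submodule K V} {𝒲 : ℤ → Submodule K W} {dV : V →ₗ[K] V}
  {dW : W →ₗ[K] W} {g : V →ₗ[K] W}

lemma IsExactSeq.exists_contraction_cone [DirectSum.Decomposition 𝒱] [DirectSum.Decomposition 𝒲]
    (hex : IsExactSeq (cone 𝒱 𝒲) (coneD (fun _ => dV) (fun _ => dW) g))
    (hV : ∀ i, ∀ x ∈ 𝒱 i, dV x ∈ 𝒱 (i + 1)) (hW : ∀ i, ∀ x ∈ 𝒲 i, dW x ∈ 𝒲 (i + 1))
    (hVV : ∀ x, dV (dV x) = 0) (hWW : ∀ x, dW (dW x) = 0)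
    (hg : ∀ i, ∀ x ∈ 𝒱 i, g x ∈ 𝒲 i) (hgd : ∀ x, g (dV x) = dW (g x)) :
    ∃ H : V × W →ₗ[K] V × W, (∀ i, ∀ x ∈ cone 𝒱 𝒲 (i + 1), H x ∈ cone 𝒱 𝒲 i) ∧
      ∀ x y, (-dV (H (x, y)).1, g (H (x, y)).1 + dW (H (x, y)).2) + H (-dV x, g x + dW y) =
        (x, y) := by
  have hD : ∀ i, ∀ x ∈ cone 𝒱 𝒲 i,
      coneD (fun _ => dV) (fun _ => dW) g i x ∈ cone 𝒱 𝒲 (i + 1) := fun i x hx =>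
    ⟨neg_mem (hV _ _ hx.1), add_mem (hg _ _ hx.1) (hW _ _ hx.2)⟩
  obtain ⟨h, hm, hh⟩ := hex.exists_contraction hD fun i x _ => by
    simp [coneD, hVV, hWW, hgd]
  let H : V × W →ₗ[K] V × W :=
    (piecewiseLinear 𝒱 fun i => h (i - 1 - 1) ∘ₗ LinearMap.inl K V W).coprod
      (piecewiseLinear 𝒲 fun i => h (i - 1) ∘ₗ LinearMap.inr K V W)
  have H_eq (i : ℤ) (x) (hx : x ∈ cone 𝒱 𝒲 (i + 1)) : H x = h i x := by
    simp only [H, LinearMap.coprod_apply, piecewiseLinear_apply 𝒱 _ hx.1,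
      piecewiseLinear_apply 𝒲 _ hx.2, add_sub_cancel_right, LinearMap.comp_apply, ← map_add]
    simp
  have H_spec (i : ℤ) (x) (hx : x ∈ cone 𝒱 𝒲 (i + 1)) :
      (coneD (fun _ => dV) (fun _ => dW) g 0 ∘ₗ H + H ∘ₗ coneD (fun _ => dV) (fun _ => dW) g 0) x =
        x := by
    have h_spec := hh i x hx
    rwa [← H_eq i x hx, ← H_eq (i + 1) _ (hD (i + 1) x hx)] at h_spec
  refine ⟨H, fun i x hx => H_eq i x hx ▸ hm i x hx, fun x y => ?_⟩
  have H_id : coneD (fun _ => dV) (fun _ => dW) g 0 ∘ₗ H +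
      H ∘ₗ coneD (fun _ => dV) (fun _ => dW) g 0 = LinearMap.id := by
    refine LinearMap.prod_ext (LinearMap.ext (ext_of_homogeneous 𝒱 fun i a ha => ?_))
      (LinearMap.ext (ext_of_homogeneous 𝒲 fun i a ha => ?_))
    · exact H_spec (i - 1 - 1) (a, 0) ⟨by simpa using ha, zero_mem _⟩
    · exact H_spec (i - 1) (0, a) ⟨zero_mem _, by simpa using ha⟩
  exact congr($H_id (x, y))

/-- A homotopy inverse, with homotopies, of a chain map `g` between graded complexes. -/
structure HomotopyInverse (𝒱 : ℤ → Submodule K V) (𝒲 : ℤ → Submodule K W) (dV : V →ₗ[K] V)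
    (dW : W →ₗ[K] W) (g : V →ₗ[K] W) where
  inv : W →ₗ[K] V
  /-- the homotopy on the source -/
  src : V →ₗ[K] V
  /-- the homotopy on the target -/
  tgt : W →ₗ[K] W
  inv_mem : ∀ {i a}, a ∈ 𝒲 i → inv a ∈ 𝒱 i
  src_mem : ∀ {i a}, a ∈ 𝒱 i → src a ∈ 𝒱 (i - 1)
  tgt_mem : ∀ {i a}, a ∈ 𝒲 i → tgt a ∈ 𝒲 (i - 1)
  inv_d : ∀ a, inv (dW a) = dV (inv a)
  inv_map : ∀ a, inv (g a) = a - (dV (src a) + src (dV a))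
  map_inv : ∀ a, g (inv a) = a - (dW (tgt a) + tgt (dW a))

lemma IsExactSeq.nonempty_homotopyInverse [DirectSum.Decomposition 𝒱] [DirectSum.Decomposition 𝒲]
    (hex : IsExactSeq (cone 𝒱 𝒲) (coneD (fun _ => dV) (fun _ => dW) g))
    (hV : ∀ i, ∀ x ∈ 𝒱 i, dV x ∈ 𝒱 (i + 1)) (hW : ∀ i, ∀ x ∈ 𝒲 i, dW x ∈ 𝒲 (i + 1))
    (hVV : ∀ x, dV (dV x) = 0) (hWW : ∀ x, dW (dW x) = 0)
    (hg : ∀ i, ∀ x ∈ 𝒱 i, g x ∈ 𝒲 i) (hgd : ∀ x, g (dV x) = dW (g x)) :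
    Nonempty (HomotopyInverse 𝒱 𝒲 dV dW g) := by
  obtain ⟨H, hm, hH⟩ := hex.exists_contraction_cone hV hW hVV hWW hg hgd
  have H_inr (b : W) :
      (-dV (H (0, b)).1, g (H (0, b)).1 + dW (H (0, b)).2) + H (0, dW b) = (0, b) := by
    simpa using hH 0 b
  have H_inl (a : V) : -dV (H (a, 0)).1 + (-(H (dV a, 0)).1 + (H (0, g a)).1) = a := by
    have h := hH a 0
    rw [show (-dV a, g a + dW 0) = -(dV a, 0) + (0, g a) by simp, map_add, map_neg] at h
    exact congrArg Prod.fst h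
  have mem_inl {i : ℤ} {a : V} (ha : a ∈ 𝒱 i) : (a, (0 : W)) ∈ cone 𝒱 𝒲 (i - 1 - 1 + 1) :=
    ⟨by simpa using ha, zero_mem _⟩
  have mem_inr {i : ℤ} {a : W} (ha : a ∈ 𝒲 i) : ((0 : V), a) ∈ cone 𝒱 𝒲 (i - 1 + 1) :=
    ⟨zero_mem _, by simpa using ha⟩
  exact ⟨{
    inv := LinearMap.fst K V W ∘ₗ H ∘ₗ LinearMap.inr K V W
    src := -(LinearMap.fst K V W ∘ₗ H ∘ₗ LinearMap.inl K V W)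
    tgt := LinearMap.snd K V W ∘ₗ H ∘ₗ LinearMap.inr K V W
    inv_mem := fun {i a} ha => by simpa using (hm _ _ (mem_inr ha)).1
    src_mem := fun {i a} ha => neg_mem (by simpa using (hm _ _ (mem_inl ha)).1)
    tgt_mem := fun {i a} ha => (hm _ _ (mem_inr ha)).2
    inv_d := fun b => (neg_add_eq_zero.1 (congrArg Prod.fst (H_inr b))).symm
    inv_map := fun a => by
      change (H (0, g a)).1 = a - (dV (-(H (a, 0)).1) + -(H (dV a, 0)).1)
      rw [map_neg, eq_sub_iff_add_eq']
      exact (add_assoc _ _ _).trans (H_inl a)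
    map_inv := fun b => by
      change g (H (0, b)).1 = b - (dW (H (0, b)).2 + (H (0, dW b)).2)
      exact eq_sub_of_add_eq ((add_assoc _ _ _).symm.trans (congrArg Prod.snd (H_inr b))) }⟩

end HomotopyInverse

section LeadingTerm

variable {R : Type*} [Ring R] {V : Type*} [AddCommGroup V] [Module R V] {X : ℕ → Type*}
  [∀ n, AddCommGroup (X n)] [∀ n, Module R (X n)] {π : ∀ n, V →ₗ[R] X n}
  {C : ℤ → Submodule R V} {D D₀ : ℤ → V →ₗ[R] V}

lemma IsExactSeq.exists_lift_leading_term (hex : IsExactSeq C D₀)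
    (hπ : ∀ x, (∀ n, π n x = 0) → x = 0)
    (hC : ∀ m (x : ℕ → V), (∀ n, x n ∈ C m) → ∃ y ∈ C m, ∀ n, π n y = π n (x n))
    (hD₀ : ∀ m x n, π n x = 0 → π n (D₀ m x) = 0)
    (hlead : ∀ m x n, (∀ i < n, π i x = 0) → π n (D m x) = π n (D₀ m x))
    {m : ℤ} {p : ℕ} {y : V} (hy : y ∈ C (m + 1)) (hDy : D (m + 1) y = 0)
    (hyp : ∀ i < p, π i y = 0) :
    ∃ x ∈ C m, (∀ i < p, π i x = 0) ∧ ∀ i < p + 1, π i (D m x) = π i y := by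
  have component (m : ℤ) (x : V) (hx : x ∈ C m) :
      ∃ x' ∈ C m, π p x' = π p x ∧ ∀ n ≠ p, π n x' = 0 := by
    obtain ⟨x', hx', h⟩ := hC m (fun n => if n = p then x else 0) fun n => by
      split_ifs
      exacts [hx, zero_mem _]
    exact ⟨x', hx', by rw [h, if_pos rfl], fun n hn => by rw [h, if_neg hn, map_zero]⟩
  have D₀_congr (m : ℤ) (x x' : V) (n : ℕ) (h : π n x = π n x') :
      π n (D₀ m x) = π n (D₀ m x') := by
    rw [← sub_eq_zero, ← map_sub, ← map_sub]
    exact hD₀ m _ n (by rw [map_sub, h, sub_self])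
  obtain ⟨y', hy', hyp', hy'0⟩ := component (m + 1) y hy
  have hD₀y' : D₀ (m + 1) y' = 0 := hπ _ fun n => by
    rcases eq_or_ne n p with rfl | hn
    · rw [D₀_congr _ _ _ _ hyp', ← hlead _ _ _ hyp, hDy, map_zero]
    · exact hD₀ _ _ _ (hy'0 n hn)
  obtain ⟨z, hz, hDz⟩ := hex m y' hy' hD₀y'
  obtain ⟨x, hx, hxp, hx0⟩ := component m z hz
  refine ⟨x, hx, fun i hi => hx0 i hi.ne, fun i hi => ?_⟩
  rw [hlead _ _ _ fun j hj => hx0 j (by lia)]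
  rcases (Nat.lt_succ_iff.1 hi).lt_or_eq with hi | rfl
  · rw [hD₀ _ _ _ (hx0 i hi.ne), hyp i hi]
  · rw [D₀_congr _ _ _ _ hxp, hDz, hyp']

/-- With `π n` in the role of the components of an element, `hC` says that the complex is complete
for the filtration by the index. This is what makes successive approximation converge. -/
lemma IsExactSeq.of_leading_term (hex : IsExactSeq C D₀) (hπ : ∀ x, (∀ n, π n x = 0) → x = 0)
    (hC : ∀ m (x : ℕ → V), (∀ n, x n ∈ C m) → ∃ y ∈ C m, ∀ n, π n y = π n (x n))
    (hD : ∀ m, ∀ x ∈ C m, D m x ∈ C (m + 1)) (hDD : ∀ m, ∀ x ∈ C m, D (m + 1) (D m x) = 0)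
    (hD₀ : ∀ m x n, π n x = 0 → π n (D₀ m x) = 0)
    (hlead : ∀ m x n, (∀ i < n, π i x = 0) → π n (D m x) = π n (D₀ m x)) : IsExactSeq C D := by
  intro m y hy hDy
  have step (p : ℕ) (x : V) : x ∈ C m ∧ (∀ i < p, π i (D m x) = π i y) →
      ∃ x' ∈ C m, (∀ i < p, π i x' = π i x) ∧ ∀ i < p + 1, π i (D m x') = π i y := by
    rintro ⟨hx, hxy⟩
    obtain ⟨e, he, he0, hDe⟩ := hex.exists_lift_leading_term hπ hC hD₀ hlead (p := p)
      (sub_mem hy (hD m x hx)) (by rw [map_sub, hDy, hDD m x hx, sub_zero])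
      fun i hi => by rw [map_sub, hxy i hi, sub_self]
    refine ⟨x + e, add_mem hx he, fun i hi => ?_, fun i hi => ?_⟩
    · rw [map_add, he0 i hi, add_zero]
    · rw [map_add, map_add, hDe i hi, map_sub, add_sub_cancel]
  choose! next next_mem next_congr next_spec using step
  let approx : ℕ → V := fun p => Nat.rec 0 next p
  have approx_spec (p : ℕ) : approx p ∈ C m ∧ ∀ i < p, π i (D m (approx p)) = π i y := by
    induction p with
    | zero => exact ⟨zero_mem _, fun i hi => absurd hi (Nat.not_lt_zero i)⟩
    | succ p ih => exact ⟨next_mem p _ ih, next_spec p _ ih⟩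
  have approx_congr {p q : ℕ} (hpq : p ≤ q) : ∀ i < p, π i (approx q) = π i (approx p) := by
    induction q, hpq using Nat.le_induction with
    | base => exact fun _ _ => rfl
    | succ q hpq ih =>
      exact fun i hi => (next_congr q _ (approx_spec q) i (hi.trans_le hpq)).trans (ih i hi)
  obtain ⟨x, hx, hxπ⟩ := hC m (fun n => approx (n + 1)) fun n => (approx_spec (n + 1)).1
  refine ⟨x, hx, sub_eq_zero.1 (hπ _ fun n => ?_)⟩
  have agree (i : ℕ) (hi : i < n + 1) : π i (x - approx (n + 1)) = 0 := by
    rw [map_sub, hxπ, approx_congr hi i i.lt_succ_self, sub_self]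
  have hDx : π n (D m (x - approx (n + 1))) = 0 := by
    rw [hlead _ _ _ fun i hi => agree i (by lia), hD₀ _ _ _ (agree n n.lt_succ_self)]
  rw [map_sub, ← (approx_spec (n + 1)).2 n n.lt_succ_self, ← map_sub, ← map_sub, hDx]

end LeadingTerm

section Homotopy

variable {R : Type u} [Ring R] {V W : Type v} [AddCommGroup V] [Module R V] [AddCommGroup W]
  [Module R W] {S : ℤ → Submodule R V} {T : ℤ → Submodule R W} {dS : ℤ → V →ₗ[R] V}
  {dT : ℤ → W →ₗ[R] W}

lemma isExactSeq_cone_of_homotopy {g : V →ₗ[R] W} {g' : W →ₗ[R] V} {hS : ℤ → V →ₗ[R] V}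
    {hT : ℤ → W →ₗ[R] W} (g_mem : ∀ m, ∀ x ∈ S m, g x ∈ T m) (g'_mem : ∀ m, ∀ y ∈ T m, g' y ∈ S m)
    (hS_mem : ∀ m, ∀ x ∈ S (m + 1), hS m x ∈ S m) (hT_mem : ∀ m, ∀ y ∈ T (m + 1), hT m y ∈ T m)
    (g_d : ∀ m x, dT m (g x) = g (dS m x)) (g'_d : ∀ m y, dS m (g' y) = g' (dT m y))
    (g'_g : ∀ m x, g' (g x) = x - (dS m (hS m x) + hS (m + 1) (dS (m + 1) x)))
    (g_g' : ∀ m y, g (g' y) = y - (dT m (hT m y) + hT (m + 1) (dT (m + 1) y))) :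
    IsExactSeq (cone S T) (coneD dS dT g) := by
  rintro m ⟨x, y⟩ ⟨hx, hy⟩ hxy
  obtain ⟨dx, gx⟩ : dS (m + 1 + 1) x = 0 ∧ g x = -dT (m + 1) y := by
    simpa only [coneD_apply, Prod.mk_eq_zero, neg_eq_zero, add_eq_zero_iff_eq_neg] using hxy
  obtain ⟨x₁, hx₁, hdx₁⟩ : ∃ x₁ ∈ S (m + 1), dS (m + 1) x₁ = -x := by
    refine ⟨g' y - hS (m + 1) x, sub_mem (g'_mem _ _ hy) (hS_mem _ _ hx), ?_⟩
    have homotopy := g'_g (m + 1) x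
    rw [dx, map_zero, add_zero, gx, map_neg, ← g'_d] at homotopy
    rw [map_sub, ← neg_inj, neg_sub', homotopy]
    abel
  obtain ⟨z, hz, hgz⟩ : ∃ z ∈ T (m + 1), y = g x₁ + z := ⟨y - g x₁, sub_mem hy (g_mem _ _ hx₁),
    by abel⟩
  have dz : dT (m + 1) z = 0 := by
    rw [← add_right_inj (dT (m + 1) (g x₁)), ← map_add, ← hgz, g_d, hdx₁, map_neg, gx]
    abel
  refine ⟨(x₁ + g' z, hT m z), ⟨add_mem hx₁ (g'_mem _ _ hz), hT_mem _ _ hz⟩, ?_⟩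
  have homotopy := g_g' m z
  rw [dz, map_zero, add_zero] at homotopy
  rw [coneD_apply, map_add, g'_d, dz, map_zero, add_zero, hdx₁, neg_neg, map_add, homotopy, hgz]
  congr 1
  abel

end Homotopy

variable {K : Type u} [Field K]

section Columns

variable {F G : DGAlgebra.{u, v} K} (M : DGBimodule F)

/-- The part of the Hochschild differential that preserves the number of arguments. -/
def columnD (m : ℤ) : Fam M →ₗ[K] Fam M := opI M m + opD M

lemma columnD_apply_eq_zero (m : ℤ) {c : Fam M} {n : ℕ} (h : c n = 0) : columnD M m c n = 0 := by
  ext a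
  change opI M m c n a + opD M c n a = 0
  rw [opD_apply, h]
  simp [opI, h]

lemma delta_apply_eq_columnD (m : ℤ) {c : Fam M} {n : ℕ} (h : ∀ i < n, c i = 0) :
    delta M m c n = columnD M m c n := by
  have delta_eq_columnD : delta M m c = columnD M m c + (opL M m c + opB M c + opR M c) := by
    rw [delta_eq]
    simp only [columnD, LinearMap.add_apply]
    abel
  rw [delta_eq_columnD]
  cases n with
  | zero => simp [opL_zero, opB_zero, opR_zero]
  | succ n =>
    ext a
    simp [opL_apply, opB_apply, opR_apply, h n n.lt_succ_self]

lemma delta_apply_eq_zero (m : ℤ) {c : Fam M} {n : ℕ} (h : ∀ i ≤ n, c i = 0) :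
    delta M m c n = 0 :=
  (delta_apply_eq_columnD M m fun i hi => h i hi.le).trans (columnD_apply_eq_zero M m (h n le_rfl))

variable {M} {N : DGBimodule G}

lemma isExactSeq_cone_delta_of_columnD {f : Fam M →ₗ[K] Fam N}
    (f_mem : ∀ m, ∀ c ∈ cochains M m, f c ∈ cochains N m)
    (f_delta : ∀ m c, delta N m (f c) = f (delta M m c)) (f_column : ∀ c n, c n = 0 → f c n = 0)
    (hex : IsExactSeq (cone (cochains M) (cochains N)) (coneD (columnD M) (columnD N) f)) :
    IsExactSeq (cone (cochains M) (cochains N)) (coneD (delta M) (delta N) f) := by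
  refine hex.of_leading_term
    (π := fun n => (LinearMap.proj n).prodMap (LinearMap.proj n)) ?_ ?_ ?_ ?_ ?_ ?_
  · exact fun x hx => Prod.ext (funext fun n => congrArg Prod.fst (hx n))
      (funext fun n => congrArg Prod.snd (hx n))
  · exact fun m x hx => ⟨(fun n => (x n).1 n, fun n => (x n).2 n),
      ⟨fun n => (hx n).1 n, fun n => (hx n).2 n⟩, fun n => rfl⟩
  · rintro m ⟨c, e⟩ ⟨hc, he⟩
    exact ⟨neg_mem (delta_mem hc), add_mem (f_mem _ _ hc) (delta_mem he)⟩
  · rintro m ⟨c, e⟩ ⟨hc, he⟩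
    simp [coneD_apply, delta_delta hc, delta_delta he, f_delta]
  · rintro m ⟨c, e⟩ n h
    simp only [LinearMap.prodMap_apply, LinearMap.proj_apply, Prod.mk_eq_zero] at h
    simp [coneD_apply, columnD_apply_eq_zero _ _ h.1, columnD_apply_eq_zero _ _ h.2,
      f_column _ _ h.1]
  · rintro m ⟨c, e⟩ n h
    simp only [LinearMap.prodMap_apply, LinearMap.proj_apply, Prod.mk_eq_zero] at h
    simp [coneD_apply, delta_apply_eq_columnD _ _ fun i hi => (h i hi).1,
      delta_apply_eq_columnD _ _ fun i hi => (h i hi).2]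

end Columns

section Substitution

variable {F G : DGAlgebra.{u, v} K} (M : DGBimodule F) (N : DGBimodule G)

lemma opI_apply (m : ℤ) (c : Fam M) (n : ℕ) (a : Fin n → F) :
    opI M m c n a = sg m • M.d (c n a) := rfl

/-- Composition with a linear map `w` in the values and with a linear map `u` in each argument. -/
def mapFam (w : M →ₗ[K] N) (u : G →ₗ[K] F) : Fam M →ₗ[K] Fam N where
  toFun c n := w.compMultilinearMap ((c n).compLinearMap fun _ => u)
  map_add' c c' := by funext n; ext a; simp
  map_smul' r c := by funext n; ext a; simp

lemma mapFam_apply (w : M →ₗ[K] N) (u : G →ₗ[K] F) (c : Fam M) (n : ℕ) (a : Fin n → G) :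
    mapFam M N w u c n a = w (c n fun i => u (a i)) := rfl

variable {M N} in
lemma mapFam_mem {w : M →ₗ[K] N} {u : G →ₗ[K] F} (r : ℤ)
    (hw : ∀ {i x}, x ∈ M.gr i → w x ∈ N.gr (i + r)) (hu : ∀ {i a}, a ∈ G.gr i → u a ∈ F.gr i)
    {m : ℤ} {c : Fam M} (hc : c ∈ cochains M m) : mapFam M N w u c ∈ cochains N (m + r) :=
  fun n p a ha => by
    have h := hw (hc n p (fun i => u (a i)) fun i => hu (ha i))
    rwa [add_assoc] at h

lemma opD_mapFam (w : M →ₗ[K] N) (u : G →ₗ[K] F) (u_d : ∀ a, u (G.d a) = F.d (u a))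
    (u_eps : ∀ a, u (G.eps a) = F.eps (u a)) (c : Fam M) :
    opD N (mapFam M N w u c) = mapFam M N w u (opD M c) := by
  funext n; ext a
  rw [mapFam_apply, opD_apply, opD_apply, map_sum]
  refine Finset.sum_congr rfl fun i _ => ?_
  rw [map_zsmul, mapFam_apply]
  congr 3
  funext j
  simp only [← u_d, ← u_eps]
  split_ifs <;> rfl

lemma columnD_mapFam (w : M →ₗ[K] N) (u : G →ₗ[K] F) (w_d : ∀ x, w (M.d x) = N.d (w x))
    (u_d : ∀ a, u (G.d a) = F.d (u a)) (u_eps : ∀ a, u (G.eps a) = F.eps (u a)) (m : ℤ)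
    (c : Fam M) : columnD N m (mapFam M N w u c) = mapFam M N w u (columnD M m c) := by
  have opI_mapFam : opI N m (mapFam M N w u c) = mapFam M N w u (opI M m c) := by
    funext n; ext a
    simp [opI, mapFam, w_d]
  simp only [columnD, LinearMap.add_apply, map_add, opD_mapFam M N w u u_d u_eps, opI_mapFam]

end Substitution

section ValueHomotopy

variable {F : DGAlgebra.{u, v} K} (M : DGBimodule F)

lemma columnD_valueHomotopy (s : M →ₗ[K] M) (m : ℤ) (c : Fam M) :
    mapFam M M (LinearMap.id - (M.d ∘ₗ s + s ∘ₗ M.d)) LinearMap.id c =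
      c - (columnD M m (sg m • mapFam M M s LinearMap.id c) +
        sg (m + 1) • mapFam M M s LinearMap.id (columnD M (m + 1) c)) := by
  have fam_zsmul_apply (r : ℤ) (c : Fam M) {n : ℕ} (a : Fin n → F) :
      (r • c) n a = r • c n a := rfl
  simp only [columnD, LinearMap.add_apply, map_add, map_zsmul,
    opD_mapFam M M s LinearMap.id (fun _ => rfl) (fun _ => rfl)]
  funext n; ext a
  simp only [fam_sub_apply, fam_add_apply, fam_neg_apply, opI_apply, fam_zsmul_apply,
    mapFam_apply, sg_succ, map_zsmul, map_neg, smul_smul, smul_add, neg_smul, smul_neg, sg_mul_self,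
    one_smul, LinearMap.sub_apply, LinearMap.add_apply, LinearMap.comp_apply, LinearMap.id_apply]
  abel

end ValueHomotopy

section ArgumentHomotopy

variable {F : DGAlgebra.{u, v} K} (M : DGBimodule F)

/-- The map induced on multilinear maps by `∑ i, e ⊗ ⋯ ⊗ e ⊗ t ⊗ 1 ⊗ ⋯ ⊗ 1` (with `t` at the
`i`-th place), where `t` is a map of odd degree. If `t` is a homotopy from `e` to the identity,
this is one from `e ⊗ ⋯ ⊗ e` to the identity. -/
def argumentHomotopy (e t : F →ₗ[K] F) : Fam M →ₗ[K] Fam M where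
  toFun c n := ∑ i : Fin n, sg i • (c n).compLinearMap fun j =>
    if j < i then e ∘ₗ F.eps else if j = i then t else LinearMap.id
  map_add' c c' := by funext n; ext a; simp [Finset.sum_add_distrib]
  map_smul' r c := by funext n; ext a; simp [Finset.smul_sum, smul_comm r]

variable (e t : F →ₗ[K] F)

lemma argumentHomotopy_apply (c : Fam M) (n : ℕ) (a : Fin n → F) :
    argumentHomotopy M e t c n a = ∑ i : Fin n, sg i •
      c n (fun j => if j < i then e (F.eps (a j)) else if j = i then t (a j) else a j) := by
  simp only [argumentHomotopy, LinearMap.coe_mk, AddHom.coe_mk, sum_apply, smul_apply,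
    MultilinearMap.compLinearMap_apply]
  refine Finset.sum_congr rfl fun i _ => ?_
  congr 2
  funext j
  split_ifs <;> rfl

lemma argumentHomotopy_zero (c : Fam M) : argumentHomotopy M e t c 0 = 0 := by
  ext a
  simp [argumentHomotopy_apply]

lemma lc_argumentHomotopy (x : F) (c : Fam M) :
    lc M x (argumentHomotopy M e t c) =
      lc M (t x) c - argumentHomotopy M e t (lc M (e (F.eps x)) c) := by
  funext n; ext a
  rw [fam_sub_apply]
  simp only [lc_apply, argumentHomotopy_apply, Fin.sum_univ_succ, sub_eq_add_neg,
    ← Finset.sum_neg_distrib]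
  congr 1
  · simp only [Fin.val_zero, Nat.cast_zero, sg_zero, one_smul]
    congr 1
    funext j
    cases j using Fin.cases <;> simp
  · refine Finset.sum_congr rfl fun i _ => ?_
    simp only [Fin.val_succ, Nat.cast_succ, sg_succ, neg_smul]
    congr 3
    funext j
    cases j using Fin.cases <;> simp

variable {M e t}

lemma argumentHomotopy_mem (e_mem : ∀ {i a}, a ∈ F.gr i → e a ∈ F.gr i)
    (t_mem : ∀ {i a}, a ∈ F.gr i → t a ∈ F.gr (i - 1)) {m : ℤ} {c : Fam M}
    (hc : c ∈ cochains M (m + 1)) : argumentHomotopy M e t c ∈ cochains M m := by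
  intro n
  induction n generalizing m c with
  | zero => intro p a _; simp [argumentHomotopy_zero]
  | succ n ih =>
    intro p a ha
    have curry : argumentHomotopy M e t c (n + 1) a =
        lc M (a 0) (argumentHomotopy M e t c) n (Fin.tail a) := by simp [lc_apply]
    rw [curry, lc_argumentHomotopy, fam_sub_apply, Fin.sum_univ_succ]
    refine sub_mem ?_ ?_
    · convert lc_mem (t_mem (ha 0)) hc n (fun i => p i.succ) (Fin.tail a) (fun i => ha i.succ)
        using 2
      ring
    · have hlc : lc M (e (F.eps (a 0))) c ∈ cochains M (m + p 0 - 1 + 1) := by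
        convert lc_mem (e_mem (F.eps_mem (ha 0))) hc using 2
        ring
      convert ih hlc (fun i => p i.succ) (Fin.tail a) (fun i => ha i.succ) using 2
      ring

lemma lc_opD_argumentHomotopy (e_d : ∀ a, e (F.d a) = F.d (e a))
    (e_eps : ∀ a, e (F.eps a) = F.eps (e a)) (t_eps : ∀ a, t (F.eps a) = -F.eps (t a))
    (e_eq : ∀ a, e a = a - (F.d (t a) + t (F.d a))) (x : F) (c : Fam M) :
    lc M x (opD M (argumentHomotopy M e t c) + argumentHomotopy M e t (opD M c)) =
      lc M (x - e x) c + (opD M (argumentHomotopy M e t (lc M (e x) c)) +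
        argumentHomotopy M e t (opD M (lc M (e x) c))) := by
  have sub_e : x - e x = F.d (t x) + t (F.d x) := by rw [e_eq]; abel
  rw [sub_e]
  simp only [lc_opD, lc_argumentHomotopy, map_sub, F.eps_d, ← e_eps, e_d, t_eps, F.eps_eps,
    lc_neg, lc_add, map_neg, map_add]
  abel

lemma opD_argumentHomotopy (e_d : ∀ a, e (F.d a) = F.d (e a))
    (e_eps : ∀ a, e (F.eps a) = F.eps (e a)) (t_eps : ∀ a, t (F.eps a) = -F.eps (t a))
    (e_eq : ∀ a, e a = a - (F.d (t a) + t (F.d a))) (c : Fam M) :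
    opD M (argumentHomotopy M e t c) + argumentHomotopy M e t (opD M c) =
      c - mapFam M M LinearMap.id e c := by
  funext n
  induction n generalizing c with
  | zero =>
    have mapFam_zero : mapFam M M LinearMap.id e c 0 = c 0 := by
      ext a
      exact congrArg (c 0) (Subsingleton.elim _ _)
    rw [Pi.add_apply, Pi.sub_apply, mapFam_zero, argumentHomotopy_zero, opD_zero, sub_self,
      add_zero]
  | succ n ih =>
    ext a
    have curry (c : Fam M) : c (n + 1) a = lc M (a 0) c n (Fin.tail a) := by simp [lc_apply]
    have lc_mapFam : lc M (a 0) (mapFam M M LinearMap.id e c) n (Fin.tail a) =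
        mapFam M M LinearMap.id e (lc M (e (a 0)) c) n (Fin.tail a) := by
      simp only [lc_apply, mapFam_apply]
      congr 2
      funext j
      cases j using Fin.cases <;> rfl
    rw [curry, lc_opD_argumentHomotopy e_d e_eps t_eps e_eq, fam_add_apply, ih, fam_sub_apply,
      curry, map_sub, fam_sub_apply, lc_mapFam, sub_eq_add_neg (a 0), lc_add, lc_neg, fam_add_apply,
      fam_neg_apply]
    abel

lemma columnD_argumentHomotopy (e_d : ∀ a, e (F.d a) = F.d (e a))
    (e_eps : ∀ a, e (F.eps a) = F.eps (e a)) (t_eps : ∀ a, t (F.eps a) = -F.eps (t a))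
    (e_eq : ∀ a, e a = a - (F.d (t a) + t (F.d a))) (m : ℤ) (c : Fam M) :
    mapFam M M LinearMap.id e c = c - (columnD M m (argumentHomotopy M e t c) +
      argumentHomotopy M e t (columnD M (m + 1) c)) := by
  have opI_argumentHomotopy :
      opI M m (argumentHomotopy M e t c) + argumentHomotopy M e t (opI M (m + 1) c) = 0 := by
    funext n; ext a
    rw [fam_add_apply, opI_apply, argumentHomotopy_apply, argumentHomotopy_apply]
    simp only [opI_apply, map_sum, map_zsmul, Finset.smul_sum, ← Finset.sum_add_distrib]
    refine Finset.sum_eq_zero fun i _ => ?_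
    rw [smul_comm (sg m), sg_succ, neg_smul, smul_neg, add_neg_cancel]
  have split : columnD M m (argumentHomotopy M e t c) +
      argumentHomotopy M e t (columnD M (m + 1) c) =
      (opI M m (argumentHomotopy M e t c) + argumentHomotopy M e t (opI M (m + 1) c)) +
        (opD M (argumentHomotopy M e t c) + argumentHomotopy M e t (opD M c)) := by
    simp only [columnD, LinearMap.add_apply, map_add]
    abel
  rw [split, opI_argumentHomotopy, zero_add, opD_argumentHomotopy e_d e_eps t_eps e_eq,
    sub_sub_cancel]

end ArgumentHomotopy

section QuasiIso

variable {F G : DGAlgebra.{u, v} K}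

namespace DGBimodule

/-- The cochain complex underlying a differential graded bimodule. -/
def toComplex (M : DGBimodule F) : CochainComplex (ModuleCat.{v} K) ℤ :=
  CochainComplex.of (fun i => ModuleCat.of K (M.gr i))
    (fun _ => ModuleCat.ofHom (M.d.restrict fun _ h => M.d_mem h))
    (fun _ => ModuleCat.hom_ext (LinearMap.ext fun x => Subtype.ext (M.d_d x)))

/-- The morphism of cochain complexes underlying a homomorphism of differential graded
bimodules. -/
def Hom.toComplexHom {M N : DGBimodule F} (f : M.Hom N) : M.toComplex ⟶ N.toComplex :=
  CochainComplex.ofHom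
    (fun i => ModuleCat.ofHom
      (f.toLinearMap.restrict (p := M.gr i) (q := N.gr i) fun _ h => f.map_mem h))
    (fun i => by
      simp only [toComplex, CochainComplex.of_d]
      exact ModuleCat.hom_ext (LinearMap.ext fun x => Subtype.ext (f.map_d x).symm))

/-- A homomorphism of differential graded bimodules is a quasi-isomorphism if it induces
isomorphisms of all cohomology groups. -/
def Hom.IsQuasiIso {M N : DGBimodule F} (f : M.Hom N) : Prop := QuasiIso f.toComplexHom

lemma Hom.IsQuasiIso.nonempty_homotopyInverse {M N : DGBimodule F} {f : M.Hom N}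
    (hf : f.IsQuasiIso) : Nonempty (HomotopyInverse M.gr N.gr M.d N.d f.toLinearMap) :=
  ((quasiIso_iff_isExactSeq_cone (dS := fun _ => M.d) (dT := fun _ => N.d) f.toLinearMap
    (fun _ _ h => M.d_mem h) (fun _ _ h => N.d_mem h) (fun _ _ h => f.map_mem h)
    (fun _ => ModuleCat.hom_ext (LinearMap.ext fun x => Subtype.ext (M.d_d x)))
    (fun _ => ModuleCat.hom_ext (LinearMap.ext fun x => Subtype.ext (N.d_d x)))
    f.toComplexHom fun _ => rfl).1 hf).nonempty_homotopyInverse (fun _ _ h => M.d_mem h)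
    (fun _ _ h => N.d_mem h) M.d_d N.d_d (fun _ _ h => f.map_mem h) f.map_d

end DGBimodule

lemma DGAlgebra.Hom.IsQuasiIso.homOfAlgHom {φ : F.Hom G} (hφ : φ.IsQuasiIso) :
    (DGBimodule.homOfAlgHom φ).IsQuasiIso := hφ

lemma DGAlgebra.Hom.IsQuasiIso.nonempty_homotopyInverse {φ : F.Hom G} (hφ : φ.IsQuasiIso) :
    Nonempty (HomotopyInverse F.gr G.gr F.d G.d φ.toAlgHom.toLinearMap) :=
  hφ.homOfAlgHom.nonempty_homotopyInverse

lemma quasiIso_coeffMap_iff {M N : DGBimodule F} (f : M.Hom N) :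
    QuasiIso (coeffMap f) ↔ IsExactSeq (cone (cochains M) (cochains N))
      (coneD (delta M) (delta N) (coeffFam f)) :=
  quasiIso_iff_isExactSeq_cone (coeffFam f) (fun _ _ h => delta_mem h) (fun _ _ h => delta_mem h)
    (fun _ _ h => coeffFam_mem f h)
    (fun _ => ModuleCat.hom_ext (LinearMap.ext fun c => Subtype.ext (delta_delta c.2)))
    (fun _ => ModuleCat.hom_ext (LinearMap.ext fun c => Subtype.ext (delta_delta c.2)))
    (coeffMap f) fun _ => rfl

lemma quasiIso_restrictMap_iff (φ : F.Hom G) (N : DGBimodule G) :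
    QuasiIso (restrictMap φ N) ↔
      IsExactSeq (cone (cochains N) (cochains (DGBimodule.restrict φ N)))
        (coneD (delta N) (delta (DGBimodule.restrict φ N)) (restrictFam φ N)) :=
  quasiIso_iff_isExactSeq_cone (restrictFam φ N) (fun _ _ h => delta_mem h)
    (fun _ _ h => delta_mem h) (fun _ _ h => restrictFam_mem φ N h)
    (fun _ => ModuleCat.hom_ext (LinearMap.ext fun c => Subtype.ext (delta_delta c.2)))
    (fun _ => ModuleCat.hom_ext (LinearMap.ext fun c => Subtype.ext (delta_delta c.2)))
    (restrictMap φ N) fun _ => rfl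

end QuasiIso

section Invariance

variable {V W : Type v} [AddCommGroup V] [Module K V] [AddCommGroup W] [Module K W]

lemma signMap_comp_of_degree (𝒱 : ℤ → Submodule K V) [DirectSum.Decomposition 𝒱]
    (𝒲 : ℤ → Submodule K W) [DirectSum.Decomposition 𝒲] {f : V →ₗ[K] W} (r : ℤ)
    (hf : ∀ {i a}, a ∈ 𝒱 i → f a ∈ 𝒲 (i + r)) (m : ℤ) (a : V) :
    signMap 𝒲 m (f a) = sg (m * r) • f (signMap 𝒱 m a) := by
  refine ext_of_homogeneous 𝒱 (f := signMap 𝒲 m ∘ₗ f)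
    (g := sg (m * r) • f ∘ₗ signMap 𝒱 m) (fun i a ha => ?_) a
  simp [signMap_apply 𝒱 _ ha, signMap_apply 𝒲 _ (hf ha), mul_add, sg_add, mul_smul,
    smul_comm (sg (m * i))]

variable {F G : DGAlgebra.{u, v} K}

lemma DGAlgebra.map_eps_of_degree_zero {f : F →ₗ[K] G}
    (hf : ∀ {i a}, a ∈ F.gr i → f a ∈ G.gr i) (a : F) : f (F.eps a) = G.eps (f a) := by
  have h := signMap_comp_of_degree F.gr G.gr (f := f) 0 (fun ha => by simpa using hf ha) 1 a
  simpa [eps, sgn] using h.symm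

lemma DGAlgebra.map_eps_of_degree_neg_one {f : F →ₗ[K] G}
    (hf : ∀ {i a}, a ∈ F.gr i → f a ∈ G.gr (i - 1)) (a : F) : f (F.eps a) = -G.eps (f a) := by
  have h := signMap_comp_of_degree F.gr G.gr (f := f) (-1) (fun ha => hf ha) 1 a
  rw [eps, sgn, eps, sgn, h]
  simp [sg]

theorem quasiIso_coeffMap {M N : DGBimodule F} {f : M.Hom N} (hf : f.IsQuasiIso) :
    QuasiIso (coeffMap f) := by
  obtain ⟨I⟩ := hf.nonempty_homotopyInverse
  have values_mem {P Q : DGBimodule F} {w : P →ₗ[K] Q} (r : ℤ)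
      (hw : ∀ {i x}, x ∈ P.gr i → w x ∈ Q.gr (i + r)) {m : ℤ} {c : Fam P}
      (hc : c ∈ cochains P m) : mapFam P Q w LinearMap.id c ∈ cochains Q (m + r) :=
    mapFam_mem r hw (fun ha => ha) hc
  refine (quasiIso_coeffMap_iff f).2 (isExactSeq_cone_delta_of_columnD
    (fun m c hc => coeffFam_mem f hc) (coeffFam_delta f)
    (fun c n h => by ext a; simp [coeffFam_apply, h]) ?_)
  refine isExactSeq_cone_of_homotopy (g' := mapFam N M I.inv LinearMap.id)
    (hS := fun m => sg m • mapFam M M I.src LinearMap.id)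
    (hT := fun m => sg m • mapFam N N I.tgt LinearMap.id) (fun m c hc => coeffFam_mem f hc)
    (fun m c hc => ?_) (fun m c hc => ?_) (fun m c hc => ?_) (fun m c => ?_) (fun m c => ?_)
    (fun m c => ?_) (fun m c => ?_)
  · simpa using values_mem 0 (fun hx => by simpa using I.inv_mem hx) hc
  · exact zsmul_mem (by simpa using values_mem (-1) I.src_mem hc) _
  · exact zsmul_mem (by simpa using values_mem (-1) I.tgt_mem hc) _
  · exact columnD_mapFam M N f.toLinearMap LinearMap.id f.map_d (fun _ => rfl) (fun _ => rfl) m c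
  · exact columnD_mapFam N M I.inv LinearMap.id I.inv_d (fun _ => rfl) (fun _ => rfl) m c
  · refine Eq.trans ?_ (columnD_valueHomotopy M I.src m c)
    funext n; ext a
    exact I.inv_map _
  · refine Eq.trans ?_ (columnD_valueHomotopy N I.tgt m c)
    funext n; ext a
    exact I.map_inv _

theorem quasiIso_restrictMap {φ : F.Hom G} (hφ : φ.IsQuasiIso) (N : DGBimodule G) :
    QuasiIso (restrictMap φ N) := by
  obtain ⟨I⟩ := hφ.nonempty_homotopyInverse
  have φ_eps := DGAlgebra.map_eps_of_degree_zero (f := φ.toAlgHom.toLinearMap) φ.map_mem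
  have inv_eps := DGAlgebra.map_eps_of_degree_zero I.inv_mem
  refine (quasiIso_restrictMap_iff φ N).2 (isExactSeq_cone_delta_of_columnD
    (fun m c hc => restrictFam_mem φ N hc) (restrictFam_delta φ N)
    (fun c n h => by ext a; rw [restrictFam_apply, h]; rfl) ?_)
  refine isExactSeq_cone_of_homotopy
    (g' := mapFam (DGBimodule.restrict φ N) N LinearMap.id I.inv)
    (hS := fun _ => argumentHomotopy N (φ.toAlgHom.toLinearMap ∘ₗ I.inv) I.tgt)
    (hT := fun _ => argumentHomotopy (DGBimodule.restrict φ N)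
      (I.inv ∘ₗ φ.toAlgHom.toLinearMap) I.src)
    (fun m c hc => restrictFam_mem φ N hc) (fun m c hc => ?_) (fun m c hc => ?_)
    (fun m c hc => ?_) (fun m c => ?_) (fun m c => ?_) (fun m c => ?_) (fun m c => ?_)
  · exact fun n p a ha => hc n p _ fun i => I.inv_mem (ha i)
  · exact argumentHomotopy_mem (fun ha => φ.map_mem (I.inv_mem ha)) I.tgt_mem hc
  · exact argumentHomotopy_mem (fun ha => I.inv_mem (φ.map_mem ha)) I.src_mem hc
  · exact columnD_mapFam N (DGBimodule.restrict φ N) LinearMap.id φ.toAlgHom.toLinearMap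
      (fun _ => rfl) φ.map_d φ_eps m c
  · exact columnD_mapFam (DGBimodule.restrict φ N) N LinearMap.id I.inv (fun _ => rfl) I.inv_d
      inv_eps m c
  · exact columnD_argumentHomotopy (e := φ.toAlgHom.toLinearMap ∘ₗ I.inv)
      (fun a => (congrArg _ (I.inv_d a)).trans (φ.map_d _))
      (fun a => (congrArg _ (inv_eps a)).trans (φ_eps _))
      (DGAlgebra.map_eps_of_degree_neg_one I.tgt_mem) I.map_inv m c
  · exact columnD_argumentHomotopy (M := DGBimodule.restrict φ N)
      (e := I.inv ∘ₗ φ.toAlgHom.toLinearMap)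
      (fun a => (congrArg I.inv (φ.map_d a)).trans (I.inv_d _))
      (fun a => (congrArg I.inv (φ_eps a)).trans (inv_eps _))
      (DGAlgebra.map_eps_of_degree_neg_one I.src_mem) I.inv_map m c

end Invariance

section Counting

lemma val_le_val_of_strictMono {n m : ℕ} {h : Fin n → Fin m} (hh : StrictMono h) (i : Fin n) :
    (i : ℕ) ≤ h i := by
  simpa using Finset.card_le_card_of_injOn (s := Finset.Iio i) (t := Finset.Iio (h i)) h
    (fun k hk => by simpa using hh (by simpa using hk)) hh.injective.injOn

lemma sub_val_le_sub_val_of_strictMono {n m : ℕ} {h : Fin n → Fin m} (hh : StrictMono h)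
    (i : Fin n) : n - (i : ℕ) ≤ m - h i := by
  simpa using Finset.card_le_card_of_injOn (s := Finset.Ici i) (t := Finset.Ici (h i)) h
    (fun k hk => by simpa using hh.monotone (by simpa using hk)) hh.injective.injOn

variable {n : ℕ} (σ : Equiv.Perm (Fin n))

/-- The natural number `i` is a position where `σ` has a descent. -/
def IsDescent (i : ℕ) : Prop := ∃ h : i + 1 < n, σ ⟨i + 1, h⟩ < σ ⟨i, by omega⟩

instance : DecidablePred (IsDescent σ) := fun _ => inferInstanceAs (Decidable (∃ _, _))

lemma descents_eq_count : descents σ = Nat.count (IsDescent σ) n := by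
  rw [Nat.count_eq_card_filter_range, descents]
  refine Finset.card_bij (fun i _ => (i : ℕ)) (fun i hi => ?_) (fun i _ j _ h => Fin.ext h)
    (fun i hi => ?_)
  · rw [Finset.mem_filter, Finset.mem_range]
    exact ⟨i.2, (Finset.mem_filter.1 hi).2⟩
  · rw [Finset.mem_filter, Finset.mem_range] at hi
    exact ⟨⟨i, hi.1⟩, Finset.mem_filter.2 ⟨Finset.mem_univ _, hi.2⟩, rfl⟩

lemma count_isDescent_le (i : Fin n) : Nat.count (IsDescent σ) i ≤ descents σ := by
  rw [descents_eq_count]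
  exact Nat.count_monotone _ i.2.le

/-- The last position is never a descent, whence the strict inequality. -/
lemma descents_add_val_lt (i : Fin n) : descents σ + i < Nat.count (IsDescent σ) i + n := by
  obtain ⟨k, hk⟩ : ∃ k, n = i + k + 1 := ⟨n - 1 - i, by omega⟩
  have last : ¬ IsDescent σ (i + k) := fun ⟨h, _⟩ => by omega
  have split : Nat.count (IsDescent σ) n = Nat.count (IsDescent σ) (i + k) :=
    (congrArg _ hk).trans (Nat.count_succ_eq_count last)
  rw [descents_eq_count, split, Nat.count_add]
  have := Nat.count_le (p := fun j => IsDescent σ (i + j)) (n := k)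
  omega

/-- Subtracting the number of earlier descents turns the requirement that the values increase
weakly, and strictly at the descents of `σ`, into strict monotonicity. -/
lemma sort_eq_iff_strictMono (g : Fin n → ℕ) :
    Tuple.sort g = σ ↔ StrictMono fun i : Fin n => g (σ i) + i - Nat.count (IsDescent σ) i := by
  rw [eq_comm, Tuple.eq_sort_iff']
  change StrictMono (fun i => toLex (g (σ i), σ i)) ↔ _
  cases n with
  | zero => exact ⟨fun _ i => i.elim0, fun _ i => i.elim0⟩
  | succ n =>
    rw [Fin.strictMono_iff_lt_succ, Fin.strictMono_iff_lt_succ]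
    refine forall_congr' fun i => ?_
    have hi := Nat.count_le (p := IsDescent σ) (n := i)
    have hdesc : IsDescent σ i ↔ σ i.succ < σ i.castSucc := ⟨fun h => h.2, fun h => ⟨by omega, h⟩⟩
    have hne : σ i.castSucc ≠ σ i.succ := σ.injective.ne Fin.castSucc_lt_succ.ne
    rw [Prod.Lex.toLex_lt_toLex]
    simp only [Fin.val_succ, Fin.val_castSucc, Nat.count_succ, hdesc]
    rcases hne.lt_or_gt with h | h
    · simp only [h, h.not_gt, if_false, and_true, add_zero]
      omega
    · simp only [h, h.not_gt, if_true, and_false, or_false]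
      omega

lemma sort_comp_of_strictMono {α β : Type*} [LinearOrder α] [LinearOrder β] {e : α → β}
    (he : StrictMono e) (g : Fin n → α) : Tuple.sort (e ∘ g) = Tuple.sort g := by
  rw [eq_comm, Tuple.eq_sort_iff]
  exact ⟨he.monotone.comp (Tuple.monotone_sort g), fun i j hij h =>
    (Tuple.eq_sort_iff.1 rfl).2 i j hij (he.injective h)⟩

/-- The labellings sorted by `σ` correspond to the strictly increasing maps
`i ↦ g (σ i) + i - #{descents before i}`. -/
def sortEquivOrderEmbedding (N : ℕ) :
    {g : Fin n → Fin N // Tuple.sort g = σ} ≃ (Fin n ↪o Fin (N + n - 1 - descents σ)) where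
  toFun g := OrderEmbedding.ofStrictMono
    (fun i => ⟨g.1 (σ i) + i - Nat.count (IsDescent σ) i, by
      have := Nat.count_le (p := IsDescent σ) (n := i)
      have := descents_add_val_lt σ i
      have := (g.1 (σ i)).2
      omega⟩)
    ((sort_eq_iff_strictMono σ _).1 ((sort_comp_of_strictMono Fin.val_strictMono g.1).trans g.2))
  invFun h :=
    ⟨fun x => ⟨h (σ.symm x) + Nat.count (IsDescent σ) (σ.symm x) - σ.symm x, by
      have := val_le_val_of_strictMono h.strictMono (σ.symm x)
      have := sub_val_le_sub_val_of_strictMono h.strictMono (σ.symm x)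
      have := count_isDescent_le σ (σ.symm x)
      omega⟩, by
      rw [← sort_comp_of_strictMono Fin.val_strictMono, sort_eq_iff_strictMono]
      convert Fin.val_strictMono.comp h.strictMono using 2 with i
      have := val_le_val_of_strictMono h.strictMono i
      simp only [Function.comp_apply, Equiv.symm_apply_apply]
      omega⟩
  left_inv g := by
    ext x
    have := Nat.count_le (p := IsDescent σ) (n := σ.symm x)
    change (g.1 (σ (σ.symm x)) + σ.symm x - Nat.count (IsDescent σ) (σ.symm x) +
      Nat.count (IsDescent σ) (σ.symm x) - σ.symm x : ℕ) = g.1 x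
    rw [Equiv.apply_symm_apply]
    omega
  right_inv h := by
    ext i
    have := val_le_val_of_strictMono h.strictMono i
    change (h (σ.symm (σ i)) + Nat.count (IsDescent σ) (σ.symm (σ i)) - (σ.symm (σ i) : ℕ) + i -
      Nat.count (IsDescent σ) i : ℕ) = h i
    rw [Equiv.symm_apply_apply]
    omega

lemma card_sort_eq (N : ℕ) :
    (Finset.univ.filter fun g : Fin n → Fin N => Tuple.sort g = σ).card =
      (N + n - 1 - descents σ).choose n := by
  rw [← Fintype.card_subtype, Fintype.card_eq_nat_card, Nat.card_congr
    ((sortEquivOrderEmbedding σ N).trans Set.powersetCard.ofFinEmbEquiv), Set.powersetCard.card,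
    Nat.card_fin]

variable (K)

lemma eulerianCoeff_eq_zero {n k : ℕ} (h : n < k) (d : ℕ) : eulerianCoeff K n k d = 0 := by
  refine Polynomial.coeff_eq_zero_of_natDegree_lt (lt_of_le_of_lt ?_ h)
  refine (Polynomial.natDegree_C_mul_le _ _).trans ((Polynomial.natDegree_prod_le _ _).trans ?_)
  refine (Finset.sum_le_card_nsmul _ _ 1 fun j _ => ?_).trans (by simp)
  rw [sub_add, ← map_sub]
  exact Polynomial.natDegree_X_sub_C_le _

lemma sum_pow_mul_eulerianCoeff (x : K) (n d : ℕ) :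
    ∑ k ∈ Finset.range (n + 1), x ^ k * eulerianCoeff K n k d =
      (n.factorial : K)⁻¹ * ∏ j ∈ Finset.range n, (x - d + j) := by
  have hdeg : (Polynomial.C (n.factorial : K)⁻¹ * ∏ j ∈ Finset.range n,
      (Polynomial.X - Polynomial.C (d : K) + Polynomial.C (j : K))).natDegree < n + 1 :=
    Nat.lt_succ_iff.2 (Polynomial.natDegree_le_iff_coeff_eq_zero.2 fun k hk =>
      eulerianCoeff_eq_zero K hk d)
  calc _ = Polynomial.eval x _ :=
        ((Polynomial.eval_eq_sum_range' hdeg x).trans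
          (Finset.sum_congr rfl fun k _ => mul_comm _ _)).symm
    _ = _ := by simp [Polynomial.eval_prod]

lemma sum_eulerianCoeff_descents [CharZero K] (N : ℕ) :
    ∑ k ∈ Finset.range (n + 1), (N : K) ^ k * eulerianCoeff K n k (descents σ) =
      ((N + n - 1 - descents σ).choose n : K) := by
  rw [sum_pow_mul_eulerianCoeff, inv_mul_eq_iff_eq_mul₀ (Nat.cast_ne_zero.2 n.factorial_ne_zero),
    ← Nat.cast_mul, ← Nat.descFactorial_eq_factorial_mul_choose]
  cases n with
  | zero => simp
  | succ n =>
    have hd := descents_add_val_lt σ 0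
    simp only [Fin.val_zero, Nat.count_zero] at hd
    rw [← descPochhammer_eval_eq_descFactorial, descPochhammer_eval_eq_prod_range,
      ← Finset.prod_range_reflect]
    refine Finset.prod_congr rfl fun j hj => ?_
    rw [Finset.mem_range] at hj
    rw [show N + (n + 1) - 1 - descents σ = N + n - descents σ by omega,
      Nat.cast_sub (by omega : descents σ ≤ N + n), show n + 1 - 1 - j = n - j by omega,
      Nat.cast_sub (by omega : j ≤ n)]
    push_cast
    ring

end Counting

section Koszul

lemma prod_pairs_comp_perm {A : Type*} [CommMonoid A] {n : ℕ} (τ : Equiv.Perm (Fin n))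
    (f : Fin n → Fin n → A) (hf : ∀ i j, f i j = f j i) :
    ∏ ij : Fin n × Fin n with ij.1 < ij.2, f (τ ij.1) (τ ij.2) =
      ∏ ij : Fin n × Fin n with ij.1 < ij.2, f ij.1 ij.2 := by
  have hne : ∀ (ρ : Equiv.Perm (Fin n)) {i j}, i < j → ρ i ≠ ρ j :=
    fun ρ i j h e => h.ne (ρ.injective e)
  let r : Equiv.Perm (Fin n) → Fin n × Fin n → Fin n × Fin n := fun ρ ij =>
    if ρ ij.1 < ρ ij.2 then (ρ ij.1, ρ ij.2) else (ρ ij.2, ρ ij.1)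
  have hr : ∀ ρ ij, ij.1 < ij.2 → (r ρ ij).1 < (r ρ ij).2 := by
    intro ρ ij h
    simp only [r]
    split_ifs with h1
    · exact h1
    · exact lt_of_le_of_ne (not_lt.1 h1) (hne ρ h).symm
  have hrr : ∀ (ρ ρ' : Equiv.Perm (Fin n)) ij, (∀ x, ρ' (ρ x) = x) → ij.1 < ij.2 →
      r ρ' (r ρ ij) = ij := by
    intro ρ ρ' ij hρ h
    simp only [r]
    by_cases h1 : ρ ij.1 < ρ ij.2
    · simp [h1, hρ, h]
    · simp [h1, hρ, h.not_gt]
  refine Finset.prod_bij' (fun ij _ => r τ ij) (fun ij _ => r τ.symm ij)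
    (fun ij h => by simpa using hr _ _ (by simpa using h))
    (fun ij h => by simpa using hr _ _ (by simpa using h))
    (fun ij h => hrr _ _ _ (by simp) (by simpa using h))
    (fun ij h => hrr _ _ _ (by simp) (by simpa using h)) (fun ij _ => ?_)
  simp only [r]
  split_ifs
  · rfl
  · exact hf _ _

lemma koszulSign_eq_prod_ite {n : ℕ} (σ : Equiv.Perm (Fin n)) (p : Fin n → ℤ) :
    koszulSign σ p = ∏ ij : Fin n × Fin n with ij.1 < ij.2,
      if σ ij.2 < σ ij.1 then sg ((p ij.1 - 1) * (p ij.2 - 1)) else 1 := by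
  rw [koszulSign, ← Finset.prod_filter, Finset.filter_filter]

lemma koszulSign_one {n : ℕ} (p : Fin n → ℤ) : koszulSign 1 p = 1 := by
  rw [koszulSign_eq_prod_ite]
  refine Finset.prod_eq_one fun ij h => ?_
  rw [Finset.mem_filter] at h
  rw [if_neg]
  exact h.2.not_gt

lemma koszulSign_mul {n : ℕ} (σ τ : Equiv.Perm (Fin n)) (p : Fin n → ℤ) :
    koszulSign (σ * τ) p = koszulSign τ p * koszulSign σ (fun i => p (τ.symm i)) := by
  let f : Fin n → Fin n → ℤ := fun i j =>
    if i ≠ j ∧ (i < j ↔ σ j < σ i) then sg ((p (τ.symm i) - 1) * (p (τ.symm j) - 1)) else 1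
  have hf : ∀ i j, f i j = f j i := by
    intro i j
    rcases eq_or_ne i j with rfl | hij
    · rfl
    · have hσ : σ i ≠ σ j := fun h => hij (σ.injective h)
      have inversion_comm : (i < j ↔ σ j < σ i) ↔ (j < i ↔ σ i < σ j) := by
        rcases lt_or_gt_of_ne hij with h | h <;> rcases lt_or_gt_of_ne hσ with h' | h' <;>
          simp [h, h', h.not_gt, h'.not_gt]
      simp only [f, inversion_comm, ne_comm (a := i), mul_comm (p (τ.symm i) - 1)]
  have sign_σ : koszulSign σ (fun i => p (τ.symm i)) =
      ∏ ij : Fin n × Fin n with ij.1 < ij.2, f ij.1 ij.2 := by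
    rw [koszulSign_eq_prod_ite]
    refine Finset.prod_congr rfl fun ij h => ?_
    rw [Finset.mem_filter] at h
    simp [f, h.2, h.2.ne]
  rw [sign_σ, ← prod_pairs_comp_perm τ f hf, koszulSign_eq_prod_ite, koszulSign_eq_prod_ite,
    ← Finset.prod_mul_distrib]
  refine Finset.prod_congr rfl fun ij h => ?_
  rw [Finset.mem_filter] at h
  have hτ : τ ij.1 ≠ τ ij.2 := fun e => h.2.ne (τ.injective e)
  have hστ : σ (τ ij.1) ≠ σ (τ ij.2) := fun e => hτ (σ.injective e)
  simp only [f, Equiv.Perm.mul_apply, Equiv.symm_apply_apply]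
  rcases lt_or_gt_of_ne hτ with h' | h' <;> rcases lt_or_gt_of_ne hστ with h'' | h'' <;>
    simp [h', h'', h'.not_gt, h''.not_gt, hτ, sg_mul_self]

end Koszul

section Action

variable {F : DGAlgebra.{u, v} K} (M : DGBimodule F)

/-- Multilinear maps `F^n → M`. -/
abbrev Multi (n : ℕ) : Type v := MultilinearMap K (fun _ : Fin n => (F : Type v)) M

/-- The multilinear map that agrees with `s p • c` on elements of degrees `p_0, …, p_{n-1}`. -/
def twist {n : ℕ} (s : (Fin n → ℤ) → ℤ) (c : Multi M n) : Multi M n :=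
  (MultilinearMap.fromDirectSumEquiv (R := K) (κ := fun _ : Fin n => ℤ)
    (M := fun _ i => F.gr i) (M' := M) fun p => s p • c.compLinearMap fun i => (F.gr (p i)).subtype)
    |>.compLinearMap fun _ => (DirectSum.decomposeLinearEquiv F.gr).toLinearMap

lemma twist_apply {n : ℕ} (s : (Fin n → ℤ) → ℤ) (c : Multi M n) {p : Fin n → ℤ} {a : Fin n → F}
    (ha : ∀ i, a i ∈ F.gr (p i)) : twist M s c a = s p • c a := by
  have h : ∀ i, DirectSum.decomposeLinearEquiv F.gr (a i) =
      DirectSum.lof K ℤ (fun i => F.gr i) (p i) ⟨a i, ha i⟩ :=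
    fun i => DirectSum.decomposeLinearEquiv_apply_coe F.gr (p i) ⟨a i, ha i⟩
  rw [twist, MultilinearMap.compLinearMap_apply]
  have h' : (fun i => (DirectSum.decomposeLinearEquiv F.gr).toLinearMap (a i)) = fun i =>
      DirectSum.lof K ℤ (fun i => F.gr i) (p i) ⟨a i, ha i⟩ := funext h
  rw [h', MultilinearMap.fromDirectSumEquiv_lof]
  rfl

/-- The graded action of a permutation on multilinear maps. -/
def permAct {n : ℕ} (σ : Equiv.Perm (Fin n)) : Module.End K (Multi M n) where
  toFun c := twist M (koszulSign σ) (c.domDomCongr σ.symm)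
  map_add' c c' := multilinear_ext fun p a ha => by
    rw [add_apply, twist_apply M _ _ ha, twist_apply M _ _ ha, twist_apply M _ _ ha]
    simp
  map_smul' r c := multilinear_ext fun p a ha => by
    rw [smul_apply, twist_apply M _ _ ha, twist_apply M _ _ ha]
    simp [smul_comm r]

lemma permAct_apply {n : ℕ} (σ : Equiv.Perm (Fin n)) (c : Multi M n) {p : Fin n → ℤ}
    {a : Fin n → F} (ha : ∀ i, a i ∈ F.gr (p i)) :
    permAct M σ c a = koszulSign σ p • c fun j => a (σ.symm j) :=
  twist_apply M _ _ ha

lemma permAct_one {n : ℕ} : permAct M (1 : Equiv.Perm (Fin n)) = 1 := by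
  ext1 c
  refine multilinear_ext fun p a ha => ?_
  rw [permAct_apply M _ _ ha, koszulSign_one, one_smul]
  rfl

lemma permAct_mul {n : ℕ} (σ τ : Equiv.Perm (Fin n)) :
    permAct M τ * permAct M σ = permAct M (σ * τ) := by
  ext1 c
  refine multilinear_ext fun p a ha => ?_
  rw [Module.End.mul_apply, permAct_apply M _ _ ha, permAct_apply M _ _ ha,
    permAct_apply M _ _ (fun i => ha (τ.symm i)), koszulSign_mul, mul_smul]
  rfl

/-- The action of the Eulerian idempotent `e_n(k)` on multilinear maps. -/
def eulerian (n k : ℕ) : Module.End K (Multi M n) :=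
  ∑ σ : Equiv.Perm (Fin n), eulerianCoeff K n k (descents σ) • permAct M σ

/-- The Adams operation of order `N = |α|`: the sum over all labellings of the `n` arguments by
elements of `α` of the permutations that sort the labels. It acts on the image of the Eulerian
idempotent `e_n(k)` as `N ^ k`. -/
def adams (n : ℕ) (α : Type) [Fintype α] [LinearOrder α] : Module.End K (Multi M n) :=
  ∑ g : Fin n → α, permAct M (Tuple.sort g)

lemma adams_congr (n : ℕ) {α β : Type} [Fintype α] [LinearOrder α] [Fintype β] [LinearOrder β]
    (e : α ≃o β) : adams M n α = adams M n β :=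
  Fintype.sum_equiv (Equiv.arrowCongr (Equiv.refl (Fin n)) e.toEquiv) _ _ fun g =>
    congrArg (permAct M) (sort_comp_of_strictMono e.strictMono g).symm

lemma sort_mul_sort {α β : Type*} [LinearOrder α] [LinearOrder β] {n : ℕ} (g : Fin n → β)
    (h : Fin n → α) : Tuple.sort g * Tuple.sort h =
      Tuple.sort fun i => toLex (h ((Tuple.sort g).symm i), g i) := by
  obtain ⟨g_mono, g_stable⟩ := Tuple.eq_sort_iff.1 (rfl : Tuple.sort g = Tuple.sort g)
  obtain ⟨h_mono, h_stable⟩ := Tuple.eq_sort_iff.1 (rfl : Tuple.sort h = Tuple.sort h)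
  rw [Tuple.eq_sort_iff]
  refine ⟨fun i j hij => ?_, fun i j hij e => ?_⟩
  · rcases hij.eq_or_lt with rfl | hij
    · rfl
    · refine Prod.Lex.toLex_le_toLex.2 ?_
      simp only [Equiv.Perm.mul_apply, Equiv.symm_apply_apply]
      rcases (h_mono hij.le).lt_or_eq with hlt | heq
      · exact Or.inl hlt
      · exact Or.inr ⟨heq, g_mono (h_stable i j hij heq).le⟩
  · have e' := Prod.ext_iff.1 (toLex_inj.1 e)
    simp only [Equiv.Perm.mul_apply, Equiv.symm_apply_apply] at e' ⊢
    exact g_stable _ _ (h_stable i j hij e'.1) e'.2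

lemma adams_mul (n : ℕ) (α β : Type) [Fintype α] [LinearOrder α] [Fintype β] [LinearOrder β] :
    adams M n α * adams M n β = adams M n (α ×ₗ β) := by
  simp only [adams, Finset.sum_mul_sum, permAct_mul, sort_mul_sort]
  rw [Finset.sum_comm, ← Finset.sum_product']
  exact Finset.sum_bij'
    (fun gh _ i => toLex (gh.2 ((Tuple.sort gh.1).symm i), gh.1 i))
    (fun k _ => (fun i => (ofLex (k i)).2,
      fun i => (ofLex (k (Tuple.sort (fun i => (ofLex (k i)).2) i))).1))
    (fun _ _ => Finset.mem_univ _) (fun _ _ => Finset.mem_univ _)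
    (fun gh _ => Prod.ext rfl (funext fun i => by simp)) (fun k _ => funext fun i => by simp)
    (fun _ _ => rfl)

lemma adams_fin_mul (n N N' : ℕ) :
    adams M n (Fin N) * adams M n (Fin N') = adams M n (Fin (N * N')) :=
  (adams_mul M n _ _).trans
    (adams_congr M n (Fintype.orderIsoFinOfCardEq _ (by simp [Lex, Fintype.card_prod])).symm)

lemma adams_one (n : ℕ) : adams M n (Fin 1) = 1 := by
  rw [adams, Fintype.sum_unique, ← permAct_one]
  congr 1
  rw [eq_comm, Tuple.eq_sort_iff]
  exact ⟨fun _ _ _ => (Subsingleton.elim _ _).le, fun i j h _ => h⟩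

lemma eulerian_eq_zero {n k : ℕ} (h : n < k) : eulerian M n k = 0 :=
  Finset.sum_eq_zero fun σ _ => by rw [eulerianCoeff_eq_zero K h, zero_smul]

variable [CharZero K]

lemma adams_eq_sum_eulerian (n N : ℕ) :
    adams M n (Fin N) = ∑ k ∈ Finset.range (n + 1), (N : K) ^ k • eulerian M n k := by
  have adams_eq : adams M n (Fin N) = ∑ σ : Equiv.Perm (Fin n),
      ((N + n - 1 - descents σ).choose n : K) • permAct M σ := by
    rw [adams, ← Finset.sum_fiberwise Finset.univ (fun g : Fin n → Fin N => Tuple.sort g)]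
    refine Finset.sum_congr rfl fun σ _ => ?_
    rw [← card_sort_eq σ N, Finset.sum_congr rfl (g := fun _ => permAct M σ)
      (fun g hg => by rw [(Finset.mem_filter.1 hg).2]), Finset.sum_const, Nat.cast_smul_eq_nsmul]
  rw [adams_eq]
  simp only [eulerian, Finset.smul_sum, smul_smul]
  rw [Finset.sum_comm]
  refine Finset.sum_congr rfl fun σ _ => ?_
  rw [← Finset.sum_smul, sum_eulerianCoeff_descents]

lemma sum_eulerian (n : ℕ) : ∑ k ∈ Finset.range (n + 1), eulerian M n k = 1 := by
  have h := adams_eq_sum_eulerian M n 1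
  rw [adams_one] at h
  simpa using h.symm

lemma eq_of_sum_pow_smul_eq {V : Type*} [AddCommGroup V] [Module K V] {n : ℕ} {x y : ℕ → V}
    (h : ∀ N : ℕ, ∑ k ∈ Finset.range n, (N : K) ^ k • x k =
      ∑ k ∈ Finset.range n, (N : K) ^ k • y k) {k : ℕ} (hk : k < n) : x k = y k := by
  rw [← sub_eq_zero, ← Module.forall_dual_apply_eq_zero_iff K]
  intro f
  let P : Polynomial K := ∑ k ∈ Finset.range n, Polynomial.monomial k (f (x k - y k))
  have hP : P = 0 := by
    refine Polynomial.eq_zero_of_infinite_isRoot P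
      ((Set.infinite_range_of_injective (Nat.cast_injective (R := K))).mono ?_)
    rintro _ ⟨N, rfl⟩
    have hN : ∑ k ∈ Finset.range n, (N : K) ^ k • f (x k - y k) = 0 := by
      simp only [← map_smul, ← map_sum, smul_sub, Finset.sum_sub_distrib, h N, sub_self, map_zero]
    simp only [P, Set.mem_ofPred_eq, Polynomial.IsRoot, Polynomial.eval_finsetSum,
      Polynomial.eval_monomial]
    exact (Finset.sum_congr rfl fun k _ => mul_comm _ _).trans hN
  have hcoeff := congrArg (fun P => Polynomial.coeff P k) hP
  simpa [P, Polynomial.coeff_monomial, hk] using hcoeff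

lemma eulerian_mul_adams {n i : ℕ} (hi : i ≤ n) (N : ℕ) :
    eulerian M n i * adams M n (Fin N) = (N : K) ^ i • eulerian M n i := by
  refine eq_of_sum_pow_smul_eq (K := K) (n := n + 1)
    (x := fun k => eulerian M n k * adams M n (Fin N))
    (y := fun k => (N : K) ^ k • eulerian M n k) (fun N' => ?_) (Nat.lt_succ_iff.2 hi)
  have h := adams_fin_mul M n N' N
  rw [adams_eq_sum_eulerian M n N', adams_eq_sum_eulerian M n (N' * N), Finset.sum_mul] at h
  simpa only [smul_mul_assoc, Nat.cast_mul, mul_pow, mul_smul] using h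

lemma eulerian_mul (n i j : ℕ) :
    eulerian M n i * eulerian M n j = if i = j then eulerian M n i else 0 := by
  rcases lt_or_ge n i with hi | hi
  · simp [eulerian_eq_zero M hi]
  rcases lt_or_ge n j with hj | hj
  · rw [eulerian_eq_zero M hj, mul_zero, if_neg (by omega)]
  refine eq_of_sum_pow_smul_eq (K := K) (n := n + 1)
    (x := fun k => eulerian M n i * eulerian M n k)
    (y := fun k => if i = k then eulerian M n i else 0) (fun N => ?_) (Nat.lt_succ_iff.2 hj)
  have h := eulerian_mul_adams M hi N
  rw [adams_eq_sum_eulerian, Finset.mul_sum] at h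
  simp only [mul_smul_comm] at h
  simp only [h, smul_ite, smul_zero, Finset.sum_ite_eq, Finset.mem_range, Nat.lt_succ_iff, hi,
    if_true]

lemma eulerian_apply_eq_self_iff {n k : ℕ} (hk : k ≤ n) (c : Multi M n) :
    eulerian M n k c = c ↔ adams M n (Fin 2) c = (2 : K) ^ k • c := by
  have eulerian_eulerian (i j : ℕ) :
      eulerian M n i (eulerian M n j c) = if i = j then eulerian M n i c else 0 := by
    rw [← Module.End.mul_apply, eulerian_mul]
    split_ifs <;> rfl
  constructor
  · intro h
    rw [← h, adams_eq_sum_eulerian]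
    simp only [LinearMap.sum_apply, LinearMap.smul_apply, eulerian_eulerian]
    simp [Finset.sum_ite_eq', Nat.lt_succ_iff.2 hk]
  · intro h
    have other_components (j : ℕ) (hj : j ∈ Finset.range (n + 1)) (hjk : j ≠ k) :
        eulerian M n j c = 0 := by
      have hadams := congrArg (fun f => f c)
        (eulerian_mul_adams M (Finset.mem_range_succ_iff.1 hj) 2)
      simp only [Module.End.mul_apply, h, map_smul, LinearMap.smul_apply, Nat.cast_ofNat] at hadams
      rw [← sub_eq_zero, ← sub_smul, smul_eq_zero] at hadams
      exact hadams.resolve_left (sub_ne_zero.2 fun hpow => hjk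
        (Nat.pow_right_injective le_rfl (by exact_mod_cast hpow.symm)))
    have hsum := congrArg (fun f => f c) (sum_eulerian M n)
    simp only [LinearMap.sum_apply, Module.End.one_apply] at hsum
    rwa [Finset.sum_eq_single_of_mem k (Finset.mem_range_succ_iff.2 hk) other_components] at hsum

end Action

section Signs

variable {A : Type*} [AddCommGroup A] (a b : ℤ) (x : A)

lemma sg_smul_sg_smul : sg a • sg b • x = sg (a + b) • x := by rw [smul_smul, sg_add]

lemma sg_smul_self : sg a • sg a • x = x := by rw [smul_smul, sg_mul_self, one_smul]

lemma sg_smul_left_comm : sg a • sg b • x = sg b • sg a • x := smul_comm _ _ _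

end Signs

/-- Letters with an integral degree, a product and a differential of degree `1`: the structure of
the homogeneous elements of a shifted differential graded algebra `F[1]` that the combinatorics of
the bar construction depends on. -/
structure GradedLetters (X : Type*) where
  deg : X → ℤ
  mul : X → X → X
  d : X → X
  deg_mul : ∀ x y, deg (mul x y) = deg x + deg y + 1
  deg_d : ∀ x, deg (d x) = deg x + 1

namespace GradedLetters

variable {X : Type*} (S : GradedLetters X) {A : Type*} [AddCommGroup A]

/-- The degree of a word, the sum of the degrees of its letters. -/
def wordDeg (u : List X) : ℤ := (u.map S.deg).sum

@[simp] lemma wordDeg_nil : S.wordDeg [] = 0 := rfl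

@[simp] lemma wordDeg_cons (x : X) (u : List X) : S.wordDeg (x :: u) = S.deg x + S.wordDeg u := rfl

lemma sg_wordDeg_cons (k r : ℤ) (f : List X → A) (x : X) :
    (fun w => sg (r + k * S.wordDeg (x :: w)) • f (x :: w)) =
      fun w => sg ((r + k * S.deg x) + k * S.wordDeg w) • f (x :: w) := by
  funext w
  rw [wordDeg_cons, mul_add, add_assoc]

/-- The value of the functional `f` on the signed shuffle product of two words. -/
def shuffle : (List X → A) → List X → List X → A
  | f, [], v => f v
  | f, x :: u, [] => f (x :: u)
  | f, x :: u, y :: v => shuffle (fun w => f (x :: w)) u (y :: v) +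
      sg (S.deg y * (S.deg x + S.wordDeg u)) • shuffle (fun w => f (y :: w)) (x :: u) v
  termination_by _ u v => u.length + v.length

@[simp] lemma shuffle_nil_left (f : List X → A) (v : List X) : S.shuffle f [] v = f v := by
  rw [shuffle]

@[simp] lemma shuffle_nil_right (f : List X → A) (u : List X) : S.shuffle f u [] = f u := by
  cases u <;> rw [shuffle]

lemma shuffle_cons_cons (f : List X → A) (x y : X) (u v : List X) :
    S.shuffle f (x :: u) (y :: v) = S.shuffle (fun w => f (x :: w)) u (y :: v) +
      sg (S.deg y * (S.deg x + S.wordDeg u)) • S.shuffle (fun w => f (y :: w)) (x :: u) v := by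
  rw [shuffle]

lemma words_induction {P : List X → List X → Prop} (nil_left : ∀ v, P [] v)
    (nil_right : ∀ x u, P (x :: u) [])
    (cons_cons : ∀ x u y v, P u (y :: v) → P (x :: u) v → P (x :: u) (y :: v)) (u v : List X) :
    P u v := by
  induction u generalizing v with
  | nil => exact nil_left v
  | cons x u ih =>
    induction v with
    | nil => exact nil_right x u
    | cons y v ih' => exact cons_cons x u y v (ih _) ih'

lemma shuffle_map {B : Type*} [AddCommGroup B] (h : A →+ B) (f : List X → A) (u v : List X) :
    S.shuffle (fun w => h (f w)) u v = h (S.shuffle f u v) := by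
  induction u, v using words_induction generalizing f with
  | nil_left v => simp
  | nil_right x u => simp
  | cons_cons x u y v ih_left ih_right =>
    rw [shuffle_cons_cons, shuffle_cons_cons, map_add, map_zsmul, ih_left fun w => f (x :: w),
      ih_right fun w => f (y :: w)]

lemma shuffle_add (f g : List X → A) (u v : List X) :
    S.shuffle (fun w => f w + g w) u v = S.shuffle f u v + S.shuffle g u v := by
  induction u, v using words_induction generalizing f g with
  | nil_left v => simp
  | nil_right x u => simp
  | cons_cons x u y v ih_left ih_right =>
    rw [shuffle_cons_cons, shuffle_cons_cons, shuffle_cons_cons,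
      ih_left (fun w => f (x :: w)) fun w => g (x :: w),
      ih_right (fun w => f (y :: w)) fun w => g (y :: w), smul_add]
    abel

lemma shuffle_sub (f g : List X → A) (u v : List X) :
    S.shuffle (fun w => f w - g w) u v = S.shuffle f u v - S.shuffle g u v := by
  rw [eq_sub_iff_add_eq, ← shuffle_add]
  simp

lemma shuffle_zsmul (r : ℤ) (f : List X → A) (u v : List X) :
    S.shuffle (fun w => r • f w) u v = r • S.shuffle f u v :=
  S.shuffle_map (zsmulAddGroupHom r) f u v

/-- The value of `G` on the deconcatenation of a word: the sum of the values of `G` on all pairs of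
words whose concatenation is the given word. -/
def cut : (List X → List X → A) → List X → A
  | G, [] => G [] []
  | G, x :: w => G [] (x :: w) + cut (fun u v => G (x :: u) v) w

lemma cut_nil (G : List X → List X → A) : cut G [] = G [] [] := rfl

lemma cut_cons (G : List X → List X → A) (x : X) (w : List X) :
    cut G (x :: w) = G [] (x :: w) + cut (fun u v => G (x :: u) v) w := rfl

lemma cut_cons_eq (G : List X → List X → A) (x : X) :
    (fun w => cut G (x :: w)) = fun w => G [] (x :: w) + cut (fun u v => G (x :: u) v) w := rfl

lemma cut_add (G H : List X → List X → A) (w : List X) :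
    cut (fun u v => G u v + H u v) w = cut G w + cut H w := by
  induction w generalizing G H with
  | nil => rfl
  | cons x w ih =>
    rw [cut_cons, cut_cons, cut_cons, ih (fun u v => G (x :: u) v) fun u v => H (x :: u) v]
    abel

lemma cut_sub (G H : List X → List X → A) (w : List X) :
    cut (fun u v => G u v - H u v) w = cut G w - cut H w := by
  rw [eq_sub_iff_add_eq, ← cut_add]
  simp

lemma cut_map {B : Type*} [AddCommGroup B] (h : A →+ B) (G : List X → List X → A) (w : List X) :
    cut (fun u v => h (G u v)) w = h (cut G w) := by
  induction w generalizing G with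
  | nil => rfl
  | cons x w ih => rw [cut_cons, cut_cons, map_add, ih fun u v => G (x :: u) v]

lemma cut_zsmul (r : ℤ) (G : List X → List X → A) (w : List X) :
    cut (fun u v => r • G u v) w = r • cut G w :=
  cut_map (zsmulAddGroupHom r) G w

lemma cut_eq_sum (G : List X → List X → A) (w : List X) :
    cut G w = ∑ k ∈ Finset.range (w.length + 1), G (w.take k) (w.drop k) := by
  induction w generalizing G with
  | nil => simp [cut_nil]
  | cons x w ih =>
    rw [cut_cons, ih, List.length_cons, Finset.sum_range_succ' _ (w.length + 1)]
    simp [add_comm]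

/-- The part of the bar differential of a word that involves its first letter `x`, up to the sign
of `x`. -/
def barHead (x : X) (f : List X → A) (w : List X) : A :=
  sg (S.deg x) • f (S.d x :: w) + match w with
    | [] => 0
    | z :: w => f (S.mul x z :: w)

/-- The bar differential, acting on functionals on words. -/
def bar : (List X → A) → List X → A
  | _, [] => 0
  | f, x :: w => sg (S.deg x) • (S.barHead x f w + bar (fun w => f (x :: w)) w)

lemma barHead_nil (x : X) (f : List X → A) : S.barHead x f [] = sg (S.deg x) • f [S.d x] :=
  add_zero _

lemma barHead_cons (x z : X) (f : List X → A) (w : List X) :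
    S.barHead x f (z :: w) = sg (S.deg x) • f (S.d x :: z :: w) + f (S.mul x z :: w) := rfl

lemma bar_nil (f : List X → A) : S.bar f [] = 0 := rfl

lemma bar_cons (f : List X → A) (x : X) (w : List X) :
    S.bar f (x :: w) = sg (S.deg x) • (S.barHead x f w + S.bar (fun w => f (x :: w)) w) := rfl

lemma barHead_add (x : X) (f g : List X → A) (w : List X) :
    S.barHead x (fun w => f w + g w) w = S.barHead x f w + S.barHead x g w := by
  cases w <;> simp only [barHead_nil, barHead_cons, smul_add]
  abel

lemma bar_add (f g : List X → A) (w : List X) :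
    S.bar (fun w => f w + g w) w = S.bar f w + S.bar g w := by
  induction w generalizing f g with
  | nil => simp [bar_nil]
  | cons x w ih =>
    rw [bar_cons, bar_cons, bar_cons, ih (fun w => f (x :: w)) fun w => g (x :: w), barHead_add,
      ← smul_add]
    congr 1
    abel

lemma barHead_sg_wordDeg (k r : ℤ) (x : X) (f : List X → A) (w : List X) :
    S.barHead x (fun w => sg (r + k * S.wordDeg w) • f w) w =
      sg (r + k * (S.deg x + S.wordDeg w + 1)) • S.barHead x f w := by
  cases w <;> simp only [barHead_nil, barHead_cons, smul_add, wordDeg_cons, wordDeg_nil, S.deg_mul,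
    S.deg_d, sg_smul_sg_smul]
  · congr 2; ring
  · congr 3 <;> ring

lemma bar_sg_wordDeg (k r : ℤ) (f : List X → A) (w : List X) :
    S.bar (fun w => sg (r + k * S.wordDeg w) • f w) w =
      sg (r + k * (S.wordDeg w + 1)) • S.bar f w := by
  induction w generalizing f r with
  | nil => simp [bar_nil]
  | cons x w ih =>
    rw [bar_cons, bar_cons, barHead_sg_wordDeg, sg_wordDeg_cons, ih, wordDeg_cons,
      show r + k * S.deg x + k * (S.wordDeg w + 1) = r + k * (S.deg x + S.wordDeg w + 1) by ring,
      ← smul_add, smul_comm]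

/-- Functionals that are symmetric with respect to the order of the factors of a product. -/
def IsSymm (f : List X → A) : Prop :=
  ∀ u x y v, f (u ++ S.mul y x :: v) =
    sg ((S.deg x + 1) * (S.deg y + 1)) • f (u ++ S.mul x y :: v)

variable {S} in
lemma IsSymm.cons {f : List X → A} (hf : S.IsSymm f) (x : X) : S.IsSymm fun w => f (x :: w) :=
  fun u => hf (x :: u)

lemma shuffle_barHead_left (f : List X → A) (x y : X) (u v : List X) :
    S.shuffle (S.barHead x f) u (y :: v) = S.barHead x (fun u => S.shuffle f u (y :: v)) u
      - sg (S.deg y * (S.deg x + S.wordDeg u + 1)) •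
          S.barHead x (fun u => S.shuffle (fun w => f (y :: w)) u v) u
      + sg (S.deg y * S.wordDeg u) • S.shuffle (fun w => f (S.mul x y :: w)) u v := by
  cases u with
  | nil =>
    simp only [shuffle_nil_left, barHead_nil, barHead_cons, shuffle_cons_cons, wordDeg_nil, S.deg_d,
      add_zero, zero_mul, sg_zero, one_smul, smul_add, mul_comm, sg_smul_left_comm]
    abel
  | cons z u =>
    simp only [shuffle_cons_cons, barHead_cons, shuffle_add, shuffle_zsmul, wordDeg_cons, S.deg_d,
      S.deg_mul, mul_add, add_mul, one_mul, sg_add, mul_smul, smul_add, mul_comm,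
      sg_smul_left_comm]
    abel

lemma shuffle_barHead_right (f : List X → A) (x y : X) (u v : List X) :
    S.shuffle (S.barHead y f) (x :: u) v = sg ((S.deg y + 1) * (S.deg x + S.wordDeg u)) •
        (S.barHead y (fun v => S.shuffle f (x :: u) v) v
          - S.barHead y (fun v => S.shuffle (fun w => f (x :: w)) u v) v)
      + S.shuffle (fun w => f (S.mul y x :: w)) u v := by
  cases v with
  | nil =>
    simp only [shuffle_nil_right, barHead_nil, barHead_cons, shuffle_cons_cons, S.deg_d, mul_add,
      add_mul, one_mul, sg_add, mul_smul, smul_add, smul_sub, mul_comm,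
      sg_smul_self, sg_smul_left_comm]
    abel
  | cons z v =>
    simp only [shuffle_cons_cons, barHead_cons, shuffle_add, shuffle_zsmul, S.deg_d,
      S.deg_mul, mul_add, add_mul, one_mul, sg_add, mul_smul, smul_add, smul_sub, mul_comm,
      sg_smul_self, sg_smul_left_comm]
    abel

lemma shuffle_bar_cons (f : List X → A) (z : X) (u v : List X) :
    S.shuffle (fun w => S.bar f (z :: w)) u v = sg (S.deg z) •
      (S.shuffle (S.barHead z f) u v + S.shuffle (S.bar fun w => f (z :: w)) u v) := by
  rw [← shuffle_add, ← shuffle_zsmul]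
  rfl

lemma bar_shuffle_cons_left (f : List X → A) (x y : X) (u v : List X) :
    S.bar (fun u => S.shuffle f (x :: u) (y :: v)) u =
      S.bar (fun u => S.shuffle (fun w => f (x :: w)) u (y :: v)) u +
        sg (S.deg y * (S.deg x + S.wordDeg u + 1)) •
          S.bar (fun u => S.shuffle (fun w => f (y :: w)) (x :: u) v) u := by
  have hsg := S.bar_sg_wordDeg (S.deg y) (S.deg y * S.deg x)
    (fun u => S.shuffle (fun w => f (y :: w)) (x :: u) v) u
  simp only [shuffle_cons_cons, bar_add, mul_add] at hsg ⊢
  rw [hsg, add_assoc (S.deg y * S.deg x)]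

lemma bar_shuffle_cons_right (f : List X → A) (x y : X) (u v : List X) :
    S.bar (fun v => S.shuffle f (x :: u) (y :: v)) v =
      S.bar (fun v => S.shuffle (fun w => f (x :: w)) u (y :: v)) v +
        sg (S.deg y * (S.deg x + S.wordDeg u)) •
          S.bar (fun v => S.shuffle (fun w => f (y :: w)) (x :: u) v) v := by
  have hsg := S.bar_sg_wordDeg 0 (S.deg y * (S.deg x + S.wordDeg u))
    (fun v => S.shuffle (fun w => f (y :: w)) (x :: u) v) v
  simp only [zero_mul, add_zero] at hsg
  simp only [shuffle_cons_cons, bar_add, hsg]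

lemma shuffle_bar {f : List X → A} (hf : S.IsSymm f) (u v : List X) :
    S.shuffle (S.bar f) u v = S.bar (fun u => S.shuffle f u v) u +
      sg (S.wordDeg u) • S.bar (fun v => S.shuffle f u v) v := by
  induction u, v using words_induction generalizing f with
  | nil_left v => simp [bar_nil]
  | nil_right x u => simp [bar_nil]
  | cons_cons x u y v ih_left ih_right =>
    have shuffle_mul_swap : S.shuffle (fun w => f (S.mul y x :: w)) u v =
        sg ((S.deg x + 1) * (S.deg y + 1)) • S.shuffle (fun w => f (S.mul x y :: w)) u v := by
      rw [← shuffle_zsmul]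
      exact congrArg (fun g => S.shuffle g u v) (funext fun w => hf [] x y w)
    rw [shuffle_cons_cons, shuffle_bar_cons, shuffle_bar_cons, ih_left (hf.cons x),
      ih_right (hf.cons y), bar_cons, bar_cons, bar_cons, bar_cons, bar_shuffle_cons_left,
      bar_shuffle_cons_right, S.shuffle_barHead_left f x y u v,
      S.shuffle_barHead_right f x y u v, shuffle_mul_swap]
    simp only [wordDeg_cons, mul_add, add_mul, mul_one, one_mul, sg_add, sg_one, mul_smul, smul_add,
      smul_sub, neg_smul, one_smul, smul_neg, mul_comm, sg_smul_self, sg_smul_left_comm]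
    abel

lemma barHead_cut (x : X) (G : List X → List X → A) (w : List X) :
    S.barHead x (cut G) w =
      S.barHead x (G []) w + cut (fun u v => S.barHead x (fun u => G u v) u) w := by
  cases w with
  | nil => simp only [barHead_nil, cut_cons, cut_nil, smul_add]
  | cons z w =>
    simp only [barHead_nil, barHead_cons, cut_cons, smul_add, cut_add, cut_zsmul]
    abel

lemma bar_cut (G : List X → List X → A) (w : List X) :
    S.bar (cut G) w = cut (fun u v => S.bar (fun u => G u v) u +
      sg (S.wordDeg u) • S.bar (fun v => G u v) v) w := by
  induction w generalizing G with
  | nil => simp [bar_nil, cut_nil]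
  | cons x w ih =>
    rw [bar_cons, cut_cons_eq, bar_add, ih, barHead_cut, cut_cons]
    simp only [bar_nil, bar_cons, wordDeg_nil, wordDeg_cons, sg_zero, one_smul, zero_add, sg_add,
      mul_smul, smul_add, cut_add, cut_zsmul]
    abel

/-- The functional on words that is concentrated at the empty word. -/
def atNil (a : A) : List X → A
  | [] => a
  | _ :: _ => 0

@[simp] lemma atNil_nil (a : A) : atNil a ([] : List X) = a := rfl

@[simp] lemma atNil_cons (a : A) (x : X) (w : List X) : atNil a (x :: w) = 0 := rfl

lemma atNil_add (a b : A) (w : List X) : atNil (a + b) w = atNil a w + atNil b w := by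
  cases w <;> simp

lemma atNil_zsmul (r : ℤ) (a : A) (w : List X) : atNil (r • a) w = r • atNil a w := by
  cases w <;> simp

lemma shuffle_atNil_cons_right (a : A) (u : List X) (y : X) (v : List X) :
    S.shuffle (atNil a) u (y :: v) = 0 := by
  have shuffle_zero : ∀ u v : List X, S.shuffle (fun _ => (0 : A)) u v = 0 := fun u v => by
    simpa using S.shuffle_map (0 : A →+ A) (fun _ => 0) u v
  cases u <;> simp [shuffle_cons_cons, shuffle_zero]

lemma shuffle_atNil_cons_left (a : A) (x : X) (u v : List X) :
    S.shuffle (atNil a) (x :: u) v = 0 := by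
  cases v <;> simp [shuffle_atNil_cons_right]

lemma cut_atNil (G : List X → A) (w : List X) : cut (fun u v => atNil (G v) u) w = G w := by
  have cut_zero : ∀ w : List X, cut (fun _ _ => (0 : A)) w = 0 := fun w => by
    simpa using cut_map (0 : A →+ A) (fun _ _ => 0) w
  cases w <;> simp [cut_nil, cut_cons, cut_zero]

/-- The twist of an action `l` of the letters by the sign for moving a letter past an element of
degree `k`. -/
def signTwist (k : ℤ) (l : X → A →+ A) (z : X) : A →+ A := sg (k * S.deg z) • l z

lemma signTwist_apply (k : ℤ) (l : X → A →+ A) (z : X) (a : A) :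
    S.signTwist k l z a = sg (k * S.deg z) • l z a := rfl

lemma signTwist_zero (l : X → A →+ A) : S.signTwist 0 l = l := by
  funext z
  simp [signTwist]

lemma signTwist_signTwist (j k : ℤ) (l : X → A →+ A) :
    S.signTwist j (S.signTwist k l) = S.signTwist (j + k) l := by
  funext z
  simp [signTwist, add_mul, sg_add, mul_smul]

/-- The action of the first letter. -/
def left (l : X → A →+ A) (f : List X → A) : List X → A
  | [] => 0
  | x :: w => l x (f w)

/-- The action of the last letter, with the sign for moving it to the front. -/
def right (l : X → A →+ A) (f : List X → A) : List X → A
  | [] => 0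
  | x :: w => right (S.signTwist (S.deg x) l) (fun w => f (x :: w)) w - atNil (l x (f [])) w

lemma left_nil (l : X → A →+ A) (f : List X → A) : left l f [] = 0 := rfl

lemma left_cons (l : X → A →+ A) (f : List X → A) (x : X) (w : List X) :
    left l f (x :: w) = l x (f w) := rfl

lemma right_nil (l : X → A →+ A) (f : List X → A) : S.right l f [] = 0 := rfl

lemma right_cons (l : X → A →+ A) (f : List X → A) (x : X) (w : List X) :
    S.right l f (x :: w) =
      S.right (S.signTwist (S.deg x) l) (fun w => f (x :: w)) w - atNil (l x (f [])) w := rfl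

lemma right_add (l : X → A →+ A) (f g : List X → A) (w : List X) :
    S.right l (fun w => f w + g w) w = S.right l f w + S.right l g w := by
  induction w generalizing l f g with
  | nil => simp [right_nil]
  | cons x w ih =>
    rw [right_cons, right_cons, right_cons, ih _ (fun w => f (x :: w)) fun w => g (x :: w),
      map_add, atNil_add]
    abel

lemma right_zsmul (k : ℤ) (l : X → A →+ A) (f : List X → A) (w : List X) :
    S.right (fun z => k • l z) f w = k • S.right l f w := by
  induction w generalizing l f with
  | nil => simp [right_nil]
  | cons x w ih =>
    have twist_smul : S.signTwist (S.deg x) (fun z => k • l z) =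
        fun z => k • S.signTwist (S.deg x) l z :=
      funext fun z => smul_comm _ _ _
    rw [right_cons, right_cons, twist_smul, ih, smul_sub, AddMonoidHom.smul_apply, atNil_zsmul]

lemma right_sg_wordDeg (k r : ℤ) (l : X → A →+ A) (f : List X → A) (w : List X) :
    S.right l (fun w => sg (r + k * S.wordDeg w) • f w) w =
      sg (r + k * S.wordDeg w) • S.right (S.signTwist k l) f w := by
  induction w generalizing l f r with
  | nil => simp [right_nil]
  | cons x w ih =>
    rw [right_cons, right_cons, sg_wordDeg_cons, ih, wordDeg_cons, smul_sub, signTwist_signTwist,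
      signTwist_signTwist, add_comm k,
      show r + k * S.deg x + k * S.wordDeg w = r + k * (S.deg x + S.wordDeg w) by ring]
    congr 1
    cases w with
    | nil =>
      simp only [atNil_nil, wordDeg_nil, signTwist_apply, map_zsmul, mul_zero, add_zero, sg_add,
        mul_smul, sg_smul_self]
    | cons z w => simp

lemma shuffle_left (l : X → A →+ A) (f : List X → A) (u v : List X) :
    S.shuffle (left l f) u v = left l (fun u => S.shuffle f u v) u +
      left (S.signTwist (S.wordDeg u) l) (fun v => S.shuffle f u v) v := by
  cases u with
  | nil => simp [left_nil, signTwist_zero]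
  | cons x u =>
    cases v with
    | nil => simp [left_nil]
    | cons y v =>
      rw [shuffle_cons_cons]
      simp only [left_cons, signTwist_apply]
      rw [S.shuffle_map (l x) f, S.shuffle_map (l y) f, wordDeg_cons, mul_comm (S.deg y)]

lemma shuffle_right_cons (l : X → A →+ A) (f : List X → A) (z : X) (u v : List X) :
    S.shuffle (fun w => S.right l f (z :: w)) u v =
      S.shuffle (S.right (S.signTwist (S.deg z) l) fun w => f (z :: w)) u v -
        S.shuffle (atNil (l z (f []))) u v := by
  rw [← shuffle_sub]
  rfl

lemma right_shuffle_cons_left (l : X → A →+ A) (f : List X → A) (x y : X) (u v : List X) :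
    S.right l (fun u => S.shuffle f (x :: u) (y :: v)) u =
      S.right l (fun u => S.shuffle (fun w => f (x :: w)) u (y :: v)) u +
        sg (S.deg y * (S.deg x + S.wordDeg u)) • S.right (S.signTwist (S.deg y) l)
          (fun u => S.shuffle (fun w => f (y :: w)) (x :: u) v) u := by
  have hsg := S.right_sg_wordDeg (S.deg y) (S.deg y * S.deg x) l
    (fun u => S.shuffle (fun w => f (y :: w)) (x :: u) v) u
  simp only [shuffle_cons_cons, right_add, mul_add] at hsg ⊢
  rw [hsg]

lemma right_shuffle_cons_right (l : X → A →+ A) (f : List X → A) (x y : X) (u v : List X) :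
    S.right l (fun v => S.shuffle f (x :: u) (y :: v)) v =
      S.right l (fun v => S.shuffle (fun w => f (x :: w)) u (y :: v)) v +
        sg (S.deg y * (S.deg x + S.wordDeg u)) •
          S.right l (fun v => S.shuffle (fun w => f (y :: w)) (x :: u) v) v := by
  have hsg := S.right_sg_wordDeg 0 (S.deg y * (S.deg x + S.wordDeg u)) l
    (fun v => S.shuffle (fun w => f (y :: w)) (x :: u) v) v
  simp only [zero_mul, add_zero, signTwist_zero] at hsg
  simp only [shuffle_cons_cons, right_add, hsg]

lemma shuffle_right (l : X → A →+ A) (f : List X → A) (u v : List X) :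
    S.shuffle (S.right l f) u v = S.right l (fun u => S.shuffle f u v) u +
      S.right (S.signTwist (S.wordDeg u) l) (fun v => S.shuffle f u v) v := by
  induction u, v using words_induction generalizing l f with
  | nil_left v => simp [right_nil, signTwist_zero]
  | nil_right x u => simp [right_nil]
  | cons_cons x u y v ih_left ih_right =>
    have atNil_sign : sg (S.deg y * (S.deg x + S.wordDeg u)) • sg (S.deg y * S.deg x) •
        atNil (l x (f (y :: v))) u = atNil (l x (f (y :: v))) u := by
      cases u <;> simp [sg_smul_self]
    rw [shuffle_cons_cons, shuffle_right_cons, shuffle_right_cons, shuffle_atNil_cons_right,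
      shuffle_atNil_cons_left, ih_left, ih_right, right_cons, right_cons, right_cons, right_cons,
      right_shuffle_cons_left, right_shuffle_cons_right]
    simp only [signTwist_signTwist, wordDeg_cons, sub_zero, shuffle_nil_left, shuffle_nil_right,
      smul_add, smul_sub, signTwist_apply, atNil_zsmul]
    rw [atNil_sign, add_comm (S.deg x) (S.deg y), add_comm (S.wordDeg u) (S.deg x),
      add_comm (S.deg x + S.wordDeg u) (S.deg y), mul_comm (S.deg y)]
    abel

lemma cut_left (l : X → A →+ A) (G : List X → List X → A) (w : List X) :
    cut (fun u v => left l (fun u => G u v) u) w = left l (cut G) w := by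
  cases w with
  | nil => rfl
  | cons x w =>
    rw [cut_cons, left_nil, zero_add]
    exact cut_map (l x) G w

lemma right_cut (l : X → A →+ A) (G : List X → List X → A) (w : List X) :
    S.right l (cut G) w = cut (fun u v => S.right l (fun u => G u v) u +
      S.right (S.signTwist (S.wordDeg u) l) (G u) v +
        left (S.signTwist (S.wordDeg u) l) (G u) v) w := by
  induction w generalizing l G with
  | nil => simp [right_nil, left_nil, cut_nil]
  | cons x w ih =>
    rw [right_cons, cut_cons_eq, right_add, ih, cut_cons]
    simp only [right_nil, right_cons, left_cons, wordDeg_nil, wordDeg_cons, signTwist_zero,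
      signTwist_signTwist, cut_nil, cut_add, cut_sub]
    rw [cut_atNil (fun v => l x (G [] v)) w]
    simp only [add_comm (S.deg x)]
    abel

/-- The second Adams operation on functionals on words: deconcatenation followed by the shuffle
product. -/
def adamsTwo (f : List X → A) : List X → A := cut (S.shuffle f)

/-- The Hochschild differential, without the differential of the coefficients, on functionals on
words with values in a symmetric bimodule on which the letters act by `l`. -/
def hochschild (l : X → A →+ A) (f : List X → A) (w : List X) : A :=
  S.bar f w + left l f w + S.right l f w

lemma adamsTwo_map {B : Type*} [AddCommGroup B] (h : A →+ B) (f : List X → A) (w : List X) :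
    S.adamsTwo (fun w => h (f w)) w = h (S.adamsTwo f w) := by
  rw [adamsTwo, adamsTwo, ← cut_map]
  exact congrArg (fun G => cut G w) (funext₂ fun u v => S.shuffle_map h f u v)

lemma adamsTwo_add (f g : List X → A) (w : List X) :
    S.adamsTwo (fun w => f w + g w) w = S.adamsTwo f w + S.adamsTwo g w := by
  rw [adamsTwo, adamsTwo, adamsTwo, ← cut_add]
  exact congrArg (fun G => cut G w) (funext₂ fun u v => S.shuffle_add f g u v)

-- The bar differential is a derivation of the shuffle product and a coderivation of
-- deconcatenation; the two outer actions are not, but their defects cancel.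
theorem hochschild_adamsTwo (l : X → A →+ A) {f : List X → A} (hf : S.IsSymm f) (w : List X) :
    S.hochschild l (S.adamsTwo f) w = S.adamsTwo (S.hochschild l f) w := by
  have shuffle_hochschild : S.shuffle (S.hochschild l f) = fun u v =>
      S.bar (fun u => S.shuffle f u v) u + sg (S.wordDeg u) • S.bar (fun v => S.shuffle f u v) v +
      left l (fun u => S.shuffle f u v) u +
      (S.right l (fun u => S.shuffle f u v) u +
        S.right (S.signTwist (S.wordDeg u) l) (S.shuffle f u) v +
        left (S.signTwist (S.wordDeg u) l) (S.shuffle f u) v) := by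
    funext u v
    have hochschild_eq : S.hochschild l f = fun w => S.bar f w + left l f w + S.right l f w := rfl
    rw [hochschild_eq, shuffle_add, shuffle_add, S.shuffle_bar hf, shuffle_left, shuffle_right]
    abel
  rw [adamsTwo, adamsTwo, shuffle_hochschild, hochschild, bar_cut, right_cut, ← cut_left,
    ← cut_add, ← cut_add]

end GradedLetters

section ExtendPerm

/-- The extension of a permutation of `n` letters that moves the letter at the place `k` to the
first place. -/
def extendPerm {n : ℕ} (k : Fin (n + 1)) (σ : Equiv.Perm (Fin n)) : Equiv.Perm (Fin (n + 1)) :=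
  (finSuccEquiv' k).trans ((Equiv.optionCongr σ).trans (finSuccEquiv' 0).symm)

variable {n : ℕ} (k : Fin (n + 1)) (σ : Equiv.Perm (Fin n))

@[simp] lemma extendPerm_self : extendPerm k σ k = 0 := by simp [extendPerm]

@[simp] lemma extendPerm_succAbove (j : Fin n) :
    extendPerm k σ (k.succAbove j) = (σ j).succ := by simp [extendPerm]

@[simp] lemma extendPerm_symm_zero : (extendPerm k σ).symm 0 = k := by
  rw [Equiv.symm_apply_eq, extendPerm_self]

@[simp] lemma extendPerm_symm_succ (j : Fin n) :
    (extendPerm k σ).symm j.succ = k.succAbove (σ.symm j) := by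
  rw [Equiv.symm_apply_eq, extendPerm_succAbove, Equiv.apply_symm_apply]

lemma lt_card_lt_iff_apply_sort_lt {α : Type*} [LinearOrder α] (g : Fin n → α) (l : α)
    (j : Fin n) :
    (j : ℕ) < (Finset.univ.filter fun i => g i < l).card ↔ g (Tuple.sort g j) < l := by
  have card_eq : (Finset.univ.filter fun i => (g ∘ Tuple.sort g) i < l).card =
      (Finset.univ.filter fun i => g i < l).card :=
    Finset.card_bij (fun i _ => Tuple.sort g i) (by simp) (by simp)
      (fun i hi => ⟨(Tuple.sort g).symm i, by simpa using hi, by simp⟩)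
  rw [← card_eq]
  exact Tuple.lt_card_lt_iff_apply_lt_of_monotone (Tuple.monotone_sort g)

lemma sort_cons {α : Type*} [LinearOrder α] (g : Fin n → α) (l : α)
    (hk : (k : ℕ) = (Finset.univ.filter fun j => g j < l).card) :
    Tuple.sort (Fin.cons l g : Fin (n + 1) → α) = extendPerm k (Tuple.sort g) := by
  have lt_iff (j : Fin n) : (j : ℕ) < k ↔ g (Tuple.sort g j) < l :=
    hk ▸ lt_card_lt_iff_apply_sort_lt g l j
  rw [eq_comm, Tuple.eq_sort_iff']
  intro i j hij
  refine Prod.Lex.toLex_lt_toLex.2 ?_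
  induction i using Fin.succAboveCases k with
  | x =>
    induction j using Fin.succAboveCases k with
    | x => exact absurd hij (lt_irrefl _)
    | p j =>
      rw [Fin.lt_succAbove_iff_le_castSucc] at hij
      have hle := not_lt.1 ((lt_iff j).not.1 (not_lt.2 hij))
      simp only [extendPerm_self, extendPerm_succAbove, Fin.cons_zero, Fin.cons_succ]
      exact hle.lt_or_eq.imp_right fun h => ⟨h, Fin.succ_pos _⟩
  | p i =>
    induction j using Fin.succAboveCases k with
    | x =>
      rw [Fin.succAbove_lt_iff_castSucc_lt] at hij
      simp only [extendPerm_self, extendPerm_succAbove, Fin.cons_zero, Fin.cons_succ]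
      exact Or.inl ((lt_iff i).1 hij)
    | p j =>
      have hlt := Prod.Lex.toLex_lt_toLex.1
        (Tuple.eq_sort_iff'.1 (rfl : Tuple.sort g = Tuple.sort g)
          (Fin.succAbove_lt_succAbove_iff.1 hij))
      simpa using hlt

lemma koszulSign_extendPerm (p : Fin (n + 1) → ℤ) :
    koszulSign (extendPerm k σ) p =
      (∏ i : Fin n, if (i : ℕ) < k then sg ((p (k.succAbove i) - 1) * (p k - 1)) else 1) *
        koszulSign σ fun i => p (k.succAbove i) := by
  have koszulSign_eq : ∀ (m : ℕ) (τ : Equiv.Perm (Fin m)) (q : Fin m → ℤ), koszulSign τ q =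
      ∏ i, ∏ j, if i < j ∧ τ j < τ i then sg ((q i - 1) * (q j - 1)) else 1 := by
    intro m τ q
    rw [koszulSign, Finset.prod_filter, ← Finset.univ_product_univ, Finset.prod_product]
  rw [koszulSign_eq, koszulSign_eq, Fin.prod_univ_succAbove _ k, Finset.prod_eq_one (by simp),
    one_mul, ← Finset.prod_mul_distrib]
  refine Finset.prod_congr rfl fun i _ => ?_
  rw [Fin.prod_univ_succAbove _ k]
  simp only [extendPerm_self, extendPerm_succAbove, Fin.succ_pos, and_true,
    Fin.succAbove_lt_succAbove_iff, Fin.succ_lt_succ_iff, Fin.succAbove_lt_iff_castSucc_lt]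
  rfl

lemma ofFn_succAbove {X : Type*} {a : Fin (n + 1) → X} {k : Fin (n + 1)} {u v : List X} {y : X}
    (h : List.ofFn a = u ++ y :: v) (hk : (k : ℕ) = u.length) :
    a k = y ∧ List.ofFn (fun i => a (k.succAbove i)) = u ++ v := by
  induction u generalizing n with
  | nil =>
    obtain rfl : k = 0 := Fin.ext hk
    rwa [List.ofFn_succ, List.nil_append, List.cons.injEq] at h
  | cons x u ih =>
    rw [List.ofFn_succ, List.cons_append, List.cons.injEq] at h
    obtain ⟨n, rfl⟩ := Nat.exists_eq_succ_of_ne_zero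
      (show n ≠ 0 by rintro rfl; simpa using congrArg List.length h.2)
    obtain ⟨k, rfl⟩ := Fin.exists_succ_eq.2 (show k ≠ 0 by rintro rfl; simp at hk)
    obtain ⟨letter_eq, rest_eq⟩ := ih (k := k) h.2 (by simpa using hk)
    refine ⟨letter_eq, ?_⟩
    rw [List.ofFn_succ, List.cons_append]
    simp only [Fin.succ_succAbove_zero, Fin.succ_succAbove_succ]
    rw [h.1, rest_eq]

end ExtendPerm

section Labellings

variable {n : ℕ}

/-- The number of letters with the label `0`. -/
def zeroCount (g : Fin n → Fin 2) : ℕ := (Finset.univ.filter fun j => g j < 1).card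

lemma zeroCount_cons_zero (g : Fin n → Fin 2) :
    zeroCount (Fin.cons 0 g : Fin (n + 1) → Fin 2) = zeroCount g + 1 := by
  rw [zeroCount, zeroCount, Finset.card_filter, Finset.card_filter, Fin.sum_univ_succ]
  simp [add_comm]

lemma zeroCount_cons_one (g : Fin n → Fin 2) :
    zeroCount (Fin.cons 1 g : Fin (n + 1) → Fin 2) = zeroCount g := by
  rw [zeroCount, zeroCount, Finset.card_filter, Finset.card_filter, Fin.sum_univ_succ]
  simp

lemma zeroCount_le (g : Fin n → Fin 2) : zeroCount g ≤ n :=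
  (Finset.card_filter_le _ _).trans (by simp)

lemma sum_zeroCount_eq {A : Type*} [AddCommMonoid A] (t : (Fin (n + 1) → Fin 2) → A) (r : ℕ) :
    ∑ g with zeroCount g = r, t g =
      ∑ g : Fin n → Fin 2 with zeroCount g + 1 = r, t (Fin.cons 0 g) +
        ∑ g : Fin n → Fin 2 with zeroCount g = r, t (Fin.cons 1 g) := by
  simp only [Finset.sum_filter]
  rw [← Equiv.sum_comp (Fin.consEquiv fun _ => Fin 2), Fintype.sum_prod_type, Fin.sum_univ_two]
  simp only [Fin.consEquiv, Equiv.coe_fn_mk, zeroCount_cons_zero, zeroCount_cons_one]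

end Labellings

namespace GradedLetters

variable {X : Type*} (S : GradedLetters X) {A : Type*} [AddCommGroup A]

lemma prod_sg_deg_mul {n : ℕ} {a : Fin n → X} {u v : List X} (h : List.ofFn a = u ++ v) (r : ℤ) :
    (∏ i : Fin n, if (i : ℕ) < u.length then sg (S.deg (a i) * r) else 1) =
      sg (r * S.wordDeg u) := by
  induction u generalizing n with
  | nil => simp
  | cons x u ih =>
    obtain ⟨n, rfl⟩ := Nat.exists_eq_succ_of_ne_zero
      (show n ≠ 0 by rintro rfl; simpa using congrArg List.length h)
    rw [List.ofFn_succ, List.cons_append, List.cons.injEq] at h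
    rw [Fin.prod_univ_succ]
    simp only [Fin.val_zero, Fin.val_succ, List.length_cons, Nat.add_lt_add_iff_right, ih h.2,
      Nat.zero_lt_succ, if_true, h.1, wordDeg_cons, mul_add, sg_add, mul_comm (S.deg x)]

/-- The summand of the second Adams operation that is given by the labelling `g`: the value of `f`
on the word whose letters are sorted by their labels, with the Koszul sign. -/
def sortedTerm (f : List X → A) {n : ℕ} (a : Fin n → X) (g : Fin n → Fin 2) : A :=
  koszulSign (Tuple.sort g) (fun i => S.deg (a i) + 1) •
    f (List.ofFn fun j => a ((Tuple.sort g).symm j))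

section SortedTerm

variable (f : List X → A) {n : ℕ}

lemma sortedTerm_cons (a : Fin (n + 1) → X) (g : Fin n → Fin 2) (l : Fin 2)
    (k : Fin (n + 1)) (hk : (k : ℕ) = (Finset.univ.filter fun j => g j < l).card) :
    S.sortedTerm f a (Fin.cons l g : Fin (n + 1) → Fin 2) =
      (∏ i : Fin n, if (i : ℕ) < k then sg (S.deg (a (k.succAbove i)) * S.deg (a k)) else 1) •
        S.sortedTerm (fun w => f (a k :: w)) (fun i => a (k.succAbove i)) g := by
  rw [sortedTerm, sortedTerm, sort_cons k g l hk, koszulSign_extendPerm, mul_smul,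
    List.ofFn_succ]
  simp

lemma sortedTerm_cons_zero (a : Fin (n + 1) → X) (g : Fin n → Fin 2) :
    S.sortedTerm f a (Fin.cons 0 g : Fin (n + 1) → Fin 2) =
      S.sortedTerm (fun w => f (a 0 :: w)) (fun i => a i.succ) g := by
  simp [S.sortedTerm_cons f a g 0 0 (by simp)]

lemma sortedTerm_cons_one {a : Fin (n + 1) → X} {g : Fin n → Fin 2} {u v : List X} {y : X}
    {k : Fin (n + 1)} (h : List.ofFn a = u ++ y :: v) (hk : (k : ℕ) = u.length)
    (hg : zeroCount g = u.length) :
    S.sortedTerm f a (Fin.cons 1 g : Fin (n + 1) → Fin 2) = sg (S.deg y * S.wordDeg u) •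
      S.sortedTerm (fun w => f (y :: w)) (fun i => a (k.succAbove i)) g := by
  obtain ⟨letter_eq, rest_eq⟩ := ofFn_succAbove h hk
  rw [S.sortedTerm_cons f a g 1 k (hk.trans hg.symm), letter_eq, hk, S.prod_sg_deg_mul rest_eq]

lemma sum_sortedTerm_eq_shuffle (a : Fin n → X) (u v : List X) (h : List.ofFn a = u ++ v) :
    ∑ g : Fin n → Fin 2 with zeroCount g = u.length, S.sortedTerm f a g = S.shuffle f u v := by
  induction n generalizing f u v with
  | zero =>
    rw [List.ofFn_zero, eq_comm, List.append_eq_nil_iff] at h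
    obtain ⟨rfl, rfl⟩ := h
    rw [Finset.filter_true_of_mem (by simp [zeroCount]), Fintype.sum_unique]
    simp [sortedTerm, koszulSign]
  | succ n ih =>
    have length_eq : n + 1 = u.length + v.length := by simpa using congrArg List.length h
    have sum_cons_zero (x : X) (u' : List X) (hu : u = x :: u') :
        ∑ g : Fin n → Fin 2 with zeroCount g + 1 = u.length, S.sortedTerm f a (Fin.cons 0 g) =
          S.shuffle (fun w => f (x :: w)) u' v := by
      subst hu
      rw [List.ofFn_succ, List.cons_append, List.cons.injEq] at h
      simp only [sortedTerm_cons_zero, h.1, List.length_cons, Nat.add_right_cancel_iff]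
      exact ih _ _ u' v h.2
    have sum_cons_one (y : X) (v' : List X) (hv : v = y :: v') :
        ∑ g : Fin n → Fin 2 with zeroCount g = u.length, S.sortedTerm f a (Fin.cons 1 g) =
          sg (S.deg y * S.wordDeg u) • S.shuffle (fun w => f (y :: w)) u v' := by
      subst hv
      rw [List.length_cons] at length_eq
      have hk : ((⟨u.length, by omega⟩ : Fin (n + 1)) : ℕ) = u.length := rfl
      rw [← ih _ _ u v' (ofFn_succAbove h hk).2, Finset.smul_sum]
      exact Finset.sum_congr rfl fun g hg =>
        S.sortedTerm_cons_one f h hk (Finset.mem_filter.1 hg).2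
    rw [sum_zeroCount_eq]
    cases u with
    | nil =>
      cases v with
      | nil => simp at length_eq
      | cons y v =>
        rw [sum_cons_one y v rfl, Finset.sum_eq_zero (by simp)]
        simp
    | cons x u =>
      rw [sum_cons_zero x u rfl]
      cases v with
      | nil =>
        have no_labelling (g : Fin n → Fin 2) : zeroCount g ≠ (x :: u).length :=
          ((zeroCount_le g).trans_lt (by simpa using length_eq.le)).ne
        rw [Finset.filter_false_of_mem fun g _ => no_labelling g, Finset.sum_empty]
        simp
      | cons y v => rw [sum_cons_one y v rfl, shuffle_cons_cons, wordDeg_cons]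

lemma sum_sortedTerm_eq_adamsTwo (a : Fin n → X) :
    ∑ g : Fin n → Fin 2, S.sortedTerm f a g = S.adamsTwo f (List.ofFn a) := by
  rw [adamsTwo, cut_eq_sum, List.length_ofFn, ← Finset.sum_fiberwise_of_maps_to (g := zeroCount)
    (t := Finset.range (n + 1)) fun g _ => Finset.mem_range_succ_iff.2 (zeroCount_le g)]
  refine Finset.sum_congr rfl fun k hk => ?_
  rw [← S.sum_sortedTerm_eq_shuffle f a _ _ (List.take_append_drop k _).symm, List.length_take,
    List.length_ofFn, min_eq_left (Finset.mem_range_succ_iff.1 hk)]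

end SortedTerm

end GradedLetters

section Words

variable {F : DGAlgebra.{u, v} K}

variable (F) in
/-- The homogeneous elements of a differential graded algebra `F`, with the degrees of `F[1]`, as
the letters of the bar construction. -/
def letters : GradedLetters (Σ i, F.gr i) where
  deg x := x.1 - 1
  mul x y := ⟨x.1 + y.1, x.2.1 * y.2.1, SetLike.mul_mem_graded x.2.2 y.2.2⟩
  d x := ⟨x.1 + 1, F.d x.2.1, F.d_mem x.2.2⟩
  deg_mul _ _ := by ring
  deg_d _ := by ring

lemma letters_deg (x : Σ i, F.gr i) : (letters F).deg x = x.1 - 1 := rfl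

lemma eps_letter (x : Σ i, F.gr i) : F.eps x.2.1 = (-sg ((letters F).deg x)) • x.2.1 := by
  rw [F.eps_apply x.2.2, letters_deg, sg_sub, sg_one, mul_neg_one, neg_neg]

variable (M : DGBimodule F)

lemma lc_zsmul (r : ℤ) (x : F) (c : Fam M) : lc M (r • x) c = r • lc M x c :=
  map_zsmul (AddMonoidHom.mk' (fun x => lc M x c) fun x y => lc_add M x y c) r x

lemma mm_zsmul (r : ℤ) (x : F) (c : Fam M) : mm M (r • x) c = r • mm M x c :=
  fam_ext M (smul_zero r).symm fun y => by rw [lc_mm, smul_mul_assoc, lc_zsmul, map_zsmul, lc_mm]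

/-- The functional on words of homogeneous elements that is given by a family of multilinear
maps. -/
def evalWord : Fam M → List (Σ i, F.gr i) → M
  | c, [] => c 0 Fin.elim0
  | c, x :: w => evalWord (lc M x.2.1 c) w

lemma evalWord_cons (c : Fam M) (x : Σ i, F.gr i) (w : List (Σ i, F.gr i)) :
    evalWord M c (x :: w) = evalWord M (lc M x.2.1 c) w := rfl

lemma evalWord_ofFn (c : Fam M) {n : ℕ} (a : Fin n → Σ i, F.gr i) :
    evalWord M c (List.ofFn a) = c n fun i => (a i).2.1 := by
  induction n generalizing c with
  | zero => exact congrArg (c 0) (Subsingleton.elim _ _)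
  | succ n ih =>
    rw [List.ofFn_succ, evalWord_cons, ih, lc_apply]
    congr 1
    funext i
    cases i using Fin.cases <;> rfl

lemma evalWord_eq (c : Fam M) (w : List (Σ i, F.gr i)) :
    evalWord M c w = c w.length fun i => (w.get i).2.1 := by
  conv_lhs => rw [← List.ofFn_get w]
  exact evalWord_ofFn M c _

lemma ext_of_evalWord {c c' : Fam M} (h : ∀ w, evalWord M c w = evalWord M c' w) : c = c' := by
  funext n
  refine multilinear_ext fun p a ha => ?_
  have eq_ofFn := h (List.ofFn fun i => ⟨p i, a i, ha i⟩)
  rwa [evalWord_ofFn, evalWord_ofFn] at eq_ofFn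

lemma evalWord_add (c c' : Fam M) (w : List (Σ i, F.gr i)) :
    evalWord M (c + c') w = evalWord M c w + evalWord M c' w := by simp only [evalWord_eq]; rfl

lemma evalWord_sub (c c' : Fam M) (w : List (Σ i, F.gr i)) :
    evalWord M (c - c') w = evalWord M c w - evalWord M c' w := by simp only [evalWord_eq]; rfl

lemma evalWord_zsmul (r : ℤ) (c : Fam M) (w : List (Σ i, F.gr i)) :
    evalWord M (r • c) w = r • evalWord M c w := by simp only [evalWord_eq]; rfl

lemma evalWord_mm_nil (x : F) (c : Fam M) : evalWord M (mm M x c) [] = 0 := rfl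

lemma evalWord_mm_cons (x z : Σ i, F.gr i) (c : Fam M) (w : List (Σ i, F.gr i)) :
    evalWord M (mm M x.2.1 c) (z :: w) = evalWord M c ((letters F).mul x z :: w) := by
  rw [evalWord_cons, lc_mm]
  rfl

lemma evalWord_lc_d_sub_mm_eps (x : Σ i, F.gr i) (c : Fam M) (w : List (Σ i, F.gr i)) :
    evalWord M (lc M (F.d x.2.1) c) w - evalWord M (mm M (F.eps x.2.1) c) w =
      sg ((letters F).deg x) • (letters F).barHead x (evalWord M c) w := by
  have evalWord_d : evalWord M (lc M (F.d x.2.1) c) w = evalWord M c ((letters F).d x :: w) := rfl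
  rw [eps_letter, mm_zsmul, evalWord_zsmul, evalWord_d]
  cases w with
  | nil => rw [evalWord_mm_nil, GradedLetters.barHead_nil, sg_smul_self, smul_zero, sub_zero]
  | cons z w =>
    rw [evalWord_mm_cons, GradedLetters.barHead_cons, smul_add, sg_smul_self, neg_smul,
      sub_neg_eq_add]

lemma evalWord_opP (c : Fam M) (w : List (Σ i, F.gr i)) :
    evalWord M (opP M c) w = (letters F).bar (evalWord M c) w := by
  induction w generalizing c with
  | nil => exact congrArg (· Fin.elim0) (opP_zero M c)
  | cons x w ih =>
    rw [evalWord_cons, lc_opP, evalWord_sub, evalWord_sub, sub_right_comm,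
      evalWord_lc_d_sub_mm_eps, eps_letter, lc_zsmul, map_zsmul, evalWord_zsmul, ih, neg_smul,
      sub_neg_eq_add, GradedLetters.bar_cons, smul_add]
    rfl

/-- The left action of the homogeneous elements, with its sign in the Hochschild differential of
cochains of degree `m`. -/
def letterAction (m : ℤ) (x : Σ i, F.gr i) : M →+ M :=
  sg (m * x.1) • (M.lact x.2.1).toAddMonoidHom

lemma letterAction_apply (m : ℤ) (x : Σ i, F.gr i) (a : M) :
    letterAction M m x a = sg (m * x.1) • M.lact x.2.1 a := rfl

lemma signTwist_letterAction (m : ℤ) (x : Σ i, F.gr i) :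
    (letters F).signTwist ((letters F).deg x) (letterAction M m) =
      fun y => sg (x.1 - 1) • letterAction M (m + x.1 - 1) y := by
  funext y
  have exponents : (x.1 - 1) * (y.1 - 1) + m * y.1 = (m + x.1 - 1) * y.1 - (x.1 - 1) := by ring
  rw [GradedLetters.signTwist, letterAction, letterAction, letters_deg, letters_deg,
    sg_smul_sg_smul, exponents, sg_sub, mul_comm, mul_smul]

lemma evalWord_opL (m : ℤ) (c : Fam M) (w : List (Σ i, F.gr i)) :
    evalWord M (opL M m c) w = GradedLetters.left (letterAction M m) (evalWord M c) w := by
  cases w with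
  | nil => rfl
  | cons x w =>
    have sgn_letter : F.sgn m x.2.1 = sg (m * x.1) • x.2.1 := signMap_apply F.gr m x.2.2
    rw [evalWord_cons, lc_opL, sgn_letter, GradedLetters.left_cons, evalWord_eq, evalWord_eq,
      letterAction_apply, ← LinearMap.smul_apply, ← map_zsmul]
    rfl

lemma opR_apply_cons (c : Fam M) (n : ℕ) (x : F) (a : Fin (n + 1) → F) :
    opR M c (n + 2) (Fin.cons x a) = -opR M (lc M (F.eps x) c) (n + 1) a := by
  have eps_cons : (fun j : Fin (n + 1) =>
      F.eps ((Fin.cons x a : Fin (n + 2) → F) j.castSucc)) =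
        Fin.cons (F.eps x) fun j => F.eps (a j.castSucc) := by
    funext j
    cases j using Fin.cases <;> rfl
  rw [opR_apply, opR_apply, lc_apply, eps_cons, Nat.cast_succ, sg_succ _, neg_smul]
  rfl

/-- The bimodules in which the right action is determined by the left action, with the Koszul
sign. -/
def DGBimodule.IsSymmetric (M : DGBimodule F) : Prop :=
  ∀ ⦃i j : ℤ⦄ ⦃a : F⦄ ⦃x : M⦄, a ∈ F.gr i → x ∈ M.gr j →
    M.ract x a = sg (i * j) • M.lact a x

lemma DGBimodule.isSymmetric_regular (hF : F.IsSupercommutative) : (regular F).IsSymmetric :=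
  fun i j _ _ ha hx => mul_comm i j ▸ hF hx ha

lemma DGBimodule.IsSymmetric.restrict {G : DGAlgebra.{u, v} K} {N : DGBimodule G}
    (hN : N.IsSymmetric) (φ : F.Hom G) : (DGBimodule.restrict φ N).IsSymmetric :=
  fun _ _ _ _ ha hx => hN (φ.map_mem ha) hx

variable {M}

lemma evalWord_opR_singleton (hM : M.IsSymmetric) {m : ℤ} {c : Fam M} (hc : c ∈ cochains M m)
    (x : Σ i, F.gr i) : evalWord M (opR M c) [x] = -letterAction M m x (evalWord M c []) := by
  have value_mem : evalWord M c [] ∈ M.gr m := by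
    simpa [evalWord] using hc 0 Fin.elim0 Fin.elim0 fun i => i.elim0
  have opR_eq : evalWord M (opR M c) [x] = sg 1 • M.ract (evalWord M c []) x.2.1 := by
    rw [evalWord_eq, evalWord_eq]
    change sg ((0 : ℕ) + 1) • M.ract (c 0 _) x.2.1 = _
    rw [Nat.cast_zero, zero_add]
    congr 4
    exact Subsingleton.elim _ _
  rw [opR_eq, hM x.2.2 value_mem, letterAction_apply, sg_one, neg_smul, one_smul, mul_comm]

lemma evalWord_opR_cons_cons (c : Fam M) (x z : Σ i, F.gr i) (w : List (Σ i, F.gr i)) :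
    evalWord M (opR M c) (x :: z :: w) =
      sg (x.1 - 1) • evalWord M (opR M (lc M x.2.1 c)) (z :: w) := by
  rw [evalWord_cons, evalWord_eq, lc_apply]
  refine (opR_apply_cons M c w.length _ _).trans ?_
  rw [eps_letter, lc_zsmul, map_zsmul, neg_smul, evalWord_eq]
  exact neg_neg _

lemma evalWord_opR (hM : M.IsSymmetric) {m : ℤ} {c : Fam M} (hc : c ∈ cochains M m)
    (w : List (Σ i, F.gr i)) :
    evalWord M (opR M c) w = (letters F).right (letterAction M m) (evalWord M c) w := by
  induction w generalizing m c with
  | nil => rfl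
  | cons x w ih =>
    rw [GradedLetters.right_cons]
    cases w with
    | nil =>
      rw [evalWord_opR_singleton hM hc, GradedLetters.right_nil, zero_sub, GradedLetters.atNil_nil]
    | cons z w =>
      rw [evalWord_opR_cons_cons, ih (lc_mem x.2.2 hc), signTwist_letterAction,
        GradedLetters.right_zsmul, GradedLetters.atNil_cons, sub_zero]
      rfl

lemma isSymm_evalWord (hF : F.IsSupercommutative) (c : Fam M) :
    (letters F).IsSymm (evalWord M c) := by
  intro u
  induction u generalizing c with
  | nil =>
    intro x y v
    have mul_swap : ((letters F).mul y x).2.1 =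
        sg (x.1 * y.1) • ((letters F).mul x y).2.1 := by
      rw [mul_comm x.1]
      exact hF y.2.2 x.2.2
    rw [List.nil_append, evalWord_cons, mul_swap, lc_zsmul, evalWord_zsmul, letters_deg,
      letters_deg, sub_add_cancel, sub_add_cancel]
    rfl
  | cons z _ ih => exact ih _

lemma evalWord_delta (hM : M.IsSymmetric) {m : ℤ} {c : Fam M} (hc : c ∈ cochains M m)
    (w : List (Σ i, F.gr i)) :
    evalWord M (delta M m c) w =
      sg m • M.d (evalWord M c w) + (letters F).hochschild (letterAction M m) (evalWord M c) w := by
  have evalWord_opI : evalWord M (opI M m c) w = sg m • M.d (evalWord M c w) := by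
    rw [evalWord_eq, evalWord_eq]
    rfl
  rw [delta_eq', evalWord_add, evalWord_add, evalWord_add, evalWord_opI, evalWord_opP,
    evalWord_opL, evalWord_opR hM hc, GradedLetters.hochschild, add_assoc, add_assoc, add_assoc]

end Words

section AdamsOperation

variable {F : DGAlgebra.{u, v} K} {M : DGBimodule F}

variable (M) in
/-- The second Adams operation on families of multilinear maps. -/
def adamsFam : Fam M →ₗ[K] Fam M where
  toFun c n := adams M n (Fin 2) (c n)
  map_add' _ _ := funext fun _ => map_add _ _ _
  map_smul' r c := funext fun n => (adams M n (Fin 2)).map_smul r (c n)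

lemma adamsFam_apply (c : Fam M) (n : ℕ) (a : Fin n → F) :
    adamsFam M c n a = ∑ g : Fin n → Fin 2, permAct M (Tuple.sort g) (c n) a := by
  change adams M n (Fin 2) (c n) a = _
  rw [adams, LinearMap.sum_apply, sum_apply]

lemma evalWord_adamsFam (c : Fam M) (w : List (Σ i, F.gr i)) :
    evalWord M (adamsFam M c) w = (letters F).adamsTwo (evalWord M c) w := by
  obtain ⟨n, a, rfl⟩ : ∃ n, ∃ a : Fin n → _, w = List.ofFn a := ⟨_, _, (List.ofFn_get w).symm⟩
  rw [evalWord_ofFn, ← GradedLetters.sum_sortedTerm_eq_adamsTwo, adamsFam_apply]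
  refine Finset.sum_congr rfl fun g _ => ?_
  rw [permAct_apply M _ _ (p := fun i => (a i).1) fun i => (a i).2.2, GradedLetters.sortedTerm,
    evalWord_ofFn]
  simp only [letters_deg, sub_add_cancel]

lemma permAct_mem {m : ℤ} {c : Fam M} (hc : c ∈ cochains M m) {n : ℕ} (σ : Equiv.Perm (Fin n))
    {p : Fin n → ℤ} {a : Fin n → F} (ha : ∀ i, a i ∈ F.gr (p i)) :
    permAct M σ (c n) a ∈ M.gr (∑ i, (p i - 1) + m) := by
  rw [permAct_apply M _ _ ha, ← Equiv.sum_comp σ.symm]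
  exact zsmul_mem (hc n (fun j => p (σ.symm j)) _ fun j => ha _) _

lemma adamsFam_mem {m : ℤ} {c : Fam M} (hc : c ∈ cochains M m) :
    adamsFam M c ∈ cochains M m := by
  intro n _ a ha
  rw [adamsFam_apply]
  exact sum_mem fun _ _ => permAct_mem hc _ ha

theorem delta_adamsFam (hF : F.IsSupercommutative) (hM : M.IsSymmetric) {m : ℤ} {c : Fam M}
    (hc : c ∈ cochains M m) : delta M m (adamsFam M c) = adamsFam M (delta M m c) := by
  refine ext_of_evalWord M fun w => ?_
  have evalWord_delta_eq : evalWord M (delta M m c) = fun w =>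
      (sg m • M.d.toAddMonoidHom) (evalWord M c w) +
        (letters F).hochschild (letterAction M m) (evalWord M c) w :=
    funext (evalWord_delta hM hc)
  rw [evalWord_delta hM (adamsFam_mem hc), evalWord_adamsFam, evalWord_adamsFam,
    funext (evalWord_adamsFam c), evalWord_delta_eq, GradedLetters.adamsTwo_add,
    GradedLetters.adamsTwo_map, GradedLetters.hochschild_adamsTwo _ _ (isSymm_evalWord hF c)]
  rfl

end AdamsOperation

section HodgeDecomposition

variable {F : DGAlgebra.{u, v} K} (M : DGBimodule F)

lemma eulerian_apply {n : ℕ} (k : ℕ) (c : Multi M n) {p : Fin n → ℤ} {a : Fin n → F}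
    (ha : ∀ i, a i ∈ F.gr (p i)) :
    eulerian M n k c a = ∑ σ : Equiv.Perm (Fin n), eulerianCoeff K n k (descents σ) •
      koszulSign σ p • c fun j => a (σ.symm j) := by
  rw [eulerian, LinearMap.sum_apply, sum_apply]
  refine Finset.sum_congr rfl fun σ _ => ?_
  rw [← permAct_apply M σ c ha]
  rfl

lemma mem_hodge_iff {k : ℕ} {m : ℤ} {c : Fam M} :
    c ∈ hodge M k m ↔ c ∈ cochains M m ∧ ∀ n, eulerian M n k (c n) = c n := by
  refine and_congr Iff.rfl (forall_congr' fun n => ⟨fun h => multilinear_ext fun p a ha => ?_,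
    fun h p a ha => ?_⟩)
  · rw [eulerian_apply M k _ ha, h p a ha]
  · rw [← eulerian_apply M k _ ha, h]

/-- The projection to the `k`-th Hodge component: the Eulerian idempotent `e_n(k)` acting on the
multilinear maps of `n` arguments. -/
def hodgeProj (k : ℕ) : Fam M →ₗ[K] Fam M where
  toFun c n := eulerian M n k (c n)
  map_add' _ _ := funext fun _ => map_add _ _ _
  map_smul' r c := funext fun n => (eulerian M n k).map_smul r (c n)

lemma hodgeProj_apply (k : ℕ) (c : Fam M) (n : ℕ) :
    hodgeProj M k c n = eulerian M n k (c n) := rfl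

variable {M}

lemma hodgeProj_eq_self {k : ℕ} {m : ℤ} {c : Fam M} (hc : c ∈ hodge M k m) :
    hodgeProj M k c = c :=
  funext ((mem_hodge_iff M).1 hc).2

lemma apply_eq_zero_of_mem_hodge {k n : ℕ} {m : ℤ} {c : Fam M} (hc : c ∈ hodge M k m)
    (h : n < k) : c n = 0 := by
  rw [← ((mem_hodge_iff M).1 hc).2 n, eulerian_eq_zero M h, LinearMap.zero_apply]

lemma hodgeProj_mem_cochains {m : ℤ} {c : Fam M} (hc : c ∈ cochains M m) (k : ℕ) :
    hodgeProj M k c ∈ cochains M m := by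
  intro n p a ha
  rw [hodgeProj_apply, eulerian, LinearMap.sum_apply, sum_apply]
  exact sum_mem fun σ _ => Submodule.smul_mem _ _ (permAct_mem hc σ ha)

variable [CharZero K]

lemma hodgeProj_mem {m : ℤ} {c : Fam M} (hc : c ∈ cochains M m) (k : ℕ) :
    hodgeProj M k c ∈ hodge M k m :=
  (mem_hodge_iff M).2 ⟨hodgeProj_mem_cochains hc k, fun n => by
    rw [hodgeProj_apply, ← Module.End.mul_apply, eulerian_mul, if_pos rfl]⟩

lemma sum_hodgeProj (c : Fam M) (n : ℕ) :
    ∑ k ∈ Finset.range (n + 1), hodgeProj M k c n = c n := by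
  simp only [hodgeProj_apply, ← LinearMap.sum_apply]
  rw [sum_eulerian, Module.End.one_apply]

lemma eq_hodgeProj {m : ℤ} {c : Fam M} {f : ℕ → Fam M} (hf : ∀ k, f k ∈ hodge M k m)
    (h : ∀ n, ∑ k ∈ Finset.range (n + 1), f k n = c n) (k : ℕ) : f k = hodgeProj M k c := by
  funext n
  rcases lt_or_ge n k with hk | hk
  · rw [apply_eq_zero_of_mem_hodge (hf k) hk, hodgeProj_apply, eulerian_eq_zero M hk,
      LinearMap.zero_apply]
  · rw [hodgeProj_apply, ← h n, map_sum, Finset.sum_eq_single k]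
    · exact (((mem_hodge_iff M).1 (hf k)).2 n).symm
    · intro j _ hj
      rw [← ((mem_hodge_iff M).1 (hf j)).2 n, ← Module.End.mul_apply, eulerian_mul,
        if_neg hj.symm, LinearMap.zero_apply]
    · intro hk'
      exact absurd (Finset.mem_range_succ_iff.2 hk) hk'

lemma adamsFam_of_mem_hodge {k : ℕ} {m : ℤ} {c : Fam M} (hc : c ∈ hodge M k m) :
    adamsFam M c = (2 : K) ^ k • c := by
  funext n
  rcases lt_or_ge n k with hk | hk
  · change adams M n (Fin 2) (c n) = (2 : K) ^ k • c n
    rw [apply_eq_zero_of_mem_hodge hc hk, map_zero, smul_zero]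
  · exact (eulerian_apply_eq_self_iff M hk (c n)).1 (((mem_hodge_iff M).1 hc).2 n)

lemma delta_mem_hodge (hF : F.IsSupercommutative) (hM : M.IsSymmetric) {k : ℕ} {m : ℤ}
    {c : Fam M} (hc : c ∈ hodge M k m) : delta M m c ∈ hodge M k (m + 1) := by
  refine (mem_hodge_iff M).2 ⟨delta_mem hc.1, fun n => ?_⟩
  rcases lt_or_ge n k with hk | hk
  · rw [delta_apply_eq_zero M m fun i hi => apply_eq_zero_of_mem_hodge hc (hi.trans_lt hk),
      map_zero]
  · rw [eulerian_apply_eq_self_iff M hk]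
    have commute := delta_adamsFam hF hM hc.1
    rw [adamsFam_of_mem_hodge hc, map_smul] at commute
    exact (congrFun commute n).symm

theorem hasHodgeDecomposition (hF : F.IsSupercommutative) (hM : M.IsSymmetric) :
    HasHodgeDecomposition M :=
  ⟨fun _ _ _ hc => delta_mem_hodge hF hM hc, fun _ c hc =>
    ⟨fun k => hodgeProj M k c, ⟨hodgeProj_mem hc, sum_hodgeProj c⟩,
      fun _ hf => funext (eq_hodgeProj hf.1 hf.2)⟩⟩

lemma delta_hodgeProj (h : HasHodgeDecomposition M) {m : ℤ} {c : Fam M} (hc : c ∈ cochains M m)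
    (k : ℕ) : delta M m (hodgeProj M k c) = hodgeProj M k (delta M m c) := by
  refine eq_hodgeProj (f := fun k => delta M m (hodgeProj M k c))
    (fun k => h.1 k m _ (hodgeProj_mem hc k)) (fun n => ?_) k
  rw [← sub_eq_zero, ← Finset.sum_apply, ← Pi.sub_apply, ← map_sum, ← map_sub]
  refine delta_apply_eq_zero M m fun i hi => ?_
  rw [Pi.sub_apply, Finset.sum_apply, sub_eq_zero, ← sum_hodgeProj c i]
  refine (Finset.sum_subset (Finset.range_subset_range.2 (by omega)) fun j _ hj => ?_).symm
  rw [hodgeProj_apply, eulerian_eq_zero M (by simpa using hj), LinearMap.zero_apply]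

lemma IsExactSeq.cone_hodge {G : DGAlgebra.{u, v} K} {N : DGBimodule G} {g : Fam M →ₗ[K] Fam N}
    (hex : IsExactSeq (cone (cochains M) (cochains N)) (coneD (delta M) (delta N) g))
    (hM : HasHodgeDecomposition M) (hN : HasHodgeDecomposition N) {k : ℕ}
    (hg : ∀ c, g (hodgeProj M k c) = hodgeProj N k (g c)) :
    IsExactSeq (cone (hodge M k) (hodge N k)) (coneD (delta M) (delta N) g) := by
  refine hex.of_projection ((hodgeProj M k).prodMap (hodgeProj N k)) ?_ ?_ ?_ ?_
  · exact fun m x hx => ⟨hx.1.1, hx.2.1⟩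
  · exact fun m x hx => ⟨hodgeProj_mem hx.1 k, hodgeProj_mem hx.2 k⟩
  · exact fun m x hx => Prod.ext (hodgeProj_eq_self hx.1) (hodgeProj_eq_self hx.2)
  · rintro m ⟨c, e⟩ ⟨hc, he⟩
    simp only [LinearMap.prodMap_apply, coneD_apply, delta_hodgeProj hM hc, delta_hodgeProj hN he,
      hg, map_neg, map_add]

end HodgeDecomposition

section Functoriality

variable {F G : DGAlgebra.{u, v} K}

lemma coeffFam_hodgeProj {M N : DGBimodule F} (f : M.Hom N) (k : ℕ) (c : Fam M) :
    coeffFam f (hodgeProj M k c) = hodgeProj N k (coeffFam f c) := by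
  funext n
  refine multilinear_ext fun p a ha => ?_
  rw [coeffFam_apply, hodgeProj_apply, hodgeProj_apply, eulerian_apply M k _ ha,
    eulerian_apply N k _ ha, map_sum]
  simp only [map_smul, map_zsmul, coeffFam_apply]

lemma restrictFam_hodgeProj (φ : F.Hom G) (N : DGBimodule G) (k : ℕ) (c : Fam N) :
    restrictFam φ N (hodgeProj N k c) =
      hodgeProj (DGBimodule.restrict φ N) k (restrictFam φ N c) := by
  funext n
  refine multilinear_ext fun p a ha => ?_
  rw [restrictFam_apply, hodgeProj_apply, hodgeProj_apply,
    eulerian_apply N k _ (fun i => φ.map_mem (ha i)), eulerian_apply _ k _ ha]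
  rfl

variable [CharZero K]

theorem quasiIso_hodgeCoeffMap {M N : DGBimodule F} {f : M.Hom N} (hf : f.IsQuasiIso)
    (hM : HasHodgeDecomposition M) (hN : HasHodgeDecomposition N) (k : ℕ) :
    QuasiIso (hodgeCoeffMap f hM hN k) :=
  (quasiIso_iff_isExactSeq_cone (coeffFam f) (hM.1 k) (hN.1 k) (fun _ _ h => coeffFam_hodge f h)
    (fun _ => ModuleCat.hom_ext (LinearMap.ext fun c => Subtype.ext (delta_delta c.2.1)))
    (fun _ => ModuleCat.hom_ext (LinearMap.ext fun c => Subtype.ext (delta_delta c.2.1)))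
    (hodgeCoeffMap f hM hN k) fun _ => rfl).2
    (((quasiIso_coeffMap_iff f).1 (quasiIso_coeffMap hf)).cone_hodge hM hN
      (coeffFam_hodgeProj f k))

theorem quasiIso_hodgeRestrictMap {φ : F.Hom G} (hφ : φ.IsQuasiIso) {N : DGBimodule G}
    (hN : HasHodgeDecomposition N) (hN' : HasHodgeDecomposition (DGBimodule.restrict φ N)) (k : ℕ) :
    QuasiIso (hodgeRestrictMap φ N hN hN' k) :=
  (quasiIso_iff_isExactSeq_cone (restrictFam φ N) (hN.1 k) (hN'.1 k)
    (fun _ _ h => restrictFam_hodge φ N h)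
    (fun _ => ModuleCat.hom_ext (LinearMap.ext fun c => Subtype.ext (delta_delta c.2.1)))
    (fun _ => ModuleCat.hom_ext (LinearMap.ext fun c => Subtype.ext (delta_delta c.2.1)))
    (hodgeRestrictMap φ N hN hN' k) fun _ => rfl).2
    (((quasiIso_restrictMap_iff φ N).1 (quasiIso_restrictMap hφ N)).cone_hodge hN hN'
      (restrictFam_hodgeProj φ N k))

end Functoriality

end DGHochschild

end

open DGHochschild in
theorem mainTheorem10_general {K : Type u} [Field K] {F G : DGAlgebra.{u, v} K}
    {φ : F.Hom G} (hφ : φ.IsQuasiIso) {M : DGBimodule F} {N : DGBimodule G}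
    {f : M.Hom (DGBimodule.restrict φ N)} (hf : f.IsQuasiIso) :
    (QuasiIso (coeffMap f) ∧ QuasiIso (restrictMap φ N)) ∧
    (CharZero K → F.IsSupercommutative → G.IsSupercommutative → M.IsSymmetric → N.IsSymmetric →
      ∃ (h₁ : HasHodgeDecomposition M) (h₂ : HasHodgeDecomposition (DGBimodule.restrict φ N))
        (h₃ : HasHodgeDecomposition N),
        ∀ k : ℕ, QuasiIso (hodgeCoeffMap f h₁ h₂ k) ∧ QuasiIso (hodgeRestrictMap φ N h₃ h₂ k)) := by
  refine ⟨⟨quasiIso_coeffMap hf, quasiIso_restrictMap hφ N⟩, fun _ hF hG hM hN => ?_⟩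
  exact ⟨hasHodgeDecomposition hF hM, hasHodgeDecomposition hF (hN.restrict φ),
    hasHodgeDecomposition hG hN, fun k =>
      ⟨quasiIso_hodgeCoeffMap hf _ _ k, quasiIso_hodgeRestrictMap hφ _ _ k⟩⟩

theorem mainTheorem10 {K : Type u} [Field K] {Ft F : DGHochschild.DGAlgebra.{u, v} K}
    (φ : Ft.Hom F) (hφ : φ.IsQuasiIso) :
    (QuasiIso (DGHochschild.coeffMap (DGHochschild.DGBimodule.homOfAlgHom φ)) ∧
      QuasiIso (DGHochschild.restrictMap φ (DGHochschild.DGBimodule.regular F))) ∧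
    (CharZero K → Ft.IsSupercommutative → F.IsSupercommutative →
      ∃ (h₁ : DGHochschild.HasHodgeDecomposition (DGHochschild.DGBimodule.regular Ft))
        (h₂ : DGHochschild.HasHodgeDecomposition
          (DGHochschild.DGBimodule.restrict φ (DGHochschild.DGBimodule.regular F)))
        (h₃ : DGHochschild.HasHodgeDecomposition (DGHochschild.DGBimodule.regular F)),
        ∀ k : ℕ,
          QuasiIso (DGHochschild.hodgeCoeffMap (DGHochschild.DGBimodule.homOfAlgHom φ) h₁ h₂ k) ∧
          QuasiIso (DGHochschild.hodgeRestrictMap φ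
            (DGHochschild.DGBimodule.regular F) h₃ h₂ k)) := by
  have general := mainTheorem10_general hφ hφ.homOfAlgHom
  exact ⟨general.1, fun _ hFt hF => general.2 ‹_› hFt hF
    (DGHochschild.DGBimodule.isSymmetric_regular hFt)
    (DGHochschild.DGBimodule.isSymmetric_regular hF)⟩
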